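/- Let $\Omega=(0,1)\times\mathbb R$ with points $(x,v)$, $M(v)=(2\pi)^{-1/2}e^{-v^2/2}$, and for a function $g$ on $\Omega$ let $\|g\|_V^2=\|g\|_{L^2(\Omega)}^2+\|\partial_x g\|_{L^2(\Omega)}^2\in[0,\infty]$, where $\partial_xg$ is the weak derivative and the norm is $\infty$ if $g$ or $\partial_xg$ is not in $L^2(\Omega)$. Let $0<\varepsilon\le 1$, $0<\lambda\le\frac14$, $0<C_s\le 1$. (Here $\lambda$ is the constant in the coercivity inequality $-\langle\mathcal Lg,g\rangle\ge\lambda\|(1-\Pi)g\|_\omega^2$ of the linearized Fokker--Planck operator, where $\langle\mathcal Lg,g\rangle=-\int_\Omega M\,|\partial_v(g/\sqrt M)|^2\,dx\,dv$, $\Pi g=\big(\int_{\mathbb R} g\sqrt M\,dv\big)\sqrt M$ and $\|g\|_\omega^2=\|g\|^2+\|\partial_vg\|^2+\|vg\|^2$; $C_s$ is the constant in the Poincaré inequality $\|\sigma'\|^2\ge\frac{C_s}{2}\big(\|\sigma-\bar\sigma\|^2+\|\sigma'\|^2\big)$ on $H^1(0,1)$, $\bar\sigma=\int_0^1\sigma\,dx$,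 normalized to $0<C_s\le1$. All admissible values of these constants lie in the ranges above, and only these ranges are used.) Let $E:[0,\infty)\times[0,1]\to\mathbb R$ be continuous with $E(t,\cdot)\in C^3([0,1])$ for every $t\ge0$, and suppose that for some constant $C_E$ and all $t\ge 0$ $$\|E(t,\cdot)\|_{L^\infty},\ \|\partial_xE(t,\cdot)\|_{L^\infty},\ \|\partial_x^3E(t,\cdot)\|_{L^\infty}\le\frac{C_E}{2}\le\frac{\lambda C_s}{16},\qquad E(t,0)=E(t,1)=0,\quad \partial_x^2E(t,0)=\partial_x^2E(t,1).$$ Let $f\in C^0([0,\infty);H^1(\Omega))$ be a weak (distributional) solution of $$\varepsilon\,\partial_tf+v\,\partial_xf-E\,\partial_vf=\frac1\varepsilon\,\partial_v\Big(M\,\partial_v\frac fM\Big)\quad\text{in }(0,\infty)\times\Omega$$ satisfying for every $t\ge0$, in the sense of traces, the feedback boundary conditions $$f(t,0,v)=k_{00}f(t,0,-v)+k_{10}f(t,1,v)\ (v>0),\qquad f(t,1,v)=k_{01}f(t,0,v)+k_{11}f(t,1,-v)\ (v<0)$$ with $k_{00}=k_{11}=0$ and $k_{01}=k_{10}=1$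 (periodic feedback). Assume that $f(0)$ is integrable with $\int_\Omega f(0,x,v)\,dx\,dv=0$. Then for every $a$ with $$\frac{4C_E}{3C_s-2C_E}<a<\frac{\lambda-C_E}{4}$$ one has $$\xi:=\min\Big\{\frac{\lambda-C_E-4a}{\varepsilon^2},\ \frac{a(3C_s-2C_E)-4C_E}{8}\Big\}>0$$ and $$\Big\|\frac{f(t)}{\sqrt M}\Big\|_V^2\le\frac54\,\Big\|\frac{f(0)}{\sqrt M}\Big\|_V^2\,e^{-2\xi t}\qquad\text{for all }t\ge0 .$$ No lower bound on $C_E$ is needed; in particular the estimate holds in the case $C_E\ge\frac{3C_s}{2}-\frac{3C_s}{2+C_B(t)}$, where $C_B(t)=\dfrac{(\sqrt A-\sqrt B)^2+(\sqrt{A_x}-\sqrt{B_x})^2}{2(\sqrt A+\sqrt B)(\sqrt{A_x}+\sqrt{B_x})}$ is formed from the boundary terms $A=\int_{-\infty}^0\frac{|v|}{2}h^2(t,0,v)\,dv$, $B=\int_0^\infty\frac v2h^2(t,1,v)\,dv$ of $h=f/\sqrt M$ and the corresponding terms $A_x,B_x$ with $\partial_xh$ in place of $h$ (where these exist). -/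

import Mathlib

open MeasureTheory Set
open scoped ContDiff

noncomputable section

namespace VFP

/-- The (open) phase space `Ω = (0,1) × ℝ`, with points `(x, v)`. -/
def phaseSpace : Set (ℝ × ℝ) := Ioo (0 : ℝ) 1 ×ˢ univ

/-- Lebesgue measure `dx dv` on the phase space. -/
def phaseMeasure : Measure (ℝ × ℝ) := volume.restrict phaseSpace

/-- The global Maxwellian `M(v) = (2π)^{-1/2} exp(-v²/2)`. -/
def maxwellian (v : ℝ) : ℝ := (Real.sqrt (2 * Real.pi))⁻¹ * Real.exp (-(v ^ 2) / 2)

/-- `g'` is the weak derivative of `g` on `Ω` in the direction `e`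
(`e = (1,0)` gives `∂_x`, `e = (0,1)` gives `∂_v`). -/
def HasWeakPartial (g : ℝ × ℝ → ℝ) (e : ℝ × ℝ) (g' : ℝ × ℝ → ℝ) : Prop :=
  LocallyIntegrableOn g phaseSpace ∧ LocallyIntegrableOn g' phaseSpace ∧
    ∀ φ : ℝ × ℝ → ℝ, ContDiff ℝ ∞ φ → HasCompactSupport φ → tsupport φ ⊆ phaseSpace →
      ∫ z, g z * fderiv ℝ φ z e ∂phaseMeasure = -∫ z, g' z * φ z ∂phaseMeasure

/-- The squared norm `‖g‖_V² = ‖g‖² + ‖∂_x g‖²` on `Ω`, with values in `[0, ∞]`.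
The weak derivative is unique up to null sets, so the infimum is `‖∂_x g‖²` where `∂_x g`
exists, and it is `∞` where it does not. -/
def vNormSq (g : ℝ × ℝ → ℝ) : ENNReal :=
  (∫⁻ z, ENNReal.ofReal (g z ^ 2) ∂phaseMeasure) +
    ⨅ (gx : ℝ × ℝ → ℝ) (_ : HasWeakPartial g (1, 0) gx),
      ∫⁻ z, ENNReal.ofReal (gx z ^ 2) ∂phaseMeasure

/-- The weighted distribution `h = f / √M`. -/
def weighted (f : ℝ × ℝ → ℝ) (z : ℝ × ℝ) : ℝ := f z / Real.sqrt (maxwellian z.2)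

/-- `f ∈ C⁰([0,∞); H¹(Ω))`: `f`, `∂_x f` and `∂_v f` are continuous in time with values
in `L²(Ω)`. -/
def ContinuousInH1 (f : ℝ → Lp ℝ 2 phaseMeasure) : Prop :=
  ∃ fx fv : ℝ → Lp ℝ 2 phaseMeasure,
    ContinuousOn f (Ici 0) ∧ ContinuousOn fx (Ici 0) ∧ ContinuousOn fv (Ici 0) ∧
    ∀ t, 0 ≤ t → HasWeakPartial (f t) (1, 0) (fx t) ∧ HasWeakPartial (f t) (0, 1) (fv t)

/-- `γ₀` and `γ₁` are the traces of `g` at `x = 0` and at `x = 1`: they are the functions for which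
the integration by parts formula in `x` holds against test functions that need not vanish at the
boundary. -/
def HasTraces (g : ℝ × ℝ → ℝ) (γ₀ γ₁ : ℝ → ℝ) : Prop :=
  MemLp γ₀ 2 volume ∧ MemLp γ₁ 2 volume ∧
    ∃ gx : ℝ × ℝ → ℝ, MemLp gx 2 phaseMeasure ∧ HasWeakPartial g (1, 0) gx ∧
      ∀ φ : ℝ × ℝ → ℝ, ContDiff ℝ ∞ φ → HasCompactSupport φ →
        (∫ z, g z * fderiv ℝ φ z (1, 0) ∂phaseMeasure) + ∫ z, gx z * φ z ∂phaseMeasure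
          = (∫ v, γ₁ v * φ (1, v)) - ∫ v, γ₀ v * φ (0, v)

/-- The feedback boundary condition with `K = [[k₀₀, k₁₀], [k₀₁, k₁₁]]`:
`g(0,v) = k₀₀ g(0,-v) + k₁₀ g(1,v)` for `v > 0` and
`g(1,v) = k₀₁ g(0,v) + k₁₁ g(1,-v)` for `v < 0`, in the sense of traces. -/
def FeedbackBC (K : Matrix (Fin 2) (Fin 2) ℝ) (g : ℝ × ℝ → ℝ) : Prop :=
  ∃ γ₀ γ₁ : ℝ → ℝ, HasTraces g γ₀ γ₁ ∧
    (∀ᵐ v : ℝ, 0 < v → γ₀ v = K 0 0 * γ₀ (-v) + K 0 1 * γ₁ v) ∧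
    (∀ᵐ v : ℝ, v < 0 → γ₁ v = K 1 0 * γ₀ v + K 1 1 * γ₁ (-v))

/-- The formal adjoint `ψ ↦ M⁻¹ ∂_v (M ∂_v ψ)` of the Fokker-Planck operator
`𝓕 f = ∂_v (M ∂_v (f / M))`. -/
def fokkerPlanckAdjoint (ψ : ℝ → ℝ) (v : ℝ) : ℝ :=
  (maxwellian v)⁻¹ * deriv (fun w => maxwellian w * deriv ψ w) v

/-- `ε ∂_t f + v ∂_x f - E ∂_v f = ε⁻¹ 𝓕 f` in the sense of distributions on
`(0,∞) × (0,1) × ℝ`. -/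
def SolvesVFP (ε : ℝ) (E : ℝ → ℝ → ℝ) (f : ℝ → Lp ℝ 2 phaseMeasure) : Prop :=
  ∀ φ : ℝ × ℝ × ℝ → ℝ, ContDiff ℝ ∞ φ → HasCompactSupport φ →
    tsupport φ ⊆ Ioi (0 : ℝ) ×ˢ phaseSpace →
    ∫ t in Ioi (0 : ℝ), ∫ z, f t z *
      (ε * deriv (fun s => φ (s, z.1, z.2)) t
        + z.2 * deriv (fun y => φ (t, y, z.2)) z.1
        - E t z.1 * deriv (fun w => φ (t, z.1, w)) z.2
        + ε⁻¹ * fokkerPlanckAdjoint (fun w => φ (t, z.1, w)) z.2) ∂phaseMeasure = 0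

/-- Weak solutions `f ∈ C⁰([0,∞); H¹(Ω))` of the Vlasov-Fokker-Planck equation with
feedback boundary condition. -/
structure IsWeakSolution (ε : ℝ) (E : ℝ → ℝ → ℝ) (K : Matrix (Fin 2) (Fin 2) ℝ)
    (f : ℝ → Lp ℝ 2 phaseMeasure) : Prop where
  continuousInH1 : ContinuousInH1 f
  solves : SolvesVFP ε E f
  boundary : ∀ t, 0 ≤ t → FeedbackBC K (f t)

/-- The assumptions on the electric field `E : [0,∞) × [0,1] → ℝ`. The values of `E` elsewhere
play no role. -/
structure FieldAssumption (E : ℝ → ℝ → ℝ) (C_E lam C_s : ℝ) : Prop where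
  continuousOn : ContinuousOn (fun p : ℝ × ℝ => E p.1 p.2) (Ici 0 ×ˢ Icc 0 1)
  contDiffOn : ∀ t, 0 ≤ t → ContDiffOn ℝ 3 (E t) (Icc 0 1)
  bound_zero : ∀ t, 0 ≤ t → ∀ x ∈ Icc (0 : ℝ) 1, |E t x| ≤ C_E / 2
  bound_one : ∀ t, 0 ≤ t → ∀ x ∈ Icc (0 : ℝ) 1,
    |iteratedDerivWithin 1 (E t) (Icc 0 1) x| ≤ C_E / 2
  bound_three : ∀ t, 0 ≤ t → ∀ x ∈ Icc (0 : ℝ) 1,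
    |iteratedDerivWithin 3 (E t) (Icc 0 1) x| ≤ C_E / 2
  small : C_E / 2 ≤ lam * C_s / 16
  left_zero : ∀ t, 0 ≤ t → E t 0 = 0
  right_zero : ∀ t, 0 ≤ t → E t 1 = 0
  second_periodic : ∀ t, 0 ≤ t →
    iteratedDerivWithin 2 (E t) (Icc 0 1) 0 = iteratedDerivWithin 2 (E t) (Icc 0 1) 1

/-- The decay rate `ξ`. -/
def rate (ε lam C_s C_E a : ℝ) : ℝ :=
  min ((lam - C_E - 4 * a) / ε ^ 2) ((a * (3 * C_s - 2 * C_E) - 4 * C_E) / 8)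

end VFP

end

/-!
Let `h = f / √M`. The proof is the hypocoercivity argument with the functional
`‖h‖² + ‖∂ₓh‖² + 2 a ε ⟨∫ v h √M dv, ∂ₓ ∫ h √M dv⟩`, carried out for weak solutions without any
smoothing of the solution.

*Derivatives as generators.* The periodic feedback turns the interval into a circle, so rotations
in `x` and translations in `v` are groups of isometries of `L²(Ω)` which commute with each other.
A weak derivative in `L²` is the same as a value of the generator of such a group (`Gen`,
`gen_rotX_of_weakPeriodic`, `gen_transV_of_hasWeakPartial`), and integration by parts without
boundary terms is the skewness of a generator (`Gen.inner_skew`). After multiplication with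
`ω = (1 + v²)⁻¹` all coefficients of the equation are bounded, and it says that the time integral
of a flux has a prescribed velocity derivative in `L²` (`Sol`, `IsWeakSolution.exists_sol`).

*Energy inequalities.* The weight `1 / M` is unbounded, and it is not known in advance that `f(t)`
has a finite weighted norm at positive times. Therefore `M` is replaced by
`M + η (1 + v²)` with `η > 0`. The regularized energy satisfies an inequality whose dissipation is
the one of the Fokker-Planck operator, up to a defect that vanishes as `η → 0` (`Sol.energy_le`).
The microscopic coercivity is the Gaussian Poincaré inequality (`gaussian_poincare`). The
inequality for `∂ₓf` follows from those for difference quotients in `x`, which solve the same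
equation up to the increments of the field (`Sol.energy_deriv_le_of_field`). Used first with a very
negative rate, these inequalities bound the regularized energies uniformly in `η`, so that `h(t)`
and `∂ₓh(t)` are in `L²` (`Sol.exists_rootM`).

*Dissipation of the density.* The energy only controls the distance of `h` to its density
`∫ h √M dv` times `√M`. The derivative of the cross term produces the negative square of
`∂ₓ ∫ h √M dv` (`Sol.hasDerivWithinAt_crossTerm`). The mass is conserved (`IsWeighted.mass_eq`), so
the Poincaré inequality on the circle (`norm_le_of_gen_rotS`) bounds the density by this derivative.

*Conclusion.* In the limit `η → 0` the functional times `exp (r t)` decreases as long as a certain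
limiting growth rate is not positive (`IsWeighted.functional_le`). With `r = 2 ξ` this reduces to a
quadratic form in the norms of the microscopic part, of the density and of their derivatives
(`totalGrowth_nonpos`, `quadratic_form_nonpos`). The functional is comparable with
`‖h‖² + ‖∂ₓh‖²` up to the factors `1 ± a`, which costs at most `5 / 4`
(`IsWeighted.norm_sq_le`), and this sum is the squared `V`-norm of `h` (`vNormSq_weighted_eq`).
If the initial norm is infinite there is nothing to prove.
-/

open MeasureTheory Set
open scoped ContDiff

noncomputable section

namespace VFP

open Filter Topology

/-! ### Square-integrable functions: multiplication operators and tensor products -/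

section General

variable {α : Type*} [MeasurableSpace α] {μ : Measure α}

lemma inner_eq_integral (f g : Lp ℝ 2 μ) : inner ℝ f g = ∫ x, f x * g x ∂μ := by
  rw [L2.inner_def]
  refine integral_congr_ae (Eventually.of_forall fun x => ?_)
  simp [mul_comm]

lemma norm_sq_eq_integral (f : Lp ℝ 2 μ) : ‖f‖ ^ 2 = ∫ x, f x ^ 2 ∂μ := by
  rw [← real_inner_self_eq_norm_sq, inner_eq_integral]
  simp only [sq]

lemma integrable_mul_Lp (f g : Lp ℝ 2 μ) : Integrable (fun x => f x * g x) μ :=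
  (Lp.memLp f).integrable_mul (Lp.memLp g)

/-- Dominated convergence in `L²`. -/
lemma tendsto_Lp_of_dominated {ι : Type*} {l : Filter ι} [l.IsCountablyGenerated]
    {F : ι → Lp ℝ 2 μ} {F₀ : Lp ℝ 2 μ} {G : α → ℝ} (hG : MemLp G 2 μ)
    (hb : ∀ᶠ i in l, ∀ᵐ x ∂μ, |F i x| ≤ G x) (hb₀ : ∀ᵐ x ∂μ, |F₀ x| ≤ G x)
    (hlim : ∀ᵐ x ∂μ, Tendsto (fun i => F i x) l (𝓝 (F₀ x))) :
    Tendsto F l (𝓝 F₀) := by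
  rw [tendsto_iff_norm_sub_tendsto_zero]
  have key : Tendsto (fun i => ‖F i - F₀‖ ^ 2) l (𝓝 0) := by
    have h0 : (0 : ℝ) = ∫ _x, (0 : ℝ) ∂μ := by simp
    have h1 : ∀ i, ‖F i - F₀‖ ^ 2 = ∫ x, (F i x - F₀ x) ^ 2 ∂μ := fun i => by
      rw [norm_sq_eq_integral]
      refine integral_congr_ae ?_
      filter_upwards [Lp.coeFn_sub (F i) F₀] with x hx
      rw [hx]; rfl
    simp only [h1]
    rw [h0]
    refine tendsto_integral_filter_of_dominated_convergence (fun x => (2 * G x) ^ 2) ?_ ?_ ?_ ?_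
    · exact Eventually.of_forall fun i =>
        (((Lp.aestronglyMeasurable (F i)).sub (Lp.aestronglyMeasurable F₀)).pow 2)
    · filter_upwards [hb] with i hi
      filter_upwards [hi, hb₀] with x h1 h2
      rw [Real.norm_eq_abs, abs_pow]
      have : |F i x - F₀ x| ≤ 2 * G x := (abs_sub _ _).trans (by linarith)
      exact pow_le_pow_left₀ (abs_nonneg _) this 2
    · exact (hG.const_mul 2).integrable_sq
    · filter_upwards [hlim] with x hx
      have := (hx.sub_const (F₀ x)).pow 2
      simpa using this
  have := key.sqrt
  simpa [Real.sqrt_sq (norm_nonneg _)] using this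

/-- Bounded measurable functions, the symbols of the multiplication operators `mulL`. -/
structure Bdd (b : α → ℝ) : Prop where
  measurable : Measurable b
  bounded : ∃ C, ∀ x, |b x| ≤ C

lemma Bdd.mul {b c : α → ℝ} (hb : Bdd b) (hc : Bdd c) : Bdd (fun x => b x * c x) := by
  obtain ⟨B, hB⟩ := hb.bounded
  obtain ⟨C, hC⟩ := hc.bounded
  refine ⟨hb.measurable.mul hc.measurable, B * C, fun x => ?_⟩
  rw [abs_mul]
  exact mul_le_mul (hB x) (hC x) (abs_nonneg _) ((abs_nonneg _).trans (hB x))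

lemma Bdd.add {b c : α → ℝ} (hb : Bdd b) (hc : Bdd c) : Bdd (fun x => b x + c x) := by
  obtain ⟨B, hB⟩ := hb.bounded
  obtain ⟨C, hC⟩ := hc.bounded
  exact ⟨hb.measurable.add hc.measurable, B + C, fun x =>
    (abs_add_le _ _).trans (add_le_add (hB x) (hC x))⟩

lemma Bdd.const (c : ℝ) : Bdd (fun _ : α => c) := ⟨measurable_const, |c|, fun _ => le_rfl⟩

lemma Bdd.const_mul {b : α → ℝ} (hb : Bdd b) (c : ℝ) : Bdd (fun x => c * b x) :=
  (Bdd.const c).mul hb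

lemma Bdd.neg {b : α → ℝ} (hb : Bdd b) : Bdd (fun x => -b x) := by
  simpa using hb.const_mul (-1)

lemma Bdd.sub {b c : α → ℝ} (hb : Bdd b) (hc : Bdd c) : Bdd (fun x => b x - c x) := by
  simpa [sub_eq_add_neg] using hb.add hc.neg

lemma Bdd.memLp {b : α → ℝ} (hb : Bdd b) (f : Lp ℝ 2 μ) :
    MemLp (fun x => b x * f x) 2 μ := by
  obtain ⟨C, hC⟩ := hb.bounded
  refine (Lp.memLp f).of_le_mul (c := C)
    (hb.measurable.aestronglyMeasurable.mul (Lp.aestronglyMeasurable f))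
    (Eventually.of_forall fun x => ?_)
  rw [norm_mul]
  exact mul_le_mul_of_nonneg_right (hC x) (norm_nonneg _)

lemma Bdd.norm_toLp_le {b : α → ℝ} (hb : Bdd b) {C : ℝ} (hC : ∀ x, |b x| ≤ C) (f : Lp ℝ 2 μ) :
    ‖(hb.memLp f).toLp _‖ ≤ C * ‖f‖ := by
  refine Lp.norm_le_mul_norm_of_ae_le_mul ?_
  filter_upwards [(hb.memLp f).coeFn_toLp] with x hx
  rw [hx, norm_mul]
  exact mul_le_mul_of_nonneg_right (hC x) (norm_nonneg _)

open Classical in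
/-- Multiplication by `b` on `L²`; it is `0` unless `b` is bounded and measurable. -/
def mulL (b : α → ℝ) : Lp ℝ 2 μ →L[ℝ] Lp ℝ 2 μ :=
  if hb : Bdd b then
    LinearMap.mkContinuous
      { toFun := fun f => (hb.memLp f).toLp _
        map_add' := fun f g => by
          refine Lp.ext ?_
          filter_upwards [(hb.memLp (f + g)).coeFn_toLp, (hb.memLp f).coeFn_toLp,
            (hb.memLp g).coeFn_toLp, Lp.coeFn_add f g,
            Lp.coeFn_add ((hb.memLp f).toLp _) ((hb.memLp g).toLp _)] with x h1 h2 h3 h4 h5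
          rw [h1, h5, Pi.add_apply, h2, h3, h4, Pi.add_apply, mul_add]
        map_smul' := fun c f => by
          refine Lp.ext ?_
          filter_upwards [(hb.memLp (c • f)).coeFn_toLp, (hb.memLp f).coeFn_toLp,
            Lp.coeFn_smul c f, Lp.coeFn_smul c ((hb.memLp f).toLp _)] with x h1 h2 h3 h4
          rw [h1, RingHom.id_apply, h4, Pi.smul_apply, h2, h3, Pi.smul_apply]
          simp only [smul_eq_mul]; ring }
      hb.bounded.choose (fun f => hb.norm_toLp_le hb.bounded.choose_spec f)
  else 0

lemma mulL_coe {b : α → ℝ} (hb : Bdd b) (f : Lp ℝ 2 μ) :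
    mulL b f =ᵐ[μ] fun x => b x * f x := by
  rw [mulL, dif_pos hb]
  exact (hb.memLp f).coeFn_toLp

lemma norm_mulL_le {b : α → ℝ} (hb : Bdd b) {C : ℝ} (hC : ∀ x, |b x| ≤ C) (f : Lp ℝ 2 μ) :
    ‖mulL b f‖ ≤ C * ‖f‖ := by
  rw [mulL, dif_pos hb]
  exact hb.norm_toLp_le hC f

lemma inner_mulL {b : α → ℝ} (hb : Bdd b) (f g : Lp ℝ 2 μ) :
    inner ℝ (mulL b f) g = ∫ x, b x * f x * g x ∂μ := by
  rw [inner_eq_integral]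
  refine integral_congr_ae ?_
  filter_upwards [mulL_coe hb f] with x hx
  rw [hx]

lemma integrable_mulL {b : α → ℝ} (hb : Bdd b) (f g : Lp ℝ 2 μ) :
    Integrable (fun x => b x * f x * g x) μ := by
  refine (integrable_mul_Lp (mulL b f) g).congr ?_
  filter_upwards [mulL_coe hb f] with x hx
  rw [hx]

lemma inner_mulL_comm (b : α → ℝ) (f g : Lp ℝ 2 μ) :
    inner ℝ (mulL b f) g = inner ℝ f (mulL b g) := by
  by_cases hb : Bdd b
  · rw [← real_inner_comm f, inner_mulL hb, inner_mulL hb]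
    refine integral_congr_ae (Eventually.of_forall fun x => ?_)
    simp only
    ring
  · simp [mulL, hb]

lemma mulL_mul {b c : α → ℝ} (hb : Bdd b) (hc : Bdd c) (f : Lp ℝ 2 μ) :
    mulL b (mulL c f) = mulL (fun x => b x * c x) f := by
  refine Lp.ext ?_
  filter_upwards [mulL_coe hb (mulL c f), mulL_coe hc f, mulL_coe (hb.mul hc) f] with x h1 h2 h3
  rw [h1, h2, h3, mul_assoc]

lemma mulL_add {b c : α → ℝ} (hb : Bdd b) (hc : Bdd c) (f : Lp ℝ 2 μ) :
    mulL (fun x => b x + c x) f = mulL b f + mulL c f := by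
  refine Lp.ext ?_
  filter_upwards [mulL_coe hb f, mulL_coe hc f, mulL_coe (hb.add hc) f,
    Lp.coeFn_add (mulL b f) (mulL c f)] with x h1 h2 h3 h4
  rw [h3, h4, Pi.add_apply, h1, h2, add_mul]

lemma mulL_const_mul {b : α → ℝ} (hb : Bdd b) (c : ℝ) (f : Lp ℝ 2 μ) :
    mulL (fun x => c * b x) f = c • mulL b f := by
  refine Lp.ext ?_
  filter_upwards [mulL_coe hb f, mulL_coe (hb.const_mul c) f,
    Lp.coeFn_smul c (mulL b f)] with x h1 h2 h3
  rw [h2, h3, Pi.smul_apply, h1, smul_eq_mul, mul_assoc]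

lemma mulL_one (f : Lp ℝ 2 μ) : mulL (fun _ => 1) f = f := by
  refine Lp.ext ?_
  filter_upwards [mulL_coe (Bdd.const 1) f] with x h1
  rw [h1, one_mul]

lemma mulL_zero (f : Lp ℝ 2 μ) : mulL (fun _ => 0) f = 0 := by
  refine Lp.ext ?_
  filter_upwards [mulL_coe (Bdd.const 0) f, Lp.coeFn_zero ℝ 2 μ] with x h1 h2
  rw [h1, h2, zero_mul, Pi.zero_apply]

lemma mulL_injective {b : α → ℝ} (hb : Bdd b) (h0 : ∀ x, b x ≠ 0) {f : Lp ℝ 2 μ}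
    (hf : mulL b f = 0) : f = 0 := by
  refine Lp.ext ?_
  have h2 : mulL b f =ᵐ[μ] 0 := by rw [hf]; exact Lp.coeFn_zero ℝ 2 μ
  filter_upwards [mulL_coe hb f, h2, Lp.coeFn_zero ℝ 2 μ] with x h1 h2 h3
  rw [h3]
  rw [h1] at h2
  simpa [h0 x] using h2

lemma inner_mulL_nonneg {b : α → ℝ} (hb : Bdd b) (h0 : ∀ x, 0 ≤ b x) (f : Lp ℝ 2 μ) :
    0 ≤ inner ℝ (mulL b f) f := by
  rw [inner_mulL hb]
  refine integral_nonneg fun x => ?_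
  simp only [mul_assoc]
  exact mul_nonneg (h0 x) (mul_self_nonneg _)

lemma inner_mulL_mono {b c : α → ℝ} (hb : Bdd b) (hc : Bdd c) (h : ∀ x, b x ≤ c x)
    (f : Lp ℝ 2 μ) : inner ℝ (mulL b f) f ≤ inner ℝ (mulL c f) f := by
  rw [inner_mulL hb, inner_mulL hc]
  refine integral_mono (integrable_mulL hb f f) (integrable_mulL hc f f) fun x => ?_
  simp only [mul_assoc]
  exact mul_le_mul_of_nonneg_right (h x) (mul_self_nonneg _)

lemma tendsto_mulL {ι : Type*} {l : Filter ι} [l.IsCountablyGenerated] {b : ι → α → ℝ}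
    {b₀ : α → ℝ} (hb : ∀ i, Bdd (b i)) (hb₀ : Bdd b₀) {C : ℝ} (hC : ∀ i x, |b i x| ≤ C)
    (hlim : ∀ x, Tendsto (fun i => b i x) l (𝓝 (b₀ x))) (f : Lp ℝ 2 μ) :
    Tendsto (fun i => mulL (b i) f) l (𝓝 (mulL b₀ f)) := by
  obtain ⟨C₀, hC₀⟩ := hb₀.bounded
  by_cases hl : l.NeBot
  swap
  · rw [not_neBot] at hl; subst hl; exact tendsto_bot
  have hC0' : ∀ x, |b₀ x| ≤ C := fun x =>
    le_of_tendsto (hlim x).abs (Eventually.of_forall fun i => hC i x)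
  have hall : ∀ᵐ x ∂μ, True := Eventually.of_forall fun _ => trivial
  -- countably many a.e. equalities are not available over a general index, so convergence is
  -- reduced to sequences
  rw [tendsto_iff_seq_tendsto]
  intro u hu
  have hae : ∀ᵐ x ∂μ, ∀ n, mulL (b (u n)) f x = b (u n) x * f x :=
    ae_all_iff.2 fun n => mulL_coe (hb (u n)) f
  refine tendsto_Lp_of_dominated (G := fun x => C * |f x|) ((Lp.memLp f).abs.const_mul C) ?_ ?_ ?_
  · refine Eventually.of_forall fun n => ?_
    filter_upwards [hae] with x hx
    simp only [Function.comp]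
    rw [hx n, abs_mul]
    exact mul_le_mul_of_nonneg_right (hC _ x) (abs_nonneg _)
  · filter_upwards [mulL_coe hb₀ f] with x hx
    rw [hx, abs_mul]
    exact mul_le_mul_of_nonneg_right (hC0' x) (abs_nonneg _)
  · filter_upwards [hae, mulL_coe hb₀ f] with x hx hx0
    simp only [Function.comp, hx, hx0]
    exact (((hlim x).comp hu).mul_const _)

open Classical in
/-- The class of `c` in `L²`; it is `0` unless `c` is square-integrable. -/
def toL2 (μ : Measure α) (c : α → ℝ) : Lp ℝ 2 μ := if h : MemLp c 2 μ then h.toLp c else 0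

lemma toL2_coe {c : α → ℝ} (hc : MemLp c 2 μ) : toL2 μ c =ᵐ[μ] c := by
  rw [toL2, dif_pos hc]; exact hc.coeFn_toLp

lemma mulL_toL2 {b c : α → ℝ} (hb : Bdd b) (hc : MemLp c 2 μ) :
    mulL b (toL2 μ c) = toL2 μ (fun x => b x * c x) := by
  have hbc : MemLp (fun x => b x * c x) 2 μ := by
    refine (Lp.memLp (mulL b (toL2 μ c))).ae_eq ?_
    filter_upwards [mulL_coe hb (toL2 μ c), toL2_coe hc] with x h1 h2
    rw [h1, h2]
  refine Lp.ext ?_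
  filter_upwards [mulL_coe hb (toL2 μ c), toL2_coe hc, toL2_coe hbc] with x h1 h2 h3
  rw [h1, h2, h3]

lemma inner_toL2 {b c : α → ℝ} (hb : MemLp b 2 μ) (hc : MemLp c 2 μ) :
    inner ℝ (toL2 μ b) (toL2 μ c) = ∫ x, b x * c x ∂μ := by
  rw [inner_eq_integral]
  refine integral_congr_ae ?_
  filter_upwards [toL2_coe hb, toL2_coe hc] with x h1 h2
  rw [h1, h2]

end General

/-- Lebesgue measure on `(0,1)`. -/
abbrev unitMeasure : Measure ℝ := volume.restrict (Ioo (0 : ℝ) 1)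

/-- `L²(Ω)`. -/
abbrev PhaseL2 : Type := Lp ℝ 2 phaseMeasure

/-- `L²(0,1)`, the space of functions of `x`. -/
abbrev SpaceL2 : Type := Lp ℝ 2 unitMeasure

/-- `L²(ℝ)`, the space of functions of `v`. -/
abbrev VelL2 : Type := Lp ℝ 2 (volume : Measure ℝ)

lemma phaseMeasure_eq : phaseMeasure = unitMeasure.prod volume := by
  rw [phaseMeasure, phaseSpace, Measure.volume_eq_prod, ← Measure.prod_restrict,
    Measure.restrict_univ]

instance : SFinite phaseMeasure := by rw [phaseMeasure]; infer_instance

lemma measurableSet_phaseSpace : MeasurableSet phaseSpace :=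
  measurableSet_Ioo.prod MeasurableSet.univ

lemma isOpen_phaseSpace : IsOpen phaseSpace := isOpen_Ioo.prod isOpen_univ

lemma ae_fst {p : ℝ → Prop} (h : ∀ᵐ x ∂unitMeasure, p x) : ∀ᵐ z ∂phaseMeasure, p z.1 := by
  rw [phaseMeasure_eq]; exact Measure.quasiMeasurePreserving_fst.ae h

lemma ae_snd {p : ℝ → Prop} (h : ∀ᵐ x : ℝ, p x) : ∀ᵐ z ∂phaseMeasure, p z.2 := by
  rw [phaseMeasure_eq]; exact Measure.quasiMeasurePreserving_snd.ae h

lemma memLp_tensor {s c : ℝ → ℝ} (hs : MemLp s 2 unitMeasure) (hc : MemLp c 2 volume) :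
    MemLp (fun z : ℝ × ℝ => s z.1 * c z.2) 2 phaseMeasure := by
  rw [phaseMeasure_eq]
  have hm : AEStronglyMeasurable (fun z : ℝ × ℝ => s z.1 * c z.2) (unitMeasure.prod volume) :=
    hs.1.comp_fst.mul hc.1.comp_snd
  rw [memLp_two_iff_integrable_sq hm]
  have := hs.integrable_sq.mul_prod hc.integrable_sq
  refine this.congr (Eventually.of_forall fun z => ?_)
  simp only
  ring

lemma norm_tensor (s : SpaceL2) (c : VelL2) :
    ‖(memLp_tensor (Lp.memLp s) (Lp.memLp c)).toLp _‖ = ‖s‖ * ‖c‖ := by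
  have h : ‖(memLp_tensor (Lp.memLp s) (Lp.memLp c)).toLp _‖ ^ 2 = (‖s‖ * ‖c‖) ^ 2 := by
    rw [norm_sq_eq_integral, mul_pow, norm_sq_eq_integral, norm_sq_eq_integral,
      ← integral_prod_mul, ← phaseMeasure_eq]
    refine integral_congr_ae ?_
    filter_upwards [(memLp_tensor (Lp.memLp s) (Lp.memLp c)).coeFn_toLp] with z hz
    rw [hz, mul_pow]
  exact (pow_left_inj₀ (norm_nonneg _) (by positivity) two_ne_zero).1 h

/-- The bounded bilinear map `(s, c) ↦ s(x) c(v)` from `L²(0,1) × L²(ℝ)` to `L²(Ω)`. -/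
def tensor : SpaceL2 →L[ℝ] VelL2 →L[ℝ] PhaseL2 :=
  LinearMap.mkContinuous₂
    (LinearMap.mk₂ ℝ (fun s c => (memLp_tensor (Lp.memLp s) (Lp.memLp c)).toLp _)
      (fun s s' c => by
        refine Lp.ext ?_
        filter_upwards [(memLp_tensor (Lp.memLp (s + s')) (Lp.memLp c)).coeFn_toLp,
          (memLp_tensor (Lp.memLp s) (Lp.memLp c)).coeFn_toLp,
          (memLp_tensor (Lp.memLp s') (Lp.memLp c)).coeFn_toLp, ae_fst (Lp.coeFn_add s s'),
          Lp.coeFn_add ((memLp_tensor (Lp.memLp s) (Lp.memLp c)).toLp _)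
            ((memLp_tensor (Lp.memLp s') (Lp.memLp c)).toLp _)] with z h1 h2 h3 h4 h5
        rw [h1, h5, Pi.add_apply, h2, h3, h4, Pi.add_apply, add_mul])
      (fun r s c => by
        refine Lp.ext ?_
        filter_upwards [(memLp_tensor (Lp.memLp (r • s)) (Lp.memLp c)).coeFn_toLp,
          (memLp_tensor (Lp.memLp s) (Lp.memLp c)).coeFn_toLp,
          ae_fst (Lp.coeFn_smul r s),
          Lp.coeFn_smul r ((memLp_tensor (Lp.memLp s) (Lp.memLp c)).toLp _)] with z h1 h2 h4 h5
        rw [h1, h5, Pi.smul_apply, h2, h4, Pi.smul_apply, smul_eq_mul, smul_eq_mul, mul_assoc])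
      (fun s c c' => by
        refine Lp.ext ?_
        filter_upwards [(memLp_tensor (Lp.memLp s) (Lp.memLp (c + c'))).coeFn_toLp,
          (memLp_tensor (Lp.memLp s) (Lp.memLp c)).coeFn_toLp,
          (memLp_tensor (Lp.memLp s) (Lp.memLp c')).coeFn_toLp, ae_snd (Lp.coeFn_add c c'),
          Lp.coeFn_add ((memLp_tensor (Lp.memLp s) (Lp.memLp c)).toLp _)
            ((memLp_tensor (Lp.memLp s) (Lp.memLp c')).toLp _)] with z h1 h2 h3 h4 h5
        rw [h1, h5, Pi.add_apply, h2, h3, h4, Pi.add_apply, mul_add])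
      (fun r s c => by
        refine Lp.ext ?_
        filter_upwards [(memLp_tensor (Lp.memLp s) (Lp.memLp (r • c))).coeFn_toLp,
          (memLp_tensor (Lp.memLp s) (Lp.memLp c)).coeFn_toLp,
          ae_snd (Lp.coeFn_smul r c),
          Lp.coeFn_smul r ((memLp_tensor (Lp.memLp s) (Lp.memLp c)).toLp _)] with z h1 h2 h4 h5
        rw [h1, h5, Pi.smul_apply, h2, h4, Pi.smul_apply, smul_eq_mul, smul_eq_mul]; ring))
    1 (fun s c => by
      rw [LinearMap.mk₂_apply, norm_tensor, one_mul])

lemma tensor_coe (s : SpaceL2) (c : VelL2) :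
    tensor s c =ᵐ[phaseMeasure] fun z => s z.1 * c z.2 :=
  (memLp_tensor (Lp.memLp s) (Lp.memLp c)).coeFn_toLp

lemma inner_tensor (s s' : SpaceL2) (c c' : VelL2) :
    inner ℝ (tensor s c) (tensor s' c') = inner ℝ s s' * inner ℝ c c' := by
  rw [inner_eq_integral, inner_eq_integral, inner_eq_integral, ← integral_prod_mul,
    ← phaseMeasure_eq]
  refine integral_congr_ae ?_
  filter_upwards [tensor_coe s c, tensor_coe s' c'] with z h1 h2
  rw [h1, h2]; ring

/-- The moment `f ↦ ∫ c(v) f(x, v) dv`, as the adjoint of `s ↦ s(x) c(v)`. -/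
def moment (c : VelL2) : PhaseL2 →L[ℝ] SpaceL2 := (tensor.flip c).adjoint

lemma inner_moment (c : VelL2) (f : PhaseL2) (s : SpaceL2) :
    inner ℝ (moment c f) s = inner ℝ f (tensor s c) := by
  rw [moment, ContinuousLinearMap.adjoint_inner_left]; rfl

lemma norm_moment_le (c : VelL2) (f : PhaseL2) : ‖moment c f‖ ≤ ‖c‖ * ‖f‖ := by
  refine ContinuousLinearMap.le_of_opNorm_le _ ?_ f
  rw [moment, LinearIsometryEquiv.norm_map]
  refine ContinuousLinearMap.opNorm_le_bound _ (norm_nonneg _) fun s => ?_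
  have : ‖tensor s c‖ = ‖s‖ * ‖c‖ := norm_tensor s c
  rw [ContinuousLinearMap.flip_apply, this, mul_comm]

lemma moment_sub (c c' : VelL2) (f : PhaseL2) :
    moment (c - c') f = moment c f - moment c' f := by
  simp [moment]

lemma moment_tensor (c c' : VelL2) (s : SpaceL2) :
    moment c (tensor s c') = (inner ℝ c' c : ℝ) • s := by
  refine ext_inner_right ℝ fun u => ?_
  rw [inner_moment, inner_tensor, inner_smul_left]
  simp [mul_comm]

lemma tendsto_moment {ι : Type*} {l : Filter ι} {c : ι → VelL2} {c₀ : VelL2}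
    (hc : Tendsto c l (𝓝 c₀)) (f : PhaseL2) :
    Tendsto (fun i => moment (c i) f) l (𝓝 (moment c₀ f)) := by
  rw [tendsto_iff_norm_sub_tendsto_zero] at hc ⊢
  have h2 : Tendsto (fun i => ‖c i - c₀‖ * ‖f‖) l (𝓝 0) := by
    simpa using hc.mul_const ‖f‖
  refine squeeze_zero (fun _ => norm_nonneg _) (fun i => ?_) h2
  rw [← moment_sub]
  exact norm_moment_le _ _

/-- Multiplication on `L²(Ω)` by a function of `v`. -/
abbrev mulV (b : ℝ → ℝ) : PhaseL2 →L[ℝ] PhaseL2 := mulL (fun z : ℝ × ℝ => b z.2)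

lemma Bdd.comp_snd {b : ℝ → ℝ} (hb : Bdd b) : Bdd (fun z : ℝ × ℝ => b z.2) :=
  ⟨hb.measurable.comp measurable_snd, hb.bounded.imp fun _ h z => h z.2⟩

lemma mulV_tensor {b : ℝ → ℝ} (hb : Bdd b) (s : SpaceL2) (c : VelL2) :
    mulV b (tensor s c) = tensor s (mulL b c) := by
  refine Lp.ext ?_
  filter_upwards [mulL_coe hb.comp_snd (tensor s c), tensor_coe s c, tensor_coe s (mulL b c),
    ae_snd (mulL_coe hb c)] with z h1 h2 h3 h4
  rw [h1, h2, h3, h4]; ring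

lemma moment_mulV {b : ℝ → ℝ} (hb : Bdd b) (c : VelL2) (f : PhaseL2) :
    moment c (mulV b f) = moment (mulL b c) f := by
  refine ext_inner_right ℝ fun u => ?_
  rw [inner_moment, inner_moment, inner_mulL_comm, mulV_tensor hb]

/-! ### Unitary groups and their generators -/

section Gen

variable {X Y : Type*} [NormedAddCommGroup X] [InnerProductSpace ℝ X]
  [NormedAddCommGroup Y] [InnerProductSpace ℝ Y]

/-- A strongly continuous one-parameter group of isometries. -/
structure IsGroup (τ : ℝ → X →ₗᵢ[ℝ] X) : Prop where
  add : ∀ r s f, τ (r + s) f = τ r (τ s f)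
  zero : ∀ f, τ 0 f = f
  tendsto : ∀ f, Tendsto (fun s => τ s f) (𝓝 0) (𝓝 f)

/-- `f'` is the derivative at `0` of the orbit of `f` under `τ`, in integrated form. -/
def Gen (τ : ℝ → X →ₗᵢ[ℝ] X) (f f' : X) : Prop :=
  ∀ s ∈ Icc (0 : ℝ) 1, τ s f - f = ∫ r in (0 : ℝ)..s, τ r f'

variable {τ : ℝ → X →ₗᵢ[ℝ] X} {ρ : ℝ → Y →ₗᵢ[ℝ] Y}

lemma IsGroup.continuous (h : IsGroup τ) (f : X) : Continuous fun s => τ s f := by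
  rw [continuous_iff_continuousAt]
  intro s
  rw [ContinuousAt, tendsto_iff_norm_sub_tendsto_zero]
  have h1 : Tendsto (fun r => ‖τ (r - s) f - f‖) (𝓝 s) (𝓝 0) := by
    have h2 : Tendsto (fun r : ℝ => r - s) (𝓝 s) (𝓝 0) := by
      have : Continuous fun r : ℝ => r - s := by fun_prop
      simpa using this.tendsto s
    exact tendsto_iff_norm_sub_tendsto_zero.1 ((h.tendsto f).comp h2)
  refine h1.congr fun r => ?_
  rw [← (τ s).norm_map, map_sub, ← h.add, add_sub_cancel]

lemma Gen.norm_sub_le {f f' : X} (hg : Gen τ f f') {s : ℝ} (hs : s ∈ Icc (0 : ℝ) 1) :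
    ‖τ s f - f‖ ≤ s * ‖f'‖ := by
  rw [hg s hs]
  refine (intervalIntegral.norm_integral_le_of_norm_le_const (C := ‖f'‖) fun r _ => ?_).trans ?_
  · rw [(τ r).norm_map]
  · rw [sub_zero, abs_of_nonneg hs.1, mul_comm]

lemma Gen.sub (h : IsGroup τ) {f f' g g' : X} (hf : Gen τ f f') (hg : Gen τ g g') :
    Gen τ (f - g) (f' - g') := by
  intro s hs
  have : τ s (f - g) - (f - g) = (τ s f - f) - (τ s g - g) := by rw [map_sub]; abel
  rw [this, hf s hs, hg s hs, ← intervalIntegral.integral_sub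
    ((h.continuous f').intervalIntegrable _ _) ((h.continuous g').intervalIntegrable _ _)]
  simp only [map_sub]

lemma Gen.add (h : IsGroup τ) {f f' g g' : X} (hf : Gen τ f f') (hg : Gen τ g g') :
    Gen τ (f + g) (f' + g') := by
  intro s hs
  have : τ s (f + g) - (f + g) = (τ s f - f) + (τ s g - g) := by rw [map_add]; abel
  rw [this, hf s hs, hg s hs, ← intervalIntegral.integral_add
    ((h.continuous f').intervalIntegrable _ _) ((h.continuous g').intervalIntegrable _ _)]
  simp only [map_add]

variable [CompleteSpace X] [CompleteSpace Y]

lemma Gen.hasDerivWithinAt (h : IsGroup τ) {f f' : X} (hg : Gen τ f f') :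
    HasDerivWithinAt (fun s => τ s f) f' (Ici 0) 0 := by
  have hc := h.continuous f'
  have h1 : HasDerivAt (fun s => f + ∫ r in (0 : ℝ)..s, τ r f') f' 0 := by
    have := intervalIntegral.integral_hasDerivAt_right (hc.intervalIntegrable 0 0)
      (hc.stronglyMeasurableAtFilter _ _) hc.continuousAt
    rw [h.zero] at this
    exact this.const_add f
  have h2 : HasDerivWithinAt (fun s => τ s f) f' (Icc 0 1) 0 :=
    h1.hasDerivWithinAt.congr (fun s hs => by rw [← hg s hs]; abel)
      (by rw [← hg 0 (by simp)]; abel)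
  exact h2.mono_of_mem_nhdsWithin (Icc_mem_nhdsGE one_pos)

lemma Gen.tendsto_div (h : IsGroup τ) {f f' : X} (hg : Gen τ f f') {u : ℕ → ℝ}
    (hu : Tendsto u atTop (𝓝[>] 0)) :
    Tendsto (fun n => (u n)⁻¹ • (τ (u n) f - f)) atTop (𝓝 f') := by
  have h1 := hasDerivWithinAt_iff_tendsto_slope.1 (hg.hasDerivWithinAt h)
  rw [Ici_sdiff_left] at h1
  refine (h1.comp hu).congr fun n => ?_
  simp [slope, h.zero]

/-- The generator is skew with respect to every invariant bilinear form. -/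
lemma Gen.skew (h : IsGroup τ) {f f' g g' : X} (hf : Gen τ f f') (hg : Gen τ g g')
    (B : X →L[ℝ] X →L[ℝ] ℝ) (hB : ∀ s f g, B (τ s f) (τ s g) = B f g) :
    B f' g + B f g' = 0 := by
  have h1 := hf.hasDerivWithinAt h
  have h2 := hg.hasDerivWithinAt h
  have h3 : HasDerivWithinAt (fun s => B (τ s f) (τ s g)) (B f' g + B f g') (Ici 0) 0 := by
    have hB1 : HasDerivWithinAt (fun s => B (τ s f)) (B f') (Ici 0) 0 :=
      B.hasFDerivAt.comp_hasDerivWithinAt 0 h1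
    have := hB1.clm_apply h2
    simpa [h.zero] using this
  simp only [hB] at h3
  have h4 : HasDerivWithinAt (fun _ : ℝ => B f g) 0 (Ici 0) 0 := hasDerivWithinAt_const _ _ _
  exact (uniqueDiffWithinAt_convex (convex_Ici 0) (by rw [interior_Ici]; exact nonempty_Ioi)
    (subset_closure self_mem_Ici)).eq_deriv _ h3 h4

lemma Gen.inner_skew (h : IsGroup τ) {f f' g g' : X} (hf : Gen τ f f') (hg : Gen τ g g') :
    inner ℝ f' g + inner ℝ f g' = 0 := by
  exact hf.skew h hg (innerSL ℝ) fun s f g => (τ s).inner_map_map f g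

lemma Gen.inner_map_skew (h : IsGroup τ) {f f' g g' : X} (hf : Gen τ f f') (hg : Gen τ g g')
    (K : X →L[ℝ] X) (hK : ∀ s f, K (τ s f) = τ s (K f)) :
    inner ℝ (K f') g + inner ℝ (K f) g' = 0 := by
  refine hf.skew h hg ((innerSL ℝ).comp K) fun s f g => ?_
  change inner ℝ (K (τ s f)) (τ s g) = inner ℝ (K f) g
  rw [hK, (τ s).inner_map_map]

lemma Gen.map (h : IsGroup τ) {f f' : X} (hf : Gen τ f f') (K : X →L[ℝ] Y)
    (hK : ∀ s f, K (τ s f) = ρ s (K f)) : Gen ρ (K f) (K f') := by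
  intro s hs
  rw [← hK, ← map_sub, hf s hs,
    ← K.intervalIntegral_comp_comm ((h.continuous f').intervalIntegrable _ _)]
  simp only [hK]

end Gen

/-! ### Rotations in `x` and translations in `v` -/

/-- A measure-preserving flow on `Ω` that moves points continuously acts on `L²(Ω)` by a strongly
continuous family. -/
lemma tendsto_compMeasurePreserving {R : ℝ → ℝ × ℝ → ℝ × ℝ}
    (hR : ∀ s, MeasurePreserving (R s) phaseMeasure phaseMeasure)
    (hlim : ∀ᵐ z ∂phaseMeasure, Tendsto (fun s => R s z) (𝓝 0) (𝓝 z))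
    (hv : ∀ s z, |(R s z).2 - z.2| ≤ |s|) (f : PhaseL2) :
    Tendsto (fun s => Lp.compMeasurePreservingₗᵢ ℝ (R s) (hR s) f) (𝓝 0) (𝓝 f) := by
  have hcoe : ∀ s (g : PhaseL2),
      Lp.compMeasurePreservingₗᵢ ℝ (R s) (hR s) g =ᵐ[phaseMeasure] g ∘ R s := fun s g =>
    Lp.coeFn_compMeasurePreserving g (hR s)
  have hreg : phaseMeasure.Regular := by
    rw [phaseMeasure]
    infer_instance
  -- the case of continuous functions of compact support
  have hcc : ∀ φ : ℝ × ℝ → ℝ, Continuous φ → HasCompactSupport φ → ∀ hφ : MemLp φ 2 phaseMeasure,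
      Tendsto (fun s => Lp.compMeasurePreservingₗᵢ ℝ (R s) (hR s) (hφ.toLp φ)) (𝓝 0)
        (𝓝 (hφ.toLp φ)) := by
    intro φ hφc hφs hφ
    -- for `|s| ≤ 1` the functions are dominated by a constant on a strip `|v| ≤ L + 1`
    rw [tendsto_iff_seq_tendsto]
    intro u hu
    obtain ⟨C, hC⟩ := hφc.bounded_above_of_compact_support hφs
    obtain ⟨L, hL⟩ := hφs.isBounded.subset_closedBall 0
    have hzero : ∀ z : ℝ × ℝ, L < |z.2| → φ z = 0 := by
      intro z hz
      by_contra hne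
      have := hL (subset_tsupport _ hne)
      rw [mem_closedBall_zero_iff] at this
      exact absurd ((norm_snd_le z).trans this) (not_le.2 hz)
    have hC0 : 0 ≤ C := (norm_nonneg _).trans (hC 0)
    have hae : ∀ᵐ z ∂phaseMeasure, ∀ n,
        Lp.compMeasurePreservingₗᵢ ℝ (R (u n)) (hR (u n)) (hφ.toLp φ) z = φ (R (u n) z) := by
      refine ae_all_iff.2 fun n => ?_
      filter_upwards [hcoe (u n) (hφ.toLp φ),
        (hR (u n)).quasiMeasurePreserving.ae hφ.coeFn_toLp] with z h1 h2
      rw [h1, Function.comp, h2]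
    refine tendsto_Lp_of_dominated
      (G := fun z => (1 : ℝ) * (Icc (-(L + 1)) (L + 1)).indicator (fun _ => C) z.2) ?_ ?_ ?_ ?_
    · refine memLp_tensor (memLp_const 1) ?_
      exact memLp_indicator_const 2 measurableSet_Icc C (Or.inr (by simp))
    · have hsmall : ∀ᶠ n in atTop, |u n| ≤ 1 := by
        have := hu.eventually (Metric.closedBall_mem_nhds (0 : ℝ) one_pos)
        filter_upwards [this] with n hn
        simpa using hn
      filter_upwards [hsmall] with n hn
      filter_upwards [hae] with z hz
      simp only [Function.comp]
      rw [hz n, one_mul]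
      by_cases hzL : z.2 ∈ Icc (-(L + 1)) (L + 1)
      · rw [indicator_of_mem hzL]; exact hC _
      · rw [indicator_of_notMem hzL, hzero, abs_zero]
        have h1 : L + 1 < |z.2| := by
          by_contra hcon
          exact hzL (abs_le.1 (not_lt.1 hcon))
        have h2 := abs_sub_abs_le_abs_sub z.2 (R (u n) z).2
        rw [abs_sub_comm] at h2
        linarith [hv (u n) z]
    · filter_upwards [hφ.coeFn_toLp] with z hz
      rw [hz, one_mul]
      by_cases hzL : z.2 ∈ Icc (-(L + 1)) (L + 1)
      · rw [indicator_of_mem hzL]; exact hC _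
      · rw [indicator_of_notMem hzL, hzero, abs_zero]
        by_contra hcon
        exact hzL (abs_le.1 (by linarith))
    · filter_upwards [hae, hφ.coeFn_toLp, hlim] with z h1 h2 h3
      simp only [Function.comp, h1, h2]
      exact (hφc.tendsto z).comp (h3.comp hu)
  -- density of these functions; the operators are isometries
  rw [Metric.tendsto_nhds]
  intro ε hε
  obtain ⟨φ, hφs, hφε, hφc, hφ⟩ := (Lp.memLp f).exists_hasCompactSupport_eLpNorm_sub_le
    (by simp) (ε := ENNReal.ofReal (ε / 3)) (by simpa using hε)
  have hfφ : ‖f - hφ.toLp φ‖ ≤ ε / 3 := by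
    have : f - hφ.toLp φ = ((Lp.memLp f).sub hφ).toLp (⇑f - φ) := by
      rw [MemLp.toLp_sub (Lp.memLp f) hφ, Lp.toLp_coeFn]
    rw [this, Lp.norm_toLp]
    exact ENNReal.toReal_le_of_le_ofReal (by positivity) hφε
  filter_upwards [Metric.tendsto_nhds.1 (hcc φ hφc hφs hφ) (ε / 3) (by positivity)] with s hs
  rw [dist_eq_norm] at hs ⊢
  set T : PhaseL2 →ₗᵢ[ℝ] PhaseL2 := Lp.compMeasurePreservingₗᵢ ℝ (R s) (hR s)
  have h1 : T f - f = T (f - hφ.toLp φ) + (T (hφ.toLp φ) - hφ.toLp φ) - (f - hφ.toLp φ) := by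
    rw [map_sub]; abel
  rw [h1]
  calc _ ≤ ‖T (f - hφ.toLp φ)‖ + ‖T (hφ.toLp φ) - hφ.toLp φ‖ + ‖f - hφ.toLp φ‖ :=
        (norm_sub_le _ _).trans (by gcongr; exact norm_add_le _ _)
    _ < ε := by rw [T.norm_map]; linarith

/-- Rotations of the unit interval preserve its measure, by invariance of the Haar measure of
the circle. -/
lemma measurePreserving_fract (s : ℝ) :
    MeasurePreserving (fun x => Int.fract (x + s)) unitMeasure unitMeasure := by
  have hm : Measurable fun x : ℝ => Int.fract (x + s) :=
    measurable_fract.comp (measurable_id.add_const s)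
  have hI : unitMeasure = volume.restrict (Ioc (0 : ℝ) (0 + 1)) := by
    rw [zero_add]; exact Measure.restrict_congr_set Ioo_ae_eq_Ioc
  refine ⟨hm, Measure.ext fun A hA => ?_⟩
  rw [Measure.map_apply hm hA, hI, Measure.restrict_apply (hm hA), Measure.restrict_apply hA]
  set U : Set UnitAddCircle :=
    {c | ((AddCircle.measurableEquivIco 1 0 c : Ico (0:ℝ) (0+1)) : ℝ) ∈ A}
  have hU : MeasurableSet U :=
    (measurable_subtype_coe.comp (AddCircle.measurableEquivIco 1 0).measurable) hA
  have hmk : ∀ x : ℝ, (QuotientAddGroup.mk x : UnitAddCircle) ∈ U ↔ Int.fract x ∈ A := by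
    intro x
    have : ((AddCircle.measurableEquivIco (1:ℝ) 0 (x : UnitAddCircle) : Ico (0:ℝ) (0+1)) : ℝ)
        = Int.fract x := by
      have h := AddCircle.coe_equivIco_mk_apply (p := (1:ℝ)) x
      rw [div_one, mul_one] at h
      exact h
    change ((AddCircle.measurableEquivIco (1:ℝ) 0 (x : UnitAddCircle) : Ico (0:ℝ) (0+1)) : ℝ)
      ∈ A ↔ _
    rw [this]
  have h0 := AddCircle.add_projection_respects_measure (1:ℝ) 0 hU
  have hs := AddCircle.add_projection_respects_measure (1:ℝ) s hU
  have e1 : (fun x => Int.fract (x + s)) ⁻¹' A ∩ Ioc 0 (0 + 1)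
      = (fun x => x + s) ⁻¹' (QuotientAddGroup.mk ⁻¹' U ∩ Ioc s (s + 1)) := by
    ext x
    simp only [mem_inter_iff, mem_preimage, hmk, mem_Ioc]
    constructor <;> rintro ⟨h1, h2, h3⟩ <;> exact ⟨h1, by linarith, by linarith⟩
  have e2 : A ∩ Ioo (0:ℝ) 1 = QuotientAddGroup.mk ⁻¹' U ∩ Ioo (0:ℝ) 1 := by
    ext x
    simp only [mem_inter_iff, mem_preimage, hmk]
    refine and_congr_left fun hx => ?_
    rw [Int.fract_eq_self.2 ⟨hx.1.le, hx.2⟩]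
  have e3 : ∀ B : Set ℝ, volume (B ∩ Ioc (0:ℝ) (0 + 1)) = volume (B ∩ Ioo 0 1) := by
    intro B
    rw [zero_add]
    exact measure_congr ((ae_eq_refl B).inter Ioo_ae_eq_Ioc.symm)
  rw [e1, measure_preimage_add_right, ← hs, e3, e2, h0, e3]

lemma measurePreserving_rotX (s : ℝ) :
    MeasurePreserving (fun z : ℝ × ℝ => (Int.fract (z.1 + s), z.2)) phaseMeasure phaseMeasure := by
  rw [phaseMeasure_eq]
  exact (measurePreserving_fract s).prod (MeasurePreserving.id volume)

lemma measurePreserving_transV (s : ℝ) :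
    MeasurePreserving (fun z : ℝ × ℝ => (z.1, z.2 + s)) phaseMeasure phaseMeasure := by
  rw [phaseMeasure_eq]
  exact (MeasurePreserving.id _).prod (measurePreserving_add_right volume s)

/-- `f(x, v) ↦ f(x + s mod 1, v)`. -/
def rotX (s : ℝ) : PhaseL2 →ₗᵢ[ℝ] PhaseL2 :=
  Lp.compMeasurePreservingₗᵢ ℝ _ (measurePreserving_rotX s)

/-- `f(x, v) ↦ f(x, v + s)`. -/
def transV (s : ℝ) : PhaseL2 →ₗᵢ[ℝ] PhaseL2 :=
  Lp.compMeasurePreservingₗᵢ ℝ _ (measurePreserving_transV s)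

/-- `σ(x) ↦ σ(x + s mod 1)`. -/
def rotS (s : ℝ) : SpaceL2 →ₗᵢ[ℝ] SpaceL2 :=
  Lp.compMeasurePreservingₗᵢ ℝ _ (measurePreserving_fract s)

lemma rotX_coe (s : ℝ) (f : PhaseL2) :
    rotX s f =ᵐ[phaseMeasure] fun z => f (Int.fract (z.1 + s), z.2) :=
  Lp.coeFn_compMeasurePreserving f (measurePreserving_rotX s)

lemma transV_coe (s : ℝ) (f : PhaseL2) :
    transV s f =ᵐ[phaseMeasure] fun z => f (z.1, z.2 + s) :=
  Lp.coeFn_compMeasurePreserving f (measurePreserving_transV s)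

lemma rotS_coe (s : ℝ) (f : SpaceL2) :
    rotS s f =ᵐ[unitMeasure] fun x => f (Int.fract (x + s)) :=
  Lp.coeFn_compMeasurePreserving f (measurePreserving_fract s)

lemma ae_mem_phaseSpace : ∀ᵐ z ∂phaseMeasure, z ∈ phaseSpace :=
  ae_restrict_mem measurableSet_phaseSpace

lemma tendsto_fract {x : ℝ} (hx : x ∈ Ioo (0 : ℝ) 1) :
    Tendsto (fun s => Int.fract (x + s)) (𝓝 0) (𝓝 x) := by
  have h1 : Tendsto (fun s => x + s) (𝓝 0) (𝓝 x) := by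
    have : Continuous fun s => x + s := by fun_prop
    simpa using this.tendsto 0
  refine h1.congr' ?_
  filter_upwards [h1.eventually (Ioo_mem_nhds hx.1 hx.2)] with s hs
  exact (Int.fract_eq_self.2 ⟨hs.1.le, hs.2⟩).symm

lemma fract_fract_add (x r s : ℝ) :
    Int.fract (Int.fract (x + r) + s) = Int.fract (x + (r + s)) := by
  rw [← add_assoc, Int.fract_eq_fract]
  exact ⟨-⌊x + r⌋, by push_cast; rw [← Int.self_sub_floor]; ring⟩

lemma isGroup_rotX : IsGroup rotX where
  add r s f := by
    refine Lp.ext ?_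
    filter_upwards [rotX_coe (r + s) f, rotX_coe r (rotX s f),
      (measurePreserving_rotX r).quasiMeasurePreserving.ae (rotX_coe s f)] with z h1 h2 h3
    rw [h1, h2, h3, fract_fract_add]
  zero f := by
    refine Lp.ext ?_
    filter_upwards [rotX_coe 0 f, ae_mem_phaseSpace] with z h1 h2
    rw [h1, add_zero, Int.fract_eq_self.2 ⟨h2.1.1.le, h2.1.2⟩]
  tendsto := tendsto_compMeasurePreserving measurePreserving_rotX
    (by
      filter_upwards [ae_mem_phaseSpace] with z hz
      exact (tendsto_fract hz.1).prodMk_nhds tendsto_const_nhds)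
    (fun s z => by simp)

lemma isGroup_transV : IsGroup transV where
  add r s f := by
    refine Lp.ext ?_
    filter_upwards [transV_coe (r + s) f, transV_coe r (transV s f),
      (measurePreserving_transV r).quasiMeasurePreserving.ae (transV_coe s f)] with z h1 h2 h3
    rw [h1, h2, h3, add_assoc]
  zero f := by
    refine Lp.ext ?_
    filter_upwards [transV_coe 0 f] with z h1
    rw [h1, add_zero]
  tendsto := tendsto_compMeasurePreserving measurePreserving_transV
    (by
      refine Eventually.of_forall fun z => ?_
      have : Continuous fun s : ℝ => (z.1, z.2 + s) := by fun_prop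
      simpa using this.tendsto 0)
    (fun s z => by simp)

lemma rotX_transV (r s : ℝ) (f : PhaseL2) : rotX r (transV s f) = transV s (rotX r f) := by
  refine Lp.ext ?_
  filter_upwards [rotX_coe r (transV s f), transV_coe s (rotX r f),
    (measurePreserving_rotX r).quasiMeasurePreserving.ae (transV_coe s f),
    (measurePreserving_transV s).quasiMeasurePreserving.ae (rotX_coe r f)] with z h1 h2 h3 h4
  rw [h1, h2, h3, h4]

lemma mulV_rotX {b : ℝ → ℝ} (hb : Bdd b) (s : ℝ) (f : PhaseL2) :
    mulV b (rotX s f) = rotX s (mulV b f) := by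
  refine Lp.ext ?_
  filter_upwards [rotX_coe s (mulV b f), mulL_coe hb.comp_snd (rotX s f), rotX_coe s f,
    (measurePreserving_rotX s).quasiMeasurePreserving.ae (mulL_coe hb.comp_snd f)]
    with z h1 h2 h3 h4
  rw [h1, h2, h3, h4]

lemma tensor_rotS (s : ℝ) (u : SpaceL2) (c : VelL2) :
    tensor (rotS s u) c = rotX s (tensor u c) := by
  refine Lp.ext ?_
  filter_upwards [rotX_coe s (tensor u c), tensor_coe (rotS s u) c, ae_fst (rotS_coe s u),
    (measurePreserving_rotX s).quasiMeasurePreserving.ae (tensor_coe u c)] with z h1 h2 h3 h4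
  rw [h1, h2, h3, h4]

lemma rotS_surj (s : ℝ) (u : SpaceL2) : rotS s (rotS (-s) u) = u := by
  refine Lp.ext ?_
  filter_upwards [rotS_coe s (rotS (-s) u), ae_restrict_mem measurableSet_Ioo,
    (measurePreserving_fract s).quasiMeasurePreserving.ae (rotS_coe (-s) u)] with z h1 h2 h3
  rw [h1, h3, fract_fract_add, add_neg_cancel, add_zero, Int.fract_eq_self.2 ⟨h2.1.le, h2.2⟩]

lemma moment_rotX (s : ℝ) (c : VelL2) (f : PhaseL2) :
    moment c (rotX s f) = rotS s (moment c f) := by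
  refine ext_inner_right ℝ fun u => ?_
  rw [← rotS_surj s u, inner_moment, tensor_rotS, (rotX s).inner_map_map,
    (rotS s).inner_map_map, inner_moment]

/-! ### Weak derivatives -/

lemma ae_phase_iff {p : ℝ × ℝ → Prop} :
    (∀ᵐ z ∂phaseMeasure, p z) ↔ ∀ᵐ z, z ∈ phaseSpace → p z :=
  ae_restrict_iff' measurableSet_phaseSpace

lemma integral_phase_eq {u : ℝ × ℝ → ℝ} (h : ∀ z ∉ phaseSpace, u z = 0) :
    ∫ z, u z ∂phaseMeasure = ∫ z, u z :=
  setIntegral_eq_integral_of_forall_compl_eq_zero h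

/-- Smooth functions with compact support in `Ω`. -/
structure IsTest (φ : ℝ × ℝ → ℝ) : Prop where
  smooth : ContDiff ℝ ∞ φ
  compact : HasCompactSupport φ
  support : tsupport φ ⊆ phaseSpace

lemma IsTest.mul_snd {φ : ℝ × ℝ → ℝ} (hφ : IsTest φ) {b : ℝ → ℝ} (hb : ContDiff ℝ ∞ b) :
    IsTest (fun z => b z.2 * φ z) where
  smooth := (hb.comp contDiff_snd).mul hφ.smooth
  compact := hφ.compact.mul_left
  support := (tsupport_mul_subset_right (f := fun z : ℝ × ℝ => b z.2)).trans hφ.support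

lemma IsTest.fderiv_apply {φ : ℝ × ℝ → ℝ} (hφ : IsTest φ) (e : ℝ × ℝ) :
    IsTest (fun z => fderiv ℝ φ z e) where
  smooth := (hφ.smooth.fderiv_right (m := ∞) (by simp)).clm_apply contDiff_const
  compact := hφ.compact.fderiv_apply (𝕜 := ℝ) e
  support := (tsupport_fderiv_apply_subset ℝ e).trans hφ.support

lemma LocallyIntegrableOn.integrable_test {g φ : ℝ × ℝ → ℝ}
    (hg : LocallyIntegrableOn g phaseSpace) (hφ : IsTest φ) :
    Integrable (fun z => g z * φ z) phaseMeasure := by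
  have h1 : IntegrableOn g (tsupport φ) :=
    hg.integrableOn_compact_subset hφ.support hφ.compact
  have h2 : IntegrableOn (fun z => g z * φ z) (tsupport φ) :=
    h1.mul_continuousOn hφ.smooth.continuous.continuousOn hφ.compact
  have h3 : Integrable (fun z => g z * φ z) := by
    rw [← integrableOn_iff_integrable_of_support_subset (s := tsupport φ)]
    · exact h2
    · intro z hz
      exact subset_tsupport _ (right_ne_zero_of_mul hz)
  exact h3.restrict

lemma locallyIntegrableOn_of_memLp {g : ℝ × ℝ → ℝ} (hg : MemLp g 2 phaseMeasure) :
    LocallyIntegrableOn g phaseSpace := by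
  have hlf : IsLocallyFiniteMeasure phaseMeasure := by rw [phaseMeasure]; infer_instance
  have h1 : LocallyIntegrable g phaseMeasure := hg.locallyIntegrable one_le_two
  intro z hz
  obtain ⟨U, hU, hgU⟩ := h1 z
  refine ⟨U ∩ phaseSpace, inter_mem (mem_nhdsWithin_of_mem_nhds hU) self_mem_nhdsWithin, ?_⟩
  rw [IntegrableOn, phaseMeasure, Measure.restrict_restrict' measurableSet_phaseSpace] at hgU
  exact hgU

lemma HasWeakPartial.congr {g g₁ g' g₁' : ℝ × ℝ → ℝ} {e : ℝ × ℝ} (h : HasWeakPartial g e g')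
    (hg : g =ᵐ[phaseMeasure] g₁) (hg' : g' =ᵐ[phaseMeasure] g₁') : HasWeakPartial g₁ e g₁' := by
  have hloc : ∀ {u w : ℝ × ℝ → ℝ}, u =ᵐ[phaseMeasure] w → LocallyIntegrableOn u phaseSpace →
      LocallyIntegrableOn w phaseSpace := by
    intro u w huw hu z hz
    obtain ⟨U, hU, hgU⟩ := hu z hz
    refine ⟨U ∩ phaseSpace, inter_mem hU self_mem_nhdsWithin, ?_⟩
    refine (hgU.mono_set inter_subset_left).congr_fun_ae ?_
    exact ae_mono (Measure.restrict_mono inter_subset_right le_rfl) huw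
  refine ⟨hloc hg h.1, hloc hg' h.2.1, fun φ h1 h2 h3 => ?_⟩
  have e1 : ∫ z, g z * fderiv ℝ φ z e ∂phaseMeasure = ∫ z, g₁ z * fderiv ℝ φ z e ∂phaseMeasure :=
    integral_congr_ae (hg.mono fun z hz => congrArg (· * fderiv ℝ φ z e) hz)
  have e2 : ∫ z, g' z * φ z ∂phaseMeasure = ∫ z, g₁' z * φ z ∂phaseMeasure :=
    integral_congr_ae (hg'.mono fun z hz => congrArg (· * φ z) hz)
  rw [← e1, ← e2, h.2.2 φ h1 h2 h3]

lemma HasWeakPartial.unique {g g' g'' : ℝ × ℝ → ℝ} {e : ℝ × ℝ} (h : HasWeakPartial g e g')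
    (h' : HasWeakPartial g e g'') : g' =ᵐ[phaseMeasure] g'' := by
  have h1 := isOpen_phaseSpace.ae_eq_zero_of_integral_contDiff_smul_eq_zero
    (h.2.1.sub h'.2.1) (μ := volume) (fun φ h1 h2 h3 => ?_)
  · filter_upwards [ae_phase_iff.2 h1] with z hz
    exact sub_eq_zero.1 hz
  · have hφ : IsTest φ := ⟨h1, h2, h3⟩
    have e1 : ∫ z, φ z • (g' - g'') z = ∫ z, (g' z * φ z - g'' z * φ z) ∂phaseMeasure := by
      rw [integral_phase_eq]
      · refine integral_congr_ae (Eventually.of_forall fun z => ?_)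
        simp only [Pi.sub_apply, smul_eq_mul]; ring
      · intro z hz
        rw [image_eq_zero_of_notMem_tsupport fun hz' => hz (h3 hz')]; simp
    rw [e1, integral_sub (LocallyIntegrableOn.integrable_test h.2.1 hφ)
      (LocallyIntegrableOn.integrable_test h'.2.1 hφ)]
    have a1 := h.2.2 φ h1 h2 h3
    have a2 := h'.2.2 φ h1 h2 h3
    linarith

lemma deriv_comp_snd {b : ℝ → ℝ} (hb : ContDiff ℝ ∞ b) {φ : ℝ × ℝ → ℝ} (hφ : IsTest φ)
    (z e : ℝ × ℝ) : fderiv ℝ (fun z : ℝ × ℝ => b z.2 * φ z) z e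
      = b z.2 * fderiv ℝ φ z e + deriv b z.2 * e.2 * φ z := by
  have h1 : HasFDerivAt (fun z : ℝ × ℝ => b z.2)
      ((ContinuousLinearMap.toSpanSingleton ℝ (deriv b z.2)).comp
        (ContinuousLinearMap.snd ℝ ℝ ℝ)) z := by
    exact ((hb.differentiable (by simp)) z.2).hasDerivAt.hasFDerivAt.comp z hasFDerivAt_snd
  have h2 := ((hφ.smooth.differentiable (by simp)) z).hasFDerivAt
  rw [show (fun z : ℝ × ℝ => b z.2 * φ z) = (fun z : ℝ × ℝ => b z.2) * φ from rfl,
    (h1.mul h2).fderiv]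
  simp
  ring

lemma contDiff_deriv {b : ℝ → ℝ} (hb : ContDiff ℝ ∞ b) : ContDiff ℝ ∞ (deriv b) :=
  (contDiff_infty_iff_deriv.1 hb).2

/-- Weak derivatives of `b(v) g(x, v)` for smooth `b`. -/
lemma HasWeakPartial.mul_snd {g g' : ℝ × ℝ → ℝ} {e : ℝ × ℝ} (h : HasWeakPartial g e g')
    {b : ℝ → ℝ} (hb : ContDiff ℝ ∞ b) :
    HasWeakPartial (fun z => b z.2 * g z) e
      (fun z => b z.2 * g' z + e.2 * deriv b z.2 * g z) := by
  have hO := isOpen_phaseSpace.isLocallyClosed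
  have hbc : ContinuousOn (fun z : ℝ × ℝ => b z.2) phaseSpace :=
    (hb.continuous.comp continuous_snd).continuousOn
  have hbc' : ContinuousOn (fun z : ℝ × ℝ => e.2 * deriv b z.2) phaseSpace :=
    (continuous_const.mul ((contDiff_deriv hb).continuous.comp continuous_snd)).continuousOn
  refine ⟨h.1.continuousOn_mul hbc hO,
    (h.2.1.continuousOn_mul hbc hO).add (h.1.continuousOn_mul hbc' hO), fun φ h1 h2 h3 => ?_⟩
  have hφ : IsTest φ := ⟨h1, h2, h3⟩
  have hbφ := hφ.mul_snd hb
  have hbφ' := hφ.mul_snd (contDiff_deriv hb)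
  have key := h.2.2 _ hbφ.smooth hbφ.compact hbφ.support
  simp only [deriv_comp_snd hb hφ] at key
  have i1 := LocallyIntegrableOn.integrable_test h.1 ((hφ.fderiv_apply e).mul_snd hb)
  have i2 := (LocallyIntegrableOn.integrable_test h.1 hbφ').const_mul e.2
  have i3 := LocallyIntegrableOn.integrable_test h.2.1 hbφ
  have e1 : ∫ z, g z * (b z.2 * fderiv ℝ φ z e + deriv b z.2 * e.2 * φ z) ∂phaseMeasure
      = (∫ z, g z * (b z.2 * fderiv ℝ φ z e) ∂phaseMeasure)
        + ∫ z, e.2 * (g z * (deriv b z.2 * φ z)) ∂phaseMeasure := by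
    rw [← integral_add i1 i2]
    refine integral_congr_ae (Eventually.of_forall fun z => ?_)
    simp only; ring
  have e2 : ∫ z, (b z.2 * g' z + e.2 * deriv b z.2 * g z) * φ z ∂phaseMeasure
      = (∫ z, g' z * (b z.2 * φ z) ∂phaseMeasure)
        + ∫ z, e.2 * (g z * (deriv b z.2 * φ z)) ∂phaseMeasure := by
    rw [← integral_add i3 i2]
    refine integral_congr_ae (Eventually.of_forall fun z => ?_)
    simp only; ring
  have e3 : ∫ z, b z.2 * g z * fderiv ℝ φ z e ∂phaseMeasure
      = ∫ z, g z * (b z.2 * fderiv ℝ φ z e) ∂phaseMeasure :=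
    integral_congr_ae (Eventually.of_forall fun z => by simp only; ring)
  rw [e1] at key
  rw [e2, e3]
  linarith

lemma IsTest.memLp {φ : ℝ × ℝ → ℝ} (hφ : IsTest φ) : MemLp φ 2 phaseMeasure :=
  (hφ.smooth.continuous.memLp_of_hasCompactSupport (μ := volume) hφ.compact).restrict _

lemma inner_test {φ : ℝ × ℝ → ℝ} (hφ : IsTest φ) (f : PhaseL2) :
    inner ℝ f (toL2 phaseMeasure φ) = ∫ z, f z * φ z ∂phaseMeasure := by
  rw [inner_eq_integral]
  refine integral_congr_ae ?_
  filter_upwards [toL2_coe hφ.memLp] with z hz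
  rw [hz]

lemma eq_zero_of_inner_test {u : PhaseL2}
    (h : ∀ φ, IsTest φ → inner ℝ u (toL2 phaseMeasure φ) = 0) : u = 0 := by
  refine Lp.ext ?_
  have h1 := isOpen_phaseSpace.ae_eq_zero_of_integral_contDiff_smul_eq_zero
    (locallyIntegrableOn_of_memLp (Lp.memLp u)) (fun φ h1 h2 h3 => ?_)
  · filter_upwards [ae_phase_iff.2 h1, Lp.coeFn_zero ℝ 2 phaseMeasure] with z hz hz0
    rw [hz, hz0, Pi.zero_apply]
  · have := h φ ⟨h1, h2, h3⟩
    rw [inner_test ⟨h1, h2, h3⟩, integral_phase_eq] at this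
    · rw [← this]
      refine integral_congr_ae (Eventually.of_forall fun z => ?_)
      simp only [smul_eq_mul]; ring
    · intro z hz
      rw [image_eq_zero_of_notMem_tsupport fun hz' => hz (h3 hz')]; simp

/-- Pairing with a translated test function is differentiable in the translation. -/
lemma hasDerivAt_integral_translate (f : PhaseL2) {φ : ℝ × ℝ → ℝ} (h1 : ContDiff ℝ ∞ φ)
    (h2 : HasCompactSupport φ) (e : ℝ × ℝ) (s : ℝ) :
    HasDerivAt (fun s : ℝ => ∫ z, f z * φ (z - s • e) ∂phaseMeasure)
      (-∫ z, f z * fderiv ℝ φ (z - s • e) e ∂phaseMeasure) s := by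
  have hlf : IsLocallyFiniteMeasure phaseMeasure := by rw [phaseMeasure]; infer_instance
  have hd : Continuous fun z => fderiv ℝ φ z e :=
    ((h1.fderiv_right (m := ∞) (by simp)).clm_apply contDiff_const).continuous
  have hds : HasCompactSupport fun z => fderiv ℝ φ z e := h2.fderiv_apply (𝕜 := ℝ) e
  obtain ⟨C, hC⟩ := hd.bounded_above_of_compact_support hds
  obtain ⟨L, hL⟩ := hds.isBounded.subset_closedBall 0
  set K : Set (ℝ × ℝ) := Metric.closedBall 0 (L + (|s| + 1) * ‖e‖)
  have hzero : ∀ r ∈ Metric.ball s 1, ∀ z ∉ K, fderiv ℝ φ (z - r • e) e = 0 := by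
    intro r hr z hz
    by_contra hne
    have h3 := hL (subset_tsupport _ hne)
    rw [mem_closedBall_zero_iff] at h3
    refine hz ?_
    rw [mem_closedBall_zero_iff]
    have h4 : |r| ≤ |s| + 1 := by
      have := abs_sub_abs_le_abs_sub r s
      rw [Metric.mem_ball, Real.dist_eq] at hr
      linarith
    calc ‖z‖ = ‖(z - r • e) + r • e‖ := by rw [sub_add_cancel]
      _ ≤ ‖z - r • e‖ + ‖r • e‖ := norm_add_le _ _
      _ ≤ L + (|s| + 1) * ‖e‖ := by
        rw [norm_smul, Real.norm_eq_abs]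
        gcongr
  have hint : ∀ {ψ : ℝ × ℝ → ℝ}, Continuous ψ → HasCompactSupport ψ →
      MemLp ψ 2 phaseMeasure := fun hψ hψ' => hψ.memLp_of_hasCompactSupport hψ'
  have hcs : ∀ r : ℝ, ∀ {ψ : ℝ × ℝ → ℝ}, HasCompactSupport ψ →
      HasCompactSupport fun z => ψ (z - r • e) := fun r ψ hψ =>
    hψ.comp_homeomorph (Homeomorph.subRight (r • e))
  have key := hasDerivAt_integral_of_dominated_loc_of_deriv_le (μ := phaseMeasure)
    (F := fun (r : ℝ) z => f z * φ (z - r • e))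
    (F' := fun (r : ℝ) z => -(f z * fderiv ℝ φ (z - r • e) e)) (x₀ := s) (s := Metric.ball s 1)
    (bound := fun z => |f z| * K.indicator (fun _ => C) z) (Metric.ball_mem_nhds s one_pos)
    (Eventually.of_forall fun r => (Lp.aestronglyMeasurable f).mul
      (h1.continuous.comp (by fun_prop)).aestronglyMeasurable)
    ((Lp.memLp f).integrable_mul (hint (h1.continuous.comp (by fun_prop)) (hcs s h2)))
    ((Lp.aestronglyMeasurable f).mul (hd.comp (by fun_prop)).aestronglyMeasurable).neg
    (Eventually.of_forall fun z r hr => ?_)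
    ((Lp.memLp f).abs.integrable_mul
      (memLp_indicator_const 2 Metric.isClosed_closedBall.measurableSet C
        (Or.inr (isCompact_closedBall (0 : ℝ × ℝ) _).measure_lt_top.ne)))
    (Eventually.of_forall fun z r hr => ?_)
  · have := key.2
    rwa [integral_neg] at this
  · rw [norm_neg, norm_mul, Real.norm_eq_abs]
    by_cases hz : z ∈ K
    · rw [indicator_of_mem hz]
      exact mul_le_mul_of_nonneg_left (hC _) (abs_nonneg _)
    · rw [hzero r hr z hz, indicator_of_notMem hz]; simp
  · have h3 : HasDerivAt (fun r : ℝ => z - r • e) (-e) r := by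
      simpa using ((hasDerivAt_id r).smul_const e).const_sub z
    have h4 := ((h1.differentiable (by simp)) (z - r • e)).hasFDerivAt.comp_hasDerivAt r h3
    have := h4.const_mul (f z)
    simpa using this

/-- A generator is recognized by differentiating the group against test functions. It is enough to
do so in the open interval, since the group is strongly continuous. -/
lemma gen_of_hasDerivAt_inner {τ : ℝ → PhaseL2 →ₗᵢ[ℝ] PhaseL2} (hτ : IsGroup τ) {f f' : PhaseL2}
    (h : ∀ φ, IsTest φ → ∀ s ∈ Ioo (0 : ℝ) 1,
      HasDerivAt (fun s => inner ℝ (τ s f) (toL2 phaseMeasure φ))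
        (inner ℝ (τ s f') (toL2 phaseMeasure φ)) s) : Gen τ f f' := by
  intro s hs
  rw [← sub_eq_zero]
  refine eq_zero_of_inner_test fun φ hφ => ?_
  have hi := (hτ.continuous f').intervalIntegrable (μ := volume) 0 s
  have hc : ∀ g, Continuous fun s => inner ℝ (τ s g) (toL2 phaseMeasure φ) := fun g =>
    (hτ.continuous g).inner continuous_const
  have h1 := intervalIntegral.integral_eq_sub_of_hasDerivAt_of_le hs.1 (hc f).continuousOn
    (fun r hr => h φ hφ r ⟨hr.1, hr.2.trans_le hs.2⟩) ((hc f').intervalIntegrable _ _)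
  have h2 : ∫ r in (0 : ℝ)..s, inner ℝ (τ r f') (toL2 phaseMeasure φ)
      = inner ℝ (∫ r in (0 : ℝ)..s, τ r f') (toL2 phaseMeasure φ) := by
    have := ((innerSL ℝ).flip (toL2 phaseMeasure φ)).intervalIntegral_comp_comm hi
    exact this
  rw [inner_sub_left, inner_sub_left, ← h2, h1, hτ.zero]
  ring

lemma transV_toL2 (s : ℝ) {φ : ℝ × ℝ → ℝ} (hφ : MemLp φ 2 phaseMeasure) :
    transV s (toL2 phaseMeasure φ) =ᵐ[phaseMeasure] fun z => φ (z.1, z.2 + s) := by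
  filter_upwards [transV_coe s (toL2 phaseMeasure φ),
    (measurePreserving_transV s).quasiMeasurePreserving.ae (toL2_coe hφ)] with z h1 h2
  rw [h1, h2]

lemma rotX_toL2 (s : ℝ) {φ : ℝ × ℝ → ℝ} (hφ : MemLp φ 2 phaseMeasure) :
    rotX s (toL2 phaseMeasure φ) =ᵐ[phaseMeasure] fun z => φ (Int.fract (z.1 + s), z.2) := by
  filter_upwards [rotX_coe s (toL2 phaseMeasure φ),
    (measurePreserving_rotX s).quasiMeasurePreserving.ae (toL2_coe hφ)] with z h1 h2
  rw [h1, h2]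

lemma IsGroup.inner_eq {τ : ℝ → PhaseL2 →ₗᵢ[ℝ] PhaseL2} (hτ : IsGroup τ) (s : ℝ) (f g : PhaseL2) :
    inner ℝ (τ s f) g = inner ℝ f (τ (-s) g) := by
  have : g = τ s (τ (-s) g) := by rw [← hτ.add, add_neg_cancel, hτ.zero]
  conv_lhs => rw [this]
  rw [(τ s).inner_map_map]

lemma IsTest.translate_snd {φ : ℝ × ℝ → ℝ} (hφ : IsTest φ) (s : ℝ) :
    IsTest fun z => φ (z - s • ((0 : ℝ), (1 : ℝ))) where
  smooth := hφ.smooth.comp (by fun_prop)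
  compact := hφ.compact.comp_homeomorph (Homeomorph.subRight (s • ((0 : ℝ), (1 : ℝ))))
  support := by
    intro z hz
    have h1 : z - s • ((0 : ℝ), (1 : ℝ)) ∈ tsupport φ :=
      tsupport_comp_subset_preimage φ
        (f := fun z : ℝ × ℝ => z - s • ((0 : ℝ), (1 : ℝ))) (by fun_prop) hz
    have := (hφ.support h1).1
    exact ⟨by simpa using this, mem_univ _⟩

/-- A weak `v`-derivative in `L²` generates translations in `v`. -/
lemma gen_transV_of_hasWeakPartial {f f' : PhaseL2} (h : HasWeakPartial f (0, 1) f') :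
    Gen transV f f' := by
  refine gen_of_hasDerivAt_inner isGroup_transV fun φ hφ s _ => ?_
  have h1 : ∀ (g : PhaseL2) (r : ℝ), inner ℝ (transV r g) (toL2 phaseMeasure φ)
      = ∫ z, g z * φ (z - r • ((0 : ℝ), (1 : ℝ))) ∂phaseMeasure := by
    intro g r
    rw [isGroup_transV.inner_eq, inner_eq_integral]
    refine integral_congr_ae ?_
    filter_upwards [transV_toL2 (-r) hφ.memLp] with z hz
    rw [hz]
    congr 2
    ext <;> simp [sub_eq_add_neg]
  simp only [h1]
  have h2 := hasDerivAt_integral_translate f hφ.smooth hφ.compact (0, 1) s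
  have ht := hφ.translate_snd s
  have h3 := h.2.2 _ ht.smooth ht.compact ht.support
  have h4 : ∀ z, fderiv ℝ (fun z => φ (z - s • ((0 : ℝ), (1 : ℝ)))) z (0, 1)
      = fderiv ℝ φ (z - s • ((0 : ℝ), (1 : ℝ))) (0, 1) := fun z => by
    rw [fderiv_comp_sub]
  simp only [h4] at h3
  rwa [h3, neg_neg] at h2

/-- Periodicity of `f` in `x`, together with `f' = ∂ₓ f`, in weak form: test functions need
not vanish at the boundary, only take equal values there. -/
def WeakPeriodic (f f' : PhaseL2) : Prop :=
  ∀ φ : ℝ × ℝ → ℝ, ContDiff ℝ ∞ φ → HasCompactSupport φ → (∀ v, φ (0, v) = φ (1, v)) →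
    ∫ z, f z * fderiv ℝ φ z (1, 0) ∂phaseMeasure = -∫ z, f' z * φ z ∂phaseMeasure

/-- A weak `x`-derivative in `L²` of a periodic function generates rotations in `x`. A test
function rotated by `s` is the sum of its translates by `s` and by `s - 1`. -/
lemma gen_rotX_of_weakPeriodic {f f' : PhaseL2} (h : WeakPeriodic f f') : Gen rotX f f' := by
  refine gen_of_hasDerivAt_inner isGroup_rotX fun φ hφ s hs => ?_
  have hvan : ∀ x v : ℝ, x ∉ Ioo (0 : ℝ) 1 → φ (x, v) = 0 := fun x v hx =>
    image_eq_zero_of_notMem_tsupport fun hz => hx (hφ.support hz).1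
  have hml : ∀ r : ℝ, MemLp (fun z => φ (z - r • ((1 : ℝ), (0 : ℝ)))) 2 phaseMeasure := fun r =>
    (Continuous.memLp_of_hasCompactSupport (μ := volume) (hφ.smooth.continuous.comp (by fun_prop))
      (hφ.compact.comp_homeomorph (Homeomorph.subRight (r • ((1 : ℝ), (0 : ℝ)))))).restrict _
  have hint : ∀ (g : PhaseL2) (r : ℝ),
      Integrable (fun z => g z * φ (z - r • ((1 : ℝ), (0 : ℝ)))) phaseMeasure := fun g r =>
    (Lp.memLp g).integrable_mul (hml r)
  have h1 : ∀ (g : PhaseL2), ∀ r ∈ Icc (0 : ℝ) 1, inner ℝ (rotX r g) (toL2 phaseMeasure φ)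
      = (∫ z, g z * φ (z - r • ((1 : ℝ), (0 : ℝ))) ∂phaseMeasure)
        + ∫ z, g z * φ (z - (r - 1) • ((1 : ℝ), (0 : ℝ))) ∂phaseMeasure := by
    intro g r hr
    rw [isGroup_rotX.inner_eq, inner_eq_integral, ← integral_add (hint g r) (hint g (r - 1))]
    refine integral_congr_ae ?_
    filter_upwards [rotX_toL2 (-r) hφ.memLp, ae_mem_phaseSpace] with z hz hzΩ
    rw [hz, ← mul_add]
    congr 1
    have e1 : z - r • ((1 : ℝ), (0 : ℝ)) = (z.1 - r, z.2) := by ext <;> simp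
    have e2 : z - (r - 1) • ((1 : ℝ), (0 : ℝ)) = (z.1 - r + 1, z.2) := by
      ext <;> simp; ring
    rw [e1, e2]
    have hx := hzΩ.1
    rcases le_or_gt 0 (z.1 - r) with hc | hc
    · have : Int.fract (z.1 + -r) = z.1 - r := by
        rw [← sub_eq_add_neg]; exact Int.fract_eq_self.2 ⟨hc, by linarith [hx.2, hr.1]⟩
      rw [this, hvan (z.1 - r + 1) z.2 (fun h => by linarith [h.2]), add_zero]
    · have : Int.fract (z.1 + -r) = z.1 - r + 1 := by
        rw [← sub_eq_add_neg, ← Int.fract_add_one]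
        exact Int.fract_eq_self.2 ⟨by linarith [hx.1, hr.2], by linarith⟩
      rw [this, hvan (z.1 - r) z.2 (fun h => by linarith [h.1]), zero_add]
  have h2 := hasDerivAt_integral_translate f hφ.smooth hφ.compact (1, 0) s
  have h2' := (hasDerivAt_integral_translate f hφ.smooth hφ.compact (1, 0) (s - 1)).comp_sub_const
    s 1
  have h3 := (h2.add h2').congr_of_eventuallyEq
    (f₁ := fun r => inner ℝ (rotX r f) (toL2 phaseMeasure φ))
    (by filter_upwards [Icc_mem_nhds hs.1 hs.2] with r hr; exact h1 f r hr)
  refine h3.congr_deriv ?_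
  rw [h1 f' s ⟨hs.1.le, hs.2.le⟩]
  set φs : ℝ × ℝ → ℝ := fun z =>
    φ (z - s • ((1 : ℝ), (0 : ℝ))) + φ (z - (s - 1) • ((1 : ℝ), (0 : ℝ)))
  have hcd : ∀ r : ℝ, ContDiff ℝ ∞ fun z : ℝ × ℝ => φ (z - r • ((1 : ℝ), (0 : ℝ))) := fun r =>
    hφ.smooth.comp (by fun_prop)
  have hcs : ∀ r : ℝ, HasCompactSupport fun z : ℝ × ℝ => φ (z - r • ((1 : ℝ), (0 : ℝ))) :=
    fun r => hφ.compact.comp_homeomorph (Homeomorph.subRight (r • ((1 : ℝ), (0 : ℝ))))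
  -- at `x = 0` and `x = 1` both values of `φs` are `φ (1 - s, v)`, so it is an admissible test
  -- function for `WeakPeriodic`
  have key := h φs ((hcd s).add (hcd (s - 1))) ((hcs s).add (hcs (s - 1))) (fun v => by
    have a1 : φ (0 - s, v) = 0 := hvan _ _ fun h => by linarith [h.1, hs.1]
    have a2 : φ (1 - (s - 1), v) = 0 := hvan _ _ fun h => by linarith [h.2, hs.2]
    simp only [φs, Prod.smul_mk, Prod.mk_sub_mk, smul_eq_mul, mul_one, mul_zero, sub_zero, a1, a2]
    ring_nf)
  have hfd : ∀ z, fderiv ℝ φs z (1, 0) = fderiv ℝ φ (z - s • ((1 : ℝ), (0 : ℝ))) (1, 0)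
      + fderiv ℝ φ (z - (s - 1) • ((1 : ℝ), (0 : ℝ))) (1, 0) := fun z => by
    have : fderiv ℝ φs z = fderiv ℝ (fun z => φ (z - s • ((1 : ℝ), (0 : ℝ)))) z
        + fderiv ℝ (fun z => φ (z - (s - 1) • ((1 : ℝ), (0 : ℝ)))) z :=
      fderiv_add ((hcd s).differentiable (by simp) z) ((hcd (s - 1)).differentiable (by simp) z)
    rw [this, fderiv_comp_sub, fderiv_comp_sub]
    rfl
  have hml' : ∀ r : ℝ, MemLp (fun z => fderiv ℝ φ (z - r • ((1 : ℝ), (0 : ℝ))) (1, 0)) 2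
      phaseMeasure := fun r =>
    (Continuous.memLp_of_hasCompactSupport (μ := volume)
      ((hφ.fderiv_apply (1, 0)).smooth.continuous.comp (by fun_prop))
      ((hφ.fderiv_apply (1, 0)).compact.comp_homeomorph
        (Homeomorph.subRight (r • ((1 : ℝ), (0 : ℝ)))))).restrict _
  have hint' : ∀ (g : PhaseL2) (r : ℝ),
      Integrable (fun z => g z * fderiv ℝ φ (z - r • ((1 : ℝ), (0 : ℝ))) (1, 0)) phaseMeasure :=
    fun g r => (Lp.memLp g).integrable_mul (hml' r)
  simp only [hfd, φs, mul_add] at key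
  rw [integral_add (hint' f s) (hint' f (s - 1)), integral_add (hint f' s) (hint f' (s - 1))] at key
  linarith

lemma IsTest.hasWeakPartial {φ : ℝ × ℝ → ℝ} (hφ : IsTest φ) (e : ℝ × ℝ) :
    HasWeakPartial φ e fun z => fderiv ℝ φ z e := by
  refine ⟨locallyIntegrableOn_of_memLp hφ.memLp,
    locallyIntegrableOn_of_memLp (hφ.fderiv_apply e).memLp,
    fun ψ h1 h2 h3 => ?_⟩
  have hψ : IsTest ψ := ⟨h1, h2, h3⟩
  have hz : ∀ {u w : ℝ × ℝ → ℝ}, tsupport u ⊆ phaseSpace →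
      ∫ z, u z * w z ∂phaseMeasure = ∫ z, u z * w z := fun {u w} hu => by
    rw [integral_phase_eq]
    intro z hz
    rw [image_eq_zero_of_notMem_tsupport fun hz' => hz (hu hz')]; simp
  rw [hz hφ.support, hz (hφ.fderiv_apply e).support]
  have hint : ∀ {u w : ℝ × ℝ → ℝ}, IsTest u → IsTest w → Integrable fun z => u z * w z :=
    fun hu hw => (hu.smooth.continuous.mul hw.smooth.continuous).integrable_of_hasCompactSupport
      hu.compact.mul_right
  exact integral_mul_fderiv_eq_neg_fderiv_mul_of_integrable (hint (hφ.fderiv_apply e) hψ)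
    (hint hφ (hψ.fderiv_apply e)) (hint hφ hψ)
    (fun z _ => hφ.smooth.differentiable (by simp) z)
    (fun z _ => hψ.smooth.differentiable (by simp) z)

lemma hasWeakPartial_of_gen_transV {f f' : PhaseL2} (h : Gen transV f f') :
    HasWeakPartial f (0, 1) f' := by
  refine ⟨locallyIntegrableOn_of_memLp (Lp.memLp f), locallyIntegrableOn_of_memLp (Lp.memLp f'),
    fun φ h1 h2 h3 => ?_⟩
  have hφ : IsTest φ := ⟨h1, h2, h3⟩
  have h4 : Gen transV (toL2 phaseMeasure φ)
      (toL2 phaseMeasure fun z => fderiv ℝ φ z (0, 1)) :=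
    gen_transV_of_hasWeakPartial ((hφ.hasWeakPartial (0, 1)).congr (toL2_coe hφ.memLp).symm
      (toL2_coe (hφ.fderiv_apply (0, 1)).memLp).symm)
  have := h.inner_skew isGroup_transV h4
  rw [inner_test hφ, inner_test (hφ.fderiv_apply (0, 1))] at this
  linarith

/-- Product rule: `∂ᵥ(b f) = b' f + b ∂ᵥ f`. -/
lemma Gen.mul_velocity {f f' : PhaseL2} (h : Gen transV f f') {b : ℝ → ℝ} (hb : ContDiff ℝ ∞ b)
    (hb0 : Bdd b) (hb1 : Bdd (deriv b)) :
    Gen transV (mulV b f) (mulV (deriv b) f + mulV b f') := by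
  refine gen_transV_of_hasWeakPartial
    (((hasWeakPartial_of_gen_transV h).mul_snd hb).congr (mulL_coe hb0.comp_snd f).symm ?_)
  filter_upwards [mulL_coe hb0.comp_snd f', mulL_coe hb1.comp_snd f,
    Lp.coeFn_add (mulV (deriv b) f) (mulV b f')] with z h1 h2 h3
  rw [h3, Pi.add_apply, h1, h2]
  ring

/-! ### The Maxwellian and its moments -/

lemma maxwellian_eq_gaussianPDFReal : maxwellian = ProbabilityTheory.gaussianPDFReal 0 1 := by
  ext v
  simp [maxwellian, ProbabilityTheory.gaussianPDFReal]

lemma maxwellian_pos (v : ℝ) : 0 < maxwellian v := by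
  rw [maxwellian]; positivity

lemma contDiff_maxwellian : ContDiff ℝ ∞ maxwellian := by
  unfold maxwellian; fun_prop

lemma continuous_maxwellian : Continuous maxwellian := contDiff_maxwellian.continuous

lemma hasDerivAt_maxwellian (v : ℝ) : HasDerivAt maxwellian (-v * maxwellian v) v := by
  have h1 : HasDerivAt (fun v : ℝ => -(v ^ 2) / 2) (-v) v := by
    have := ((hasDerivAt_pow 2 v).neg).div_const 2
    refine this.congr_deriv ?_
    norm_num
    ring
  have := (h1.exp).const_mul (Real.sqrt (2 * Real.pi))⁻¹
  refine this.congr_deriv ?_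
  rw [maxwellian]
  ring

lemma maxwellian_neg (v : ℝ) : maxwellian (-v) = maxwellian v := by simp [maxwellian]

lemma maxwellian_le_one (v : ℝ) : maxwellian v ≤ 1 := by
  rw [maxwellian]
  have h1 : (1 : ℝ) ≤ Real.sqrt (2 * Real.pi) := by
    rw [Real.one_le_sqrt]; linarith [Real.pi_gt_three]
  have h2 : Real.exp (-(v ^ 2) / 2) ≤ 1 := by
    rw [Real.exp_le_one_iff]; nlinarith [sq_nonneg v]
  exact mul_le_one₀ (inv_le_one_of_one_le₀ h1) (Real.exp_pos _).le h2

lemma integrable_pow_mul_maxwellian (n : ℕ) : Integrable fun v => v ^ n * maxwellian v := by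
  have h := (integrable_rpow_mul_exp_neg_mul_sq (b := 1 / 2) (by norm_num) (s := n)
    (by have : (0 : ℝ) ≤ n := n.cast_nonneg
        linarith)).const_mul (Real.sqrt (2 * Real.pi))⁻¹
  refine h.congr (Eventually.of_forall fun v => ?_)
  simp only [Real.rpow_natCast, maxwellian]
  rw [show -(1 / 2) * v ^ 2 = -(v ^ 2) / 2 by ring]
  ring

lemma integrable_maxwellian : Integrable maxwellian := by
  simpa using integrable_pow_mul_maxwellian 0

lemma integral_maxwellian : ∫ v, maxwellian v = 1 := by
  rw [maxwellian_eq_gaussianPDFReal]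
  exact ProbabilityTheory.integral_gaussianPDFReal_eq_one 0 one_ne_zero

lemma hasDerivAt_pow_mul_maxwellian (n : ℕ) (v : ℝ) :
    HasDerivAt (fun v => v ^ (n + 1) * maxwellian v)
      ((n + 1) * (v ^ n * maxwellian v) - v ^ (n + 2) * maxwellian v) v := by
  have := (hasDerivAt_pow (n + 1) v).mul (hasDerivAt_maxwellian v)
  refine this.congr_deriv ?_
  push_cast
  ring

/-- The recursion `∫ v^{n+2} M = (n+1) ∫ v^n M`. -/
lemma integral_pow_add_two_mul_maxwellian (n : ℕ) :
    ∫ v, v ^ (n + 2) * maxwellian v = (n + 1) * ∫ v, v ^ n * maxwellian v := by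
  have h := integral_eq_zero_of_hasDerivAt_of_integrable (hasDerivAt_pow_mul_maxwellian n)
    (((integrable_pow_mul_maxwellian n).const_mul _).sub (integrable_pow_mul_maxwellian (n + 2)))
    (integrable_pow_mul_maxwellian (n + 1))
  rw [integral_sub ((integrable_pow_mul_maxwellian n).const_mul _)
    (integrable_pow_mul_maxwellian (n + 2)), integral_const_mul] at h
  linarith

lemma integral_id_mul_maxwellian : ∫ v, v * maxwellian v = 0 := by
  have h := integral_eq_zero_of_hasDerivAt_of_integrable hasDerivAt_maxwellian
    (by simpa using (integrable_pow_mul_maxwellian 1).neg) integrable_maxwellian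
  simp only [neg_mul, integral_neg, neg_eq_zero] at h
  exact h

lemma integral_sq_mul_maxwellian : ∫ v, v ^ 2 * maxwellian v = 1 := by
  have := integral_pow_add_two_mul_maxwellian 0
  simpa [integral_maxwellian] using this

lemma integral_pow_four_mul_maxwellian : ∫ v, v ^ 4 * maxwellian v = 3 := by
  have := integral_pow_add_two_mul_maxwellian 2
  rw [integral_sq_mul_maxwellian] at this
  rw [this]; norm_num

/-! ### The Gaussian Poincaré inequality -/

section Kernel

/-- The tail `∫_{t > 0} M(y + t) dt`. -/
def tail (y : ℝ) : ℝ := ∫ t in Ioi (0 : ℝ), maxwellian (y + t)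

lemma integral_id_mul_shift (y : ℝ) :
    IntegrableOn (fun t => t * maxwellian (y + t)) (Ioi 0) ∧
      ∫ t in Ioi (0 : ℝ), t * maxwellian (y + t) = maxwellian y - y * tail y := by
  have i0 : Integrable fun t => maxwellian (y + t) := integrable_maxwellian.comp_add_left y
  have i1 : Integrable fun t => (y + t) * maxwellian (y + t) := by
    simpa using (integrable_pow_mul_maxwellian 1).comp_add_left y
  have hd : ∀ t : ℝ, HasDerivAt (fun t => -maxwellian (y + t)) ((y + t) * maxwellian (y + t)) t :=
    fun t =>
      ((hasDerivAt_maxwellian (y + t)).comp_const_add y t).neg.congr_deriv (by ring)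
  have hlim := tendsto_zero_of_hasDerivAt_of_integrableOn_Ioi (a := 0) (fun t _ => hd t)
    i1.integrableOn i0.neg.integrableOn
  have h1 := integral_Ioi_of_hasDerivAt_of_tendsto' (a := 0) (fun t _ => hd t) i1.integrableOn hlim
  have e : ∀ t, t * maxwellian (y + t) = (y + t) * maxwellian (y + t) - y * maxwellian (y + t) :=
    fun t => by ring
  constructor
  · simp only [e]
    exact (i1.sub (i0.const_mul y)).integrableOn
  · simp only [e]
    rw [integral_sub i1.integrableOn (i0.const_mul y).integrableOn, h1, integral_const_mul]
    simp [tail]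

lemma tail_nonneg (y : ℝ) : 0 ≤ tail y :=
  setIntegral_nonneg measurableSet_Ioi fun _ _ => (maxwellian_pos _).le

lemma tail_add_tail_neg (y : ℝ) : tail y + tail (-y) = 1 := by
  have i0 : Integrable fun t => maxwellian (y + t) := integrable_maxwellian.comp_add_left y
  have h1 : tail (-y) = ∫ t in Iic (0 : ℝ), maxwellian (y + t) := by
    rw [tail, ← neg_zero, ← integral_comp_neg_Iic, neg_zero]
    refine setIntegral_congr_fun measurableSet_Iic fun t _ => ?_
    rw [← maxwellian_neg]
    ring_nf
  rw [h1, tail, add_comm, ← setIntegral_union (Iic_disjoint_Ioi le_rfl) measurableSet_Ioi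
    i0.integrableOn i0.integrableOn, Iic_union_Ioi, setIntegral_univ,
    integral_add_left_eq_self maxwellian y, integral_maxwellian]

/-- `M` as a function with values in `[0, ∞]`. -/
def eM (v : ℝ) : ENNReal := ENNReal.ofReal (maxwellian v)

lemma measurable_eM : Measurable eM := continuous_maxwellian.measurable.ennreal_ofReal

lemma lintegral_tail (y : ℝ) : ∫⁻ t in Ioi (0 : ℝ), eM (y + t) = ENNReal.ofReal (tail y) := by
  rw [tail, ofReal_integral_eq_lintegral_ofReal
    (integrable_maxwellian.comp_add_left y).integrableOn
    (Eventually.of_forall fun t => (maxwellian_pos _).le)]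
  rfl

lemma lintegral_id_mul_shift (y : ℝ) : ∫⁻ t in Ioi (0 : ℝ), ENNReal.ofReal t * eM (y + t)
    = ENNReal.ofReal (maxwellian y - y * tail y) := by
  rw [← (integral_id_mul_shift y).2, ofReal_integral_eq_lintegral_ofReal
    (integral_id_mul_shift y).1]
  · refine setLIntegral_congr_fun measurableSet_Ioi fun t ht => ?_
    rw [ENNReal.ofReal_mul (le_of_lt ht), eM]
  · filter_upwards [ae_restrict_mem measurableSet_Ioi] with t ht
    exact mul_nonneg (le_of_lt ht) (maxwellian_pos _).le

/-- The kernel identity `∫∫_{w < y < v} (v - w) M(w) M(v) dw dv = M(y)`, with `w = y - r` and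
`v = y + t`. It is the reason why the Poincaré constant is `1`. -/
lemma lintegral_kernel (y : ℝ) :
    ∫⁻ r in Ioi (0 : ℝ), ∫⁻ t in Ioi (0 : ℝ),
      ENNReal.ofReal (r + t) * (eM (y - r) * eM (y + t)) = eM y := by
  have hP : ∀ r, eM (y - r) = eM (-y + r) := fun r => by
    rw [eM, eM, ← maxwellian_neg]; ring_nf
  have hI : ∀ z, 0 ≤ maxwellian z - z * tail z := fun z => by
    rw [← (integral_id_mul_shift z).2]
    exact setIntegral_nonneg measurableSet_Ioi fun t ht =>
      mul_nonneg (le_of_lt ht) (maxwellian_pos _).le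
  have hm1 : Measurable fun t => eM (y + t) := measurable_eM.comp (measurable_const_add y)
  have hm2 : Measurable fun t => eM (-y + t) := measurable_eM.comp (measurable_const_add (-y))
  have hm3 : Measurable fun t => ENNReal.ofReal t * eM (y + t) :=
    ENNReal.measurable_ofReal.mul hm1
  have hm4 : Measurable fun t => ENNReal.ofReal t * eM (-y + t) :=
    ENNReal.measurable_ofReal.mul hm2
  have h1 : ∀ r ∈ Ioi (0 : ℝ), ∫⁻ t in Ioi (0 : ℝ),
      ENNReal.ofReal (r + t) * (eM (y - r) * eM (y + t))
      = ENNReal.ofReal r * eM (-y + r) * ENNReal.ofReal (tail y)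
        + eM (-y + r) * ENNReal.ofReal (maxwellian y - y * tail y) := by
    intro r hr
    rw [← lintegral_tail, ← lintegral_id_mul_shift, ← lintegral_const_mul _ hm1,
      ← lintegral_const_mul _ hm3, ← lintegral_add_left
        (hm1.const_mul _)]
    refine setLIntegral_congr_fun measurableSet_Ioi fun t ht => ?_
    rw [ENNReal.ofReal_add (le_of_lt hr) (le_of_lt ht), hP]
    ring
  rw [setLIntegral_congr_fun measurableSet_Ioi h1, lintegral_add_left
    (hm4.mul_const _), lintegral_mul_const _ hm4, lintegral_mul_const _ hm2, lintegral_tail,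
    lintegral_id_mul_shift, ← ENNReal.ofReal_mul (hI _), ← ENNReal.ofReal_mul (tail_nonneg _),
    ← ENNReal.ofReal_add (mul_nonneg (hI _) (tail_nonneg _))
      (mul_nonneg (tail_nonneg _) (hI _)), eM]
  congr 1
  rw [maxwellian_neg]
  linear_combination maxwellian y * tail_add_tail_neg y

end Kernel

section Variance

lemma integral_sub_add_const_mul {f g h : ℝ → ℝ} (hf : Integrable f) (hg : Integrable g)
    (hh : Integrable h) (a c : ℝ) : Integrable (fun v => f v - a * g v + c * h v) ∧
      ∫ v, (f v - a * g v + c * h v) = (∫ v, f v) - a * (∫ v, g v) + c * ∫ v, h v := by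
  have i1 : Integrable fun v => f v - a * g v := hf.sub (hg.const_mul a)
  refine ⟨i1.add (hh.const_mul c), ?_⟩
  rw [integral_add i1 (hh.const_mul c), integral_sub hf (hg.const_mul a), integral_const_mul,
    integral_const_mul]

/-- Twice the variance of `u` with respect to `M` as a double integral. -/
lemma lintegral_lintegral_sub_sq {u : ℝ → ℝ} (hu : Measurable u)
    (hu2 : Integrable fun v => maxwellian v * u v ^ 2) :
    ∫⁻ v, eM v * ∫⁻ w, eM w * ENNReal.ofReal ((u w - u v) ^ 2)
      = ENNReal.ofReal (2 * (∫ v, maxwellian v * u v ^ 2)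
        - 2 * (∫ v, maxwellian v * u v) ^ 2) := by
  have hu1 : Integrable fun v => maxwellian v * u v := by
    refine (integrable_maxwellian.add hu2).mono'
      (continuous_maxwellian.measurable.mul hu).aestronglyMeasurable
      (Eventually.of_forall fun v => ?_)
    rw [Real.norm_eq_abs, abs_mul, abs_of_pos (maxwellian_pos v), Pi.add_apply]
    have : |u v| ≤ 1 + u v ^ 2 := by
      rw [← sq_abs]; nlinarith [sq_nonneg (|u v| - 1), abs_nonneg (u v)]
    calc maxwellian v * |u v| ≤ maxwellian v * (1 + u v ^ 2) :=
          mul_le_mul_of_nonneg_left this (maxwellian_pos v).le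
      _ = _ := by ring
  set a := ∫ v, maxwellian v * u v
  set b := ∫ v, maxwellian v * u v ^ 2
  have key : ∀ v, ∫⁻ w, eM w * ENNReal.ofReal ((u w - u v) ^ 2)
      = ENNReal.ofReal (b - 2 * u v * a + u v ^ 2) := by
    intro v
    have e : ∀ w, maxwellian w * (u w - u v) ^ 2 = maxwellian w * u w ^ 2
        - 2 * u v * (maxwellian w * u w) + u v ^ 2 * maxwellian w := fun w => by ring
    obtain ⟨hint, hval⟩ := integral_sub_add_const_mul hu2 hu1 integrable_maxwellian (2 * u v)
      (u v ^ 2)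
    simp only [← e] at hint hval
    rw [integral_maxwellian, mul_one] at hval
    change _ = b - 2 * u v * a + u v ^ 2 at hval
    rw [← hval, ofReal_integral_eq_lintegral_ofReal hint
      (Eventually.of_forall fun w => mul_nonneg (maxwellian_pos w).le (sq_nonneg _))]
    refine lintegral_congr fun w => ?_
    rw [ENNReal.ofReal_mul (maxwellian_pos w).le, eM]
  have hnn : ∀ v, 0 ≤ b - 2 * u v * a + u v ^ 2 := by
    have hab : a ^ 2 ≤ b := by
      have h0 : 0 ≤ ∫ v, maxwellian v * (u v - a) ^ 2 :=
        integral_nonneg fun v => mul_nonneg (maxwellian_pos v).le (sq_nonneg _)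
      have e : ∀ w, maxwellian w * (u w - a) ^ 2 = maxwellian w * u w ^ 2
        - 2 * a * (maxwellian w * u w) + a ^ 2 * maxwellian w := fun w => by ring
      simp only [e] at h0
      rw [(integral_sub_add_const_mul hu2 hu1 integrable_maxwellian (2 * a) (a ^ 2)).2,
        integral_maxwellian] at h0
      change 0 ≤ b - 2 * a * a + a ^ 2 * 1 at h0
      nlinarith
    intro v
    nlinarith [sq_nonneg (u v - a)]
  have e : ∀ v, maxwellian v * (b - 2 * u v * a + u v ^ 2) = maxwellian v * u v ^ 2
        - 2 * a * (maxwellian v * u v) + b * maxwellian v := fun w => by ring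
  obtain ⟨hint, hval'⟩ := integral_sub_add_const_mul hu2 hu1 integrable_maxwellian (2 * a) b
  simp only [← e] at hint hval'
  have hval : ∫ v, maxwellian v * (b - 2 * u v * a + u v ^ 2) = 2 * b - 2 * a ^ 2 := by
    rw [hval', integral_maxwellian]
    change b - 2 * a * a + b * 1 = _
    ring
  rw [← hval, ofReal_integral_eq_lintegral_ofReal hint
    (Eventually.of_forall fun v => mul_nonneg (maxwellian_pos v).le (hnn v))]
  refine lintegral_congr fun v => ?_
  rw [key, ENNReal.ofReal_mul (maxwellian_pos v).le, eM]

/-- A symmetric integrand is integrated over `{w > v}` with half the total mass. -/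
lemma two_mul_lintegral_Ioi {F : ℝ → ℝ → ENNReal} (hF : Measurable (Function.uncurry F))
    (hsymm : ∀ v w, F v w = F w v) :
    2 * ∫⁻ v, ∫⁻ w in Ioi v, F v w = ∫⁻ v, ∫⁻ w, F v w := by
  have hms : MeasurableSet {p : ℝ × ℝ | p.1 < p.2} := measurableSet_lt measurable_fst measurable_snd
  have h1 : ∀ v, ∫⁻ w in Ioi v, F v w
      = ∫⁻ w, {p : ℝ × ℝ | p.1 < p.2}.indicator (Function.uncurry F) (v, w) := fun v => by
    rw [← lintegral_indicator measurableSet_Ioi]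
    rfl
  have h2 : ∫⁻ v, ∫⁻ w in Ioi v, F v w = ∫⁻ v, ∫⁻ w in Iio v, F v w := by
    simp only [h1]
    rw [lintegral_lintegral_swap (f := fun v w =>
      {p : ℝ × ℝ | p.1 < p.2}.indicator (Function.uncurry F) (v, w))
      ((hF.indicator hms).aemeasurable)]
    refine lintegral_congr fun v => ?_
    rw [← lintegral_indicator measurableSet_Iio]
    refine lintegral_congr fun w => ?_
    simp only [indicator, mem_ofPred_eq, mem_Iio, Function.uncurry_apply_pair, hsymm v w]
  rw [two_mul]
  conv_lhs => rw [h2]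
  nth_rw 2 [← h2]
  have hm : Measurable fun v => ∫⁻ w in Ioi v, F v w := by
    simp only [h1]
    exact (hF.indicator hms).lintegral_prod_right'
  rw [← lintegral_add_right _ hm]
  refine lintegral_congr fun v => ?_
  have h3 := lintegral_union (μ := volume) (f := F v) measurableSet_Ioi
    (Iic_disjoint_Ioi (le_refl v))
  rw [Iic_union_Ioi, setLIntegral_univ] at h3
  rw [h3, setLIntegral_congr (Iio_ae_eq_Iic (a := v))]

end Variance

section Orbit

variable {X : Type*} [NormedAddCommGroup X] [InnerProductSpace ℝ X] [CompleteSpace X]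
  {τ : ℝ → X →ₗᵢ[ℝ] X}

/-- The group law extends the defining relation of `Gen` from `[0, 1]` to all positive times. -/
lemma Gen.forall_nonneg (h : IsGroup τ) {f f' : X} (hg : Gen τ f f') {s : ℝ} (hs : 0 ≤ s) :
    τ s f - f = ∫ r in (0 : ℝ)..s, τ r f' := by
  have key : ∀ n : ℕ, ∀ s ∈ Icc (0 : ℝ) (n + 1), τ s f - f = ∫ r in (0 : ℝ)..s, τ r f' := by
    intro n
    induction n with
    | zero => exact fun s hs => hg s (by simpa using hs)
    | succ n ih =>
      intro s hs
      push_cast at hs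
      rcases le_or_gt s (n + 1) with h1 | h1
      · exact ih s ⟨hs.1, h1⟩
      have hn : (0 : ℝ) ≤ n := n.cast_nonneg
      have h2 := ih (s - 1) ⟨by linarith, by linarith [hs.2]⟩
      have h3 := hg 1 (by simp)
      have hi : ∀ a b, IntervalIntegrable (fun r => τ r f') volume a b := fun a b =>
        (h.continuous f').intervalIntegrable a b
      have e1 : τ s f = τ (s - 1) (τ 1 f) := by rw [← h.add, sub_add_cancel]
      have e2 : τ (s - 1) (τ 1 f - f) = ∫ r in (s - 1)..s, τ r f' := by
        rw [h3]
        have := (τ (s - 1)).toContinuousLinearMap.intervalIntegral_comp_comm (hi 0 1)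
        simp only [LinearIsometry.coe_toContinuousLinearMap] at this
        rw [← this]
        simp only [← h.add]
        rw [intervalIntegral.integral_comp_add_left (fun r => τ r f')]
        simp
      rw [← intervalIntegral.integral_add_adjacent_intervals (hi 0 (s - 1)) (hi (s - 1) s), ← h2,
        ← e2, e1, map_sub]
      abel
  obtain ⟨n, hn⟩ := exists_nat_ge s
  exact key n s ⟨hs, by linarith⟩

omit [CompleteSpace X] in
lemma norm_integral_sq_le {G : ℝ → X} (hG : Continuous G) {s : ℝ} (hs : 0 ≤ s) :
    ‖∫ r in (0 : ℝ)..s, G r‖ ^ 2 ≤ s * ∫ r in (0 : ℝ)..s, ‖G r‖ ^ 2 := by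
  rcases hs.eq_or_lt with rfl | hs
  · simp
  set I := ∫ r in (0 : ℝ)..s, ‖G r‖
  have h1 : ‖∫ r in (0 : ℝ)..s, G r‖ ≤ I := intervalIntegral.norm_integral_le_integral_norm hs.le
  have hi1 : IntervalIntegrable (fun r => ‖G r‖) volume 0 s := hG.norm.intervalIntegrable 0 s
  have hi2 : IntervalIntegrable (fun r => ‖G r‖ ^ 2) volume 0 s :=
    (hG.norm.pow 2).intervalIntegrable 0 s
  have h2 : 0 ≤ ∫ r in (0 : ℝ)..s, (‖G r‖ ^ 2 - 2 * (I / s) * ‖G r‖ + (I / s) ^ 2) :=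
    intervalIntegral.integral_nonneg hs.le fun r _ => by nlinarith [sq_nonneg (‖G r‖ - I / s)]
  rw [intervalIntegral.integral_add (hi2.sub (hi1.const_mul _)) (by simp),
    intervalIntegral.integral_sub hi2 (hi1.const_mul _), intervalIntegral.integral_const_mul,
    intervalIntegral.integral_const] at h2
  simp only [sub_zero, smul_eq_mul] at h2
  change 0 ≤ (∫ r in (0 : ℝ)..s, ‖G r‖ ^ 2) - 2 * (I / s) * I + s * (I / s) ^ 2 at h2
  have h3 : s * (2 * (I / s) * I - s * (I / s) ^ 2) = I ^ 2 := by field_simp; ring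
  calc _ ≤ I ^ 2 := pow_le_pow_left₀ (norm_nonneg _) h1 2
    _ ≤ _ := by rw [← h3]; exact mul_le_mul_of_nonneg_left (by linarith) hs.le

end Orbit

lemma lintegral_shift_Ioi (H : ℝ → ENNReal) (v : ℝ) :
    ∫⁻ s in Ioi (0 : ℝ), H (v + s) = ∫⁻ w in Ioi v, H w := by
  rw [← lintegral_indicator measurableSet_Ioi, ← lintegral_indicator measurableSet_Ioi,
    ← lintegral_add_left_eq_self ((Ioi v).indicator H) v]
  refine lintegral_congr fun s => ?_
  by_cases hs : 0 < s
  · rw [indicator_of_mem (mem_Ioi.2 hs), indicator_of_mem (mem_Ioi.2 (by linarith))]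
  · rw [indicator_of_notMem (by simpa using hs), indicator_of_notMem (by simpa using not_lt.1 hs)]

lemma lintegral_triangle {F : ℝ → ℝ → ENNReal} (hF : Measurable (Function.uncurry F)) :
    ∫⁻ s in Ioi (0 : ℝ), ∫⁻ r in Ioo 0 s, F s r
      = ∫⁻ r in Ioi (0 : ℝ), ∫⁻ t in Ioi (0 : ℝ), F (r + t) r := by
  set T : Set (ℝ × ℝ) := {p | 0 < p.2 ∧ p.2 < p.1}
  have hT : MeasurableSet T :=
    (measurableSet_lt measurable_const measurable_snd).inter
      (measurableSet_lt measurable_snd measurable_fst)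
  have h1 : ∀ s, (Ioi (0 : ℝ)).indicator (fun s => ∫⁻ r in Ioo 0 s, F s r) s
      = ∫⁻ r, T.indicator (Function.uncurry F) (s, r) := by
    intro s
    by_cases hs : s ∈ Ioi (0 : ℝ)
    · rw [indicator_of_mem hs, ← lintegral_indicator measurableSet_Ioo]
      rfl
    · rw [indicator_of_notMem hs]
      have : ∀ r, T.indicator (Function.uncurry F) (s, r) = 0 := fun r =>
        indicator_of_notMem (fun h => hs (lt_trans h.1 h.2)) _
      simp [this]
  rw [← lintegral_indicator measurableSet_Ioi, lintegral_congr h1,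
    lintegral_lintegral_swap (f := fun s r => T.indicator (Function.uncurry F) (s, r))
      (hF.indicator hT).aemeasurable, ← lintegral_indicator measurableSet_Ioi]
  refine lintegral_congr fun r => ?_
  by_cases hr : r ∈ Ioi (0 : ℝ)
  · rw [indicator_of_mem hr, lintegral_shift_Ioi (fun s => F s r),
      ← lintegral_indicator measurableSet_Ioi]
    refine lintegral_congr fun s => ?_
    by_cases hs : r < s
    · rw [indicator_of_mem (show (s, r) ∈ T from ⟨hr, hs⟩), indicator_of_mem (mem_Ioi.2 hs)]
      rfl
    · rw [indicator_of_notMem (fun h => hs h.2), indicator_of_notMem (by simpa using hs)]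
  · rw [indicator_of_notMem hr]
    have : ∀ s, T.indicator (Function.uncurry F) (s, r) = 0 := fun s =>
      indicator_of_notMem (fun h => hr h.1) _
    simp [this]

lemma ofReal_norm_mulL_sq {b : ℝ × ℝ → ℝ} (hb : Bdd b) (f : PhaseL2) :
    ENNReal.ofReal (‖mulL b f‖ ^ 2)
      = ∫⁻ z, ENNReal.ofReal (b z ^ 2) * ENNReal.ofReal (f z ^ 2) ∂phaseMeasure := by
  rw [norm_sq_eq_integral, ofReal_integral_eq_lintegral_ofReal (Lp.memLp _).integrable_sq
    (Eventually.of_forall fun z => sq_nonneg _)]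
  refine lintegral_congr_ae ?_
  filter_upwards [mulL_coe hb f] with z hz
  rw [hz, mul_pow, ENNReal.ofReal_mul (sq_nonneg _)]

lemma bdd_maxwellian : Bdd maxwellian :=
  ⟨continuous_maxwellian.measurable, 1, fun v => by
    rw [abs_of_pos (maxwellian_pos v)]; exact maxwellian_le_one v⟩

/-- The mean square of an increment of length `s`, weighted with `M(v) M(v + s)`. -/
lemma lintegral_increment_le {U U' : PhaseL2} (h : Gen transV U U') {s : ℝ} (hs : 0 < s) :
    ∫⁻ z, eM z.2 * eM (z.2 + s) * ENNReal.ofReal ((U (z.1, z.2 + s) - U z) ^ 2) ∂phaseMeasure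
      ≤ ENNReal.ofReal s * ∫⁻ r in Ioo 0 s, ∫⁻ z,
        eM z.2 * eM (z.2 + s) * ENNReal.ofReal (U' (z.1, z.2 + r) ^ 2) ∂phaseMeasure := by
  set b : ℝ → ℝ := fun v => Real.sqrt (maxwellian v * maxwellian (v + s))
  have hb : Bdd b := by
    refine ⟨(continuous_maxwellian.mul
      (continuous_maxwellian.comp (by fun_prop))).sqrt.measurable, 1, fun v => ?_⟩
    rw [abs_of_nonneg (Real.sqrt_nonneg _), Real.sqrt_le_one]
    exact mul_le_one₀ (maxwellian_le_one _) (maxwellian_pos _).le (maxwellian_le_one _)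
  have hb2 : ∀ v, ENNReal.ofReal (b v ^ 2) = eM v * eM (v + s) := fun v => by
    rw [Real.sq_sqrt (mul_pos (maxwellian_pos _) (maxwellian_pos _)).le,
      ENNReal.ofReal_mul (maxwellian_pos _).le]
    rfl
  have hc : Continuous fun r => mulV b (transV r U') :=
    (mulV b).continuous.comp (isGroup_transV.continuous U')
  have h1 : ‖mulV b (transV s U - U)‖ ^ 2 ≤ s * ∫ r in (0 : ℝ)..s, ‖mulV b (transV r U')‖ ^ 2 := by
    rw [h.forall_nonneg isGroup_transV hs.le, ← (mulV b).intervalIntegral_comp_comm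
      ((isGroup_transV.continuous U').intervalIntegrable 0 s)]
    exact norm_integral_sq_le hc hs.le
  have hi : Integrable (fun r => ‖mulV b (transV r U')‖ ^ 2) (volume.restrict (Ioc 0 s)) :=
    (hc.norm.pow 2).integrableOn_Ioc
  have h2 := ENNReal.ofReal_le_ofReal h1
  rw [ofReal_norm_mulL_sq hb.comp_snd, ENNReal.ofReal_mul hs.le,
    intervalIntegral.integral_of_le hs.le, ofReal_integral_eq_lintegral_ofReal hi
      (Eventually.of_forall fun r => sq_nonneg _), setLIntegral_congr Ioo_ae_eq_Ioc.symm] at h2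
  simp only [ofReal_norm_mulL_sq hb.comp_snd, hb2] at h2
  have e1 : ∫⁻ z, eM z.2 * eM (z.2 + s) * ENNReal.ofReal ((transV s U - U : PhaseL2) z ^ 2)
      ∂phaseMeasure = ∫⁻ z, eM z.2 * eM (z.2 + s) *
        ENNReal.ofReal ((U (z.1, z.2 + s) - U z) ^ 2) ∂phaseMeasure := by
    refine lintegral_congr_ae ?_
    filter_upwards [Lp.coeFn_sub (transV s U) U, transV_coe s U] with z h3 h4
    rw [h3, Pi.sub_apply, h4]
  have e2 : ∀ r, ∫⁻ z, eM z.2 * eM (z.2 + s) * ENNReal.ofReal (transV r U' z ^ 2) ∂phaseMeasure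
      = ∫⁻ z, eM z.2 * eM (z.2 + s) * ENNReal.ofReal (U' (z.1, z.2 + r) ^ 2) ∂phaseMeasure :=
    fun r => by
      refine lintegral_congr_ae ?_
      filter_upwards [transV_coe r U'] with z h4
      rw [h4]
  simpa only [e1, e2] using h2

lemma Integrable.prod_of_phase {g : ℝ × ℝ → ℝ} (h : Integrable g phaseMeasure) :
    Integrable g (unitMeasure.prod volume) := phaseMeasure_eq ▸ h

lemma integral_phase_prod {g : ℝ × ℝ → ℝ} (h : Integrable g phaseMeasure) :
    ∫ z, g z ∂phaseMeasure = ∫ x, (∫ v, g (x, v)) ∂unitMeasure := by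
  rw [phaseMeasure_eq, integral_prod _ (Integrable.prod_of_phase h)]

lemma measurable_Lp (f : PhaseL2) : Measurable f := (Lp.stronglyMeasurable f).measurable

/-- Integrating the right-hand side of `lintegral_increment_le` over all increments. -/
lemma lintegral_increment_bound (P : ℝ × ℝ → ENNReal) (hP : Measurable P) :
    ∫⁻ s in Ioi (0 : ℝ), ENNReal.ofReal s * ∫⁻ r in Ioo 0 s, ∫⁻ z,
        eM z.2 * eM (z.2 + s) * P (z.1, z.2 + r) ∂phaseMeasure
      = ∫⁻ z, eM z.2 * P z ∂phaseMeasure := by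
  have hmM := measurable_eM
  have hshift : ∀ s r, ∫⁻ z, eM z.2 * eM (z.2 + s) * P (z.1, z.2 + r) ∂phaseMeasure
      = ∫⁻ z, eM (z.2 - r) * eM (z.2 - r + s) * P z ∂phaseMeasure := by
    intro s r
    rw [← (measurePreserving_transV r).lintegral_comp (f := fun z : ℝ × ℝ =>
      eM (z.2 - r) * eM (z.2 - r + s) * P z) (by fun_prop)]
    simp
  simp only [hshift]
  have hm3 : Measurable fun p : (ℝ × ℝ) × (ℝ × ℝ) =>
      eM (p.2.2 - p.1.2) * eM (p.2.2 - p.1.2 + p.1.1) * P p.2 := by fun_prop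
  have hm2 : Measurable fun p : ℝ × ℝ =>
      ∫⁻ z, eM (z.2 - p.2) * eM (z.2 - p.2 + p.1) * P z ∂phaseMeasure :=
    hm3.lintegral_prod_right'
  obtain ⟨G, hGm, hG⟩ : ∃ G : ℝ × ℝ → ENNReal, Measurable G ∧ ∀ s r,
      ∫⁻ z, eM (z.2 - r) * eM (z.2 - r + s) * P z ∂phaseMeasure = G (s, r) :=
    ⟨_, hm2, fun _ _ => rfl⟩
  have e1 : ∀ s : ℝ, ENNReal.ofReal s * ∫⁻ r in Ioo 0 s, G (s, r)
      = ∫⁻ r in Ioo 0 s, ENNReal.ofReal s * G (s, r) := fun s =>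
    (lintegral_const_mul _ (hGm.comp measurable_prodMk_left)).symm
  simp only [hG, e1]
  rw [lintegral_triangle (F := fun s r => ENNReal.ofReal s * G (s, r))
    ((ENNReal.measurable_ofReal.comp measurable_fst).mul hGm)]
  simp only [← hG]
  have hm4 : Measurable fun p : (ℝ × ℝ) × (ℝ × ℝ) =>
      ENNReal.ofReal (p.1.1 + p.1.2) * (eM (p.2.2 - p.1.1) * eM (p.2.2 + p.1.2) * P p.2) := by
    fun_prop
  have e2 : ∀ r t : ℝ, ENNReal.ofReal (r + t) *
      ∫⁻ z, eM (z.2 - r) * eM (z.2 - r + (r + t)) * P z ∂phaseMeasure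
      = ∫⁻ z, ENNReal.ofReal (r + t) * (eM (z.2 - r) * eM (z.2 + t) * P z) ∂phaseMeasure := by
    intro r t
    rw [← lintegral_const_mul]
    · refine lintegral_congr fun z => ?_
      rw [show z.2 - r + (r + t) = z.2 + t by ring]
    · fun_prop
  simp only [e2]
  have e3 : ∀ r : ℝ, ∫⁻ t in Ioi (0 : ℝ), ∫⁻ z, ENNReal.ofReal (r + t) *
      (eM (z.2 - r) * eM (z.2 + t) * P z) ∂phaseMeasure = ∫⁻ z, (∫⁻ t in Ioi (0 : ℝ),
        ENNReal.ofReal (r + t) * (eM (z.2 - r) * eM (z.2 + t) * P z)) ∂phaseMeasure := by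
    intro r
    rw [lintegral_lintegral_swap]
    exact (hm4.comp ((measurable_const.prodMk measurable_fst).prodMk measurable_snd)).aemeasurable
  simp only [e3]
  rw [lintegral_lintegral_swap]
  · refine lintegral_congr fun z => ?_
    rw [← lintegral_kernel z.2, ← lintegral_mul_const]
    · refine lintegral_congr fun r => ?_
      rw [← lintegral_mul_const]
      · refine lintegral_congr fun t => ?_
        ring
      · fun_prop
    · refine Measurable.lintegral_prod_right' (f := fun p : ℝ × ℝ =>
        ENNReal.ofReal (p.1 + p.2) * (eM (z.2 - p.1) * eM (z.2 + p.2))) ?_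
      fun_prop
  · refine Measurable.aemeasurable ?_
    refine Measurable.lintegral_prod_right' (f := fun p : (ℝ × (ℝ × ℝ)) × ℝ =>
      ENNReal.ofReal (p.1.1 + p.2) * (eM (p.1.2.2 - p.1.1) * eM (p.1.2.2 + p.2) * P p.1.2)) ?_
    fun_prop

/-- Integrating the left-hand side of `lintegral_increment_le` over all increments. -/
lemma lintegral_increment_eq (u : ℝ × ℝ → ℝ) (hu : Measurable u) :
    2 * ∫⁻ s in Ioi (0 : ℝ), ∫⁻ z, eM z.2 * eM (z.2 + s) *
        ENNReal.ofReal ((u (z.1, z.2 + s) - u z) ^ 2) ∂phaseMeasure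
      = ∫⁻ x, (∫⁻ v, eM v * ∫⁻ w, eM w * ENNReal.ofReal ((u (x, w) - u (x, v)) ^ 2))
        ∂unitMeasure := by
  have hmM := measurable_eM
  have hm : Measurable fun p : ℝ × (ℝ × ℝ) => eM p.2.2 * eM (p.2.2 + p.1) *
      ENNReal.ofReal ((u (p.2.1, p.2.2 + p.1) - u p.2) ^ 2) := by fun_prop
  rw [lintegral_lintegral_swap (hm.aemeasurable)]
  have e1 : ∀ z : ℝ × ℝ, ∫⁻ s in Ioi (0 : ℝ), eM z.2 * eM (z.2 + s) *
        ENNReal.ofReal ((u (z.1, z.2 + s) - u z) ^ 2) = ∫⁻ w in Ioi z.2, eM z.2 * eM w *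
        ENNReal.ofReal ((u (z.1, w) - u (z.1, z.2)) ^ 2) := fun z =>
    lintegral_shift_Ioi (fun w => eM z.2 * eM w *
        ENNReal.ofReal ((u (z.1, w) - u (z.1, z.2)) ^ 2)) z.2
  have hm5 : Measurable fun z : ℝ × ℝ => ∫⁻ w in Ioi z.2, eM z.2 * eM w *
        ENNReal.ofReal ((u (z.1, w) - u (z.1, z.2)) ^ 2) := by
    simp only [← e1]
    refine Measurable.lintegral_prod_right' (f := fun p : (ℝ × ℝ) × ℝ =>
      eM p.1.2 * eM (p.1.2 + p.2) * ENNReal.ofReal ((u (p.1.1, p.1.2 + p.2) - u p.1) ^ 2)) ?_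
    fun_prop
  simp only [e1]
  rw [phaseMeasure_eq, lintegral_prod _ hm5.aemeasurable, ← lintegral_const_mul]
  · refine lintegral_congr fun x => ?_
    rw [two_mul_lintegral_Ioi (F := fun v w => eM v * eM w *
        ENNReal.ofReal ((u (x, w) - u (x, v)) ^ 2))]
    · refine lintegral_congr fun v => ?_
      rw [← lintegral_const_mul]
      · refine lintegral_congr fun w => ?_
        rw [mul_assoc]
      · fun_prop
    · change Measurable fun p : ℝ × ℝ => eM p.1 * eM p.2 *
        ENNReal.ofReal ((u (x, p.2) - u (x, p.1)) ^ 2)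
      fun_prop
    · intro v w
      rw [mul_comm (eM v), ← neg_sub, neg_sq]
  · exact hm5.lintegral_prod_right'

lemma memLp_maxwellian : MemLp maxwellian 2 volume := by
  rw [memLp_two_iff_integrable_sq continuous_maxwellian.aestronglyMeasurable]
  refine integrable_maxwellian.mono' (continuous_maxwellian.pow 2).aestronglyMeasurable
    (Eventually.of_forall fun v => ?_)
  rw [Real.norm_eq_abs, abs_of_nonneg (sq_nonneg _), sq]
  exact mul_le_of_le_one_left (maxwellian_pos v).le (maxwellian_le_one v)

/-- **Gaussian Poincaré inequality** in the velocity variable. -/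
theorem gaussian_poincare {U U' : PhaseL2} (h : Gen transV U U') :
    inner ℝ (mulV maxwellian U) U - ‖moment (toL2 volume maxwellian) U‖ ^ 2
      ≤ inner ℝ (mulV maxwellian U') U' := by
  have hu := measurable_Lp U
  have hu' := measurable_Lp U'
  have hbM := bdd_maxwellian.comp_snd
  -- both sides are integrated over `s > 0`
  have h1 : ∫⁻ s in Ioi (0 : ℝ), ∫⁻ z, eM z.2 * eM (z.2 + s) *
      ENNReal.ofReal ((U (z.1, z.2 + s) - U z) ^ 2) ∂phaseMeasure
      ≤ ∫⁻ z, eM z.2 * ENNReal.ofReal (U' z ^ 2) ∂phaseMeasure := by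
    rw [← lintegral_increment_bound (fun z => ENNReal.ofReal (U' z ^ 2)) (by fun_prop)]
    exact setLIntegral_mono' measurableSet_Ioi fun s hs => lintegral_increment_le h hs
  -- the substitution `w = v + s` turns the left side into half of the integral over all `v`, `w`,
  -- which is the variance
  have h2 : ∫⁻ x, (∫⁻ v, eM v * ∫⁻ w, eM w * ENNReal.ofReal ((U (x, w) - U (x, v)) ^ 2))
      ∂unitMeasure ≤ 2 * ∫⁻ z, eM z.2 * ENNReal.ofReal (U' z ^ 2) ∂phaseMeasure := by
    rw [← lintegral_increment_eq U hu]
    gcongr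
  have hint : ∀ f : PhaseL2, Integrable (fun z : ℝ × ℝ => maxwellian z.2 * f z ^ 2) phaseMeasure :=
    fun f => (integrable_mulL hbM f f).congr
      (Eventually.of_forall fun z => by simp only; ring)
  have hval : ∀ f : PhaseL2, inner ℝ (mulV maxwellian f) f
      = ∫ z, maxwellian z.2 * f z ^ 2 ∂phaseMeasure := fun f => by
    rw [inner_mulL hbM]
    exact integral_congr_ae (Eventually.of_forall fun z => by simp only; ring)
  have hR : ∫⁻ z, eM z.2 * ENNReal.ofReal (U' z ^ 2) ∂phaseMeasure
      = ENNReal.ofReal (inner ℝ (mulV maxwellian U') U') := by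
    rw [hval, ofReal_integral_eq_lintegral_ofReal (hint U')
      (Eventually.of_forall fun z => mul_nonneg (maxwellian_pos _).le (sq_nonneg _))]
    refine lintegral_congr fun z => ?_
    rw [ENNReal.ofReal_mul (maxwellian_pos _).le, eM]
  have hintU := Integrable.prod_of_phase (hint U)
  -- second moment and mean of `U (x, ·)` with respect to the Gaussian measure
  set P : ℝ → ℝ := fun x => ∫ v, maxwellian v * U (x, v) ^ 2
  set g : ℝ → ℝ := fun x => ∫ v, maxwellian v * U (x, v)
  have hPint : Integrable P unitMeasure := hintU.integral_prod_left
  have hslice := hintU.prod_right_ae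
  have hL : ∀ᵐ x ∂unitMeasure, ∫⁻ v, eM v * ∫⁻ w, eM w * ENNReal.ofReal ((U (x, w) - U (x, v)) ^ 2)
      = ENNReal.ofReal (2 * P x - 2 * g x ^ 2) := by
    filter_upwards [hslice] with x hx
    exact lintegral_lintegral_sub_sq (u := fun v => U (x, v)) (by fun_prop) hx
  have hgm : AEStronglyMeasurable g unitMeasure := by
    refine StronglyMeasurable.aestronglyMeasurable ?_
    refine StronglyMeasurable.integral_prod_right' (f := fun z : ℝ × ℝ => maxwellian z.2 * U z) ?_
    exact ((continuous_maxwellian.measurable.comp measurable_snd).mul hu).stronglyMeasurable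
  have hgP : ∀ᵐ x ∂unitMeasure, g x ^ 2 ≤ P x := by
    filter_upwards [hslice] with x hx
    have hu1 : Integrable fun v => maxwellian v * U (x, v) := by
      refine (integrable_maxwellian.add hx).mono'
        (continuous_maxwellian.measurable.mul (by fun_prop)).aestronglyMeasurable
        (Eventually.of_forall fun v => ?_)
      rw [Real.norm_eq_abs, abs_mul, abs_of_pos (maxwellian_pos v), Pi.add_apply]
      have : |U (x, v)| ≤ 1 + U (x, v) ^ 2 := by
        rw [← sq_abs]; nlinarith [sq_nonneg (|U (x, v)| - 1), abs_nonneg (U (x, v))]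
      calc maxwellian v * |U (x, v)| ≤ maxwellian v * (1 + U (x, v) ^ 2) :=
            mul_le_mul_of_nonneg_left this (maxwellian_pos v).le
        _ = _ := by ring
    have h0 : 0 ≤ ∫ v, maxwellian v * (U (x, v) - g x) ^ 2 :=
      integral_nonneg fun v => mul_nonneg (maxwellian_pos v).le (sq_nonneg _)
    have e : ∀ w, maxwellian w * (U (x, w) - g x) ^ 2 = maxwellian w * U (x, w) ^ 2
      - 2 * g x * (maxwellian w * U (x, w)) + g x ^ 2 * maxwellian w := fun w => by ring
    simp only [e] at h0
    rw [(integral_sub_add_const_mul hx hu1 integrable_maxwellian (2 * g x) (g x ^ 2)).2,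
      integral_maxwellian] at h0
    change 0 ≤ P x - 2 * g x * g x + g x ^ 2 * 1 at h0
    nlinarith
  have hg2 : Integrable (fun x => g x ^ 2) unitMeasure :=
    hPint.mono' (hgm.pow 2) (by
      filter_upwards [hgP] with x hx
      rwa [Real.norm_eq_abs, abs_of_nonneg (sq_nonneg _)])
  have hgL : MemLp g 2 unitMeasure := (memLp_two_iff_integrable_sq hgm).2 hg2
  -- the moment, which is defined by duality, is the fibrewise mean
  have hmom : moment (toL2 volume maxwellian) U = toL2 unitMeasure g := by
    refine ext_inner_right ℝ fun s => ?_
    rw [inner_moment, inner_eq_integral, inner_eq_integral]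
    have e1 : ∫ z, U z * tensor s (toL2 volume maxwellian) z ∂phaseMeasure
        = ∫ z, s z.1 * (maxwellian z.2 * U z) ∂phaseMeasure := by
      refine integral_congr_ae ?_
      filter_upwards [tensor_coe s (toL2 volume maxwellian), ae_snd (toL2_coe memLp_maxwellian)]
        with z h3 h4
      rw [h3, h4]; ring
    have i1 : Integrable (fun z : ℝ × ℝ => s z.1 * (maxwellian z.2 * U z))
        phaseMeasure := by
      refine (integrable_mul_Lp U (tensor s (toL2 volume maxwellian))).congr ?_
      filter_upwards [tensor_coe s (toL2 volume maxwellian), ae_snd (toL2_coe memLp_maxwellian)]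
        with z h3 h4
      rw [h3, h4]; ring
    rw [e1, integral_phase_prod i1]
    refine integral_congr_ae ?_
    filter_upwards [toL2_coe hgL] with x hx
    rw [integral_const_mul, hx, mul_comm]
  have hnorm : ‖moment (toL2 volume maxwellian) U‖ ^ 2 = ∫ x, g x ^ 2 ∂unitMeasure := by
    rw [hmom, norm_sq_eq_integral]
    refine integral_congr_ae ?_
    filter_upwards [toL2_coe hgL] with x hx
    rw [hx]
  have hPval : inner ℝ (mulV maxwellian U) U = ∫ x, P x ∂unitMeasure := by
    rw [hval, integral_phase_prod (hint U)]
  have i3 : Integrable (fun x => 2 * P x - 2 * g x ^ 2) unitMeasure :=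
    (hPint.const_mul 2).sub (hg2.const_mul 2)
  have h22 : 2 * ENNReal.ofReal (inner ℝ (mulV maxwellian U') U')
      = ENNReal.ofReal (2 * inner ℝ (mulV maxwellian U') U') := by
    rw [ENNReal.ofReal_mul zero_le_two, ENNReal.ofReal_ofNat]
  rw [lintegral_congr_ae hL, hR, ← ofReal_integral_eq_lintegral_ofReal i3 (by
    filter_upwards [hgP] with x hx
    simp only [Pi.zero_apply]; linarith), integral_sub (hPint.const_mul 2) (hg2.const_mul 2),
    integral_const_mul, integral_const_mul, ← hPval, ← hnorm,
    h22, ENNReal.ofReal_le_ofReal_iff] at h2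
  · linarith
  · exact mul_nonneg zero_le_two (inner_mulL_nonneg hbM (fun z => (maxwellian_pos _).le) U')

/-! ### Weights in the velocity variable -/

lemma Bdd.of_continuous {b : ℝ → ℝ} (hb : Continuous b) {C : ℝ} (hC : ∀ v, |b v| ≤ C) : Bdd b :=
  ⟨hb.measurable, C, hC⟩

/-- The square root of the Maxwellian. -/
def rootM (v : ℝ) : ℝ := Real.sqrt (maxwellian v)

lemma rootM_pos (v : ℝ) : 0 < rootM v := Real.sqrt_pos.2 (maxwellian_pos v)

lemma rootM_mul_self (v : ℝ) : rootM v * rootM v = maxwellian v :=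
  Real.mul_self_sqrt (maxwellian_pos v).le

lemma contDiff_rootM : ContDiff ℝ ∞ rootM :=
  contDiff_maxwellian.sqrt fun v => (maxwellian_pos v).ne'

lemma bdd_rootM : Bdd rootM := .of_continuous contDiff_rootM.continuous (C := 1) fun v => by
  rw [abs_of_pos (rootM_pos v), rootM, Real.sqrt_le_one]; exact maxwellian_le_one v

lemma memLp_rootM : MemLp rootM 2 volume := by
  rw [memLp_two_iff_integrable_sq contDiff_rootM.continuous.aestronglyMeasurable]
  exact integrable_maxwellian.congr (Eventually.of_forall fun v => by
    simp only [sq, rootM_mul_self])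

lemma norm_rootM : ‖toL2 volume rootM‖ = 1 := by
  rw [← sq_eq_sq₀ (norm_nonneg _) zero_le_one, ← real_inner_self_eq_norm_sq,
    inner_toL2 memLp_rootM memLp_rootM]
  simp only [rootM_mul_self]
  rw [integral_maxwellian, one_pow]

/-- The weight `ω(v) = (1 + v²)⁻¹`: multiplying the equation by `ω` makes all of its coefficients
bounded. -/
def omega (v : ℝ) : ℝ := (1 + v ^ 2)⁻¹

lemma one_add_sq_pos (v : ℝ) : 0 < 1 + v ^ 2 := by positivity

lemma abs_le_one_add_sq (v : ℝ) : |v| ≤ 1 + v ^ 2 := by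
  rw [← sq_abs]; nlinarith [sq_nonneg (|v| - 1), abs_nonneg v]

lemma contDiff_omega : ContDiff ℝ ∞ omega := by
  unfold omega
  exact ContDiff.inv (by fun_prop) fun v => (one_add_sq_pos v).ne'

lemma hasDerivAt_omega (v : ℝ) : HasDerivAt omega (-(2 * v) * omega v ^ 2) v := by
  have h : HasDerivAt (fun v : ℝ => 1 + v ^ 2) (2 * v) v := by
    simpa using (hasDerivAt_pow 2 v).const_add 1
  refine (h.inv (one_add_sq_pos v).ne').congr_deriv ?_
  rw [omega]; field_simp

lemma deriv_omega : deriv omega = fun v => -(2 * v) * omega v ^ 2 :=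
  funext fun v => (hasDerivAt_omega v).deriv

lemma bdd_omega : Bdd omega := by
  refine .of_continuous contDiff_omega.continuous (C := 1) fun v => ?_
  rw [omega, abs_of_pos (inv_pos.2 (one_add_sq_pos v))]
  exact inv_le_one_of_one_le₀ (by nlinarith)

lemma bdd_id_mul_omega : Bdd fun v => v * omega v := by
  refine .of_continuous (continuous_id.mul contDiff_omega.continuous) (C := 1) fun v => ?_
  rw [omega, abs_mul, abs_inv, abs_of_pos (one_add_sq_pos v), ← div_eq_mul_inv,
    div_le_one (one_add_sq_pos v)]
  exact abs_le_one_add_sq v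

lemma bdd_deriv_omega : Bdd (deriv omega) := by
  rw [deriv_omega]
  convert (bdd_id_mul_omega.mul bdd_omega).const_mul (-2) using 2 with v
  ring

lemma bdd_id_mul_deriv_omega : Bdd fun v => v * deriv omega v := by
  rw [deriv_omega]
  convert (bdd_id_mul_omega.mul bdd_id_mul_omega).const_mul (-2) using 2 with v
  ring

/-- The regularized Maxwellian `q_η(v) = M(v) + η (1 + v²)`. -/
def regMaxwellian (η v : ℝ) : ℝ := maxwellian v + η * (1 + v ^ 2)

/-- The bounded weight `w_η = 1 / q_η`, which increases to `1 / M` as `η` decreases to `0`. -/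
def regWeight (η v : ℝ) : ℝ := (regMaxwellian η v)⁻¹

/-- The derivative of `q_η`. -/
def regSlope (η v : ℝ) : ℝ := -v * maxwellian v + η * (2 * v)

variable {η : ℝ}

lemma regMaxwellian_pos (hη : 0 < η) (v : ℝ) : 0 < regMaxwellian η v :=
  add_pos (maxwellian_pos v) (mul_pos hη (one_add_sq_pos v))

lemma regWeight_pos (hη : 0 < η) (v : ℝ) : 0 < regWeight η v := inv_pos.2 (regMaxwellian_pos hη v)

lemma regMaxwellian_mul_regWeight (hη : 0 < η) (v : ℝ) :
    regMaxwellian η v * regWeight η v = 1 := mul_inv_cancel₀ (regMaxwellian_pos hη v).ne'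

lemma hasDerivAt_regMaxwellian (v : ℝ) : HasDerivAt (regMaxwellian η) (regSlope η v) v := by
  have h : HasDerivAt (fun v : ℝ => 1 + v ^ 2) (2 * v) v := by
    simpa using (hasDerivAt_pow 2 v).const_add 1
  exact (hasDerivAt_maxwellian v).add (h.const_mul η)

lemma contDiff_regWeight (hη : 0 < η) : ContDiff ℝ ∞ (regWeight η) := by
  unfold regWeight regMaxwellian
  refine ContDiff.inv (contDiff_maxwellian.add (by fun_prop)) fun v =>
    (regMaxwellian_pos hη v).ne'

lemma hasDerivAt_regWeight (hη : 0 < η) (v : ℝ) :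
    HasDerivAt (regWeight η) (-regSlope η v * regWeight η v ^ 2) v := by
  refine ((hasDerivAt_regMaxwellian v).inv (regMaxwellian_pos hη v).ne').congr_deriv ?_
  rw [regWeight, div_eq_mul_inv, inv_pow]

lemma eta_mul_regWeight_le (hη : 0 < η) (v : ℝ) : η * (1 + v ^ 2) * regWeight η v ≤ 1 := by
  refine le_of_le_of_eq ?_ (regMaxwellian_mul_regWeight hη v)
  exact mul_le_mul_of_nonneg_right (le_add_of_nonneg_left (maxwellian_pos v).le)
    (regWeight_pos hη v).le

lemma maxwellian_mul_regWeight_le (hη : 0 < η) (v : ℝ) : maxwellian v * regWeight η v ≤ 1 := by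
  refine le_of_le_of_eq ?_ (regMaxwellian_mul_regWeight hη v)
  exact mul_le_mul_of_nonneg_right (le_add_of_nonneg_right (mul_pos hη (one_add_sq_pos v)).le)
    (regWeight_pos hη v).le

lemma bdd_one_add_sq_mul_regWeight (hη : 0 < η) : Bdd fun v => (1 + v ^ 2) * regWeight η v := by
  refine .of_continuous (Continuous.mul (by fun_prop) (contDiff_regWeight hη).continuous)
    (C := η⁻¹) fun v => ?_
  rw [abs_of_pos (mul_pos (one_add_sq_pos v) (regWeight_pos hη v)), ← one_div, le_div_iff₀' hη,
    ← mul_assoc]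
  exact eta_mul_regWeight_le hη v

lemma bdd_regWeight (hη : 0 < η) : Bdd (regWeight η) := by
  convert bdd_omega.mul (bdd_one_add_sq_mul_regWeight hη) using 2 with v
  rw [omega, inv_mul_cancel_left₀ (one_add_sq_pos v).ne']

lemma bdd_id_mul_regWeight (hη : 0 < η) : Bdd fun v => v * regWeight η v := by
  convert bdd_id_mul_omega.mul (bdd_one_add_sq_mul_regWeight hη) using 2 with v
  rw [omega, mul_assoc, inv_mul_cancel_left₀ (one_add_sq_pos v).ne']

lemma bdd_regSlope_mul_regWeight (hη : 0 < η) : Bdd fun v => regSlope η v * regWeight η v := by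
  convert ((bdd_maxwellian.const_mul (-1)).add (.const (2 * η))).mul (bdd_id_mul_regWeight hη)
    using 2 with v
  rw [regSlope]; ring

/-- The derivative of `w_η`. -/
def regWeightDeriv (η v : ℝ) : ℝ := -regSlope η v * regWeight η v ^ 2

lemma deriv_regWeight (hη : 0 < η) : deriv (regWeight η) = regWeightDeriv η :=
  funext fun v => (hasDerivAt_regWeight hη v).deriv

lemma bdd_regWeightDeriv (hη : 0 < η) : Bdd (regWeightDeriv η) := by
  convert ((bdd_regSlope_mul_regWeight hη).mul (bdd_regWeight hη)).neg using 2 with v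
  rw [regWeightDeriv]; ring

lemma bdd_id_mul_regWeightDeriv (hη : 0 < η) : Bdd fun v => v * regWeightDeriv η v := by
  convert ((bdd_regSlope_mul_regWeight hη).mul (bdd_id_mul_regWeight hη)).neg using 2 with v
  rw [regWeightDeriv]; ring

lemma contDiff_one_add_sq_mul_regWeight (hη : 0 < η) :
    ContDiff ℝ ∞ fun v => (1 + v ^ 2) * regWeight η v :=
  ContDiff.mul (by fun_prop) (contDiff_regWeight hη)

lemma deriv_one_add_sq_mul_regWeight (hη : 0 < η) :
    deriv (fun v => (1 + v ^ 2) * regWeight η v)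
      = fun v => 2 * v * regWeight η v + (1 + v ^ 2) * regWeightDeriv η v := by
  funext v
  have h : HasDerivAt (fun v : ℝ => 1 + v ^ 2) (2 * v) v := by
    simpa using (hasDerivAt_pow 2 v).const_add 1
  exact (h.mul (hasDerivAt_regWeight hη v)).deriv

lemma bdd_deriv_one_add_sq_mul_regWeight (hη : 0 < η) :
    Bdd (deriv fun v => (1 + v ^ 2) * regWeight η v) := by
  rw [deriv_one_add_sq_mul_regWeight hη]
  convert ((bdd_id_mul_regWeight hη).const_mul 2).sub
    ((bdd_regSlope_mul_regWeight hη).mul (bdd_one_add_sq_mul_regWeight hη)) using 2 with v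
  rw [regWeightDeriv]; ring

/-- The coefficient `(q' + v q) / q²` of the cross term in the Fokker--Planck dissipation. -/
def crossCoeff (η v : ℝ) : ℝ := regSlope η v * regWeight η v ^ 2 + v * regWeight η v

lemma contDiff_crossCoeff (hη : 0 < η) : ContDiff ℝ ∞ (crossCoeff η) := by
  unfold crossCoeff regSlope
  have := contDiff_regWeight hη
  have := contDiff_maxwellian
  fun_prop

/-- Since `M'' + (v M)' = 0`, only the regularization contributes to `q'' + (v q)'`. -/
lemma deriv_crossCoeff (hη : 0 < η) (v : ℝ) :
    deriv (crossCoeff η) v = 3 * η * (1 + v ^ 2) * regWeight η v ^ 2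
      - 2 * crossCoeff η v * (regSlope η v * regWeight η v) := by
  have hs : HasDerivAt (regSlope η) (-maxwellian v + v ^ 2 * maxwellian v + 2 * η) v := by
    have h1 := ((hasDerivAt_id v).neg.mul (hasDerivAt_maxwellian v)).add
      (((hasDerivAt_id v).const_mul 2).const_mul η)
    refine h1.congr_deriv ?_
    simp only [id, Pi.neg_apply]; ring
  have hw := hasDerivAt_regWeight hη v
  have h := (hs.mul (hw.pow 2)).add ((hasDerivAt_id v).mul hw)
  have e : crossCoeff η = regSlope η * regWeight η ^ 2 + id * regWeight η := by
    funext v; simp [crossCoeff]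
  rw [e, h.deriv]
  have hq := regMaxwellian_mul_regWeight hη v
  simp only [id, Pi.pow_apply, Pi.add_apply, Pi.mul_apply]
  have hM : maxwellian v * regWeight η v = 1 - η * (1 + v ^ 2) * regWeight η v := by
    rw [regMaxwellian] at hq; linarith
  simp only [regSlope]
  push_cast
  linear_combination -regWeight η v * hM

lemma bdd_crossCoeff (hη : 0 < η) : Bdd (crossCoeff η) := by
  convert ((bdd_regSlope_mul_regWeight hη).mul (bdd_regWeight hη)).add (bdd_id_mul_regWeight hη)
    using 2 with v
  rw [crossCoeff]; ring

lemma bdd_deriv_crossCoeff (hη : 0 < η) : Bdd (deriv (crossCoeff η)) := by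
  convert (((bdd_one_add_sq_mul_regWeight hη).mul (bdd_regWeight hη)).const_mul (3 * η)).sub
    (((bdd_crossCoeff hη).const_mul 2).mul (bdd_regSlope_mul_regWeight hη)) using 2 with v
  rw [deriv_crossCoeff hη]; ring

/-! ### The evolution equation, weakly in time and velocity -/

/-- The flux in `v`, weighted with `ω`: the equation reads
`ε ∂ₜ(ω F) + source = ∂_v flux`. -/
def flux (ε : ℝ) (F Fv G : PhaseL2) : PhaseL2 :=
  mulV omega (G + ε⁻¹ • Fv) + ε⁻¹ • mulV (fun v => v * omega v) F

/-- The terms of the weighted equation that are not a derivative in `v`. -/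
def source (ε : ℝ) (F Fx Fv G : PhaseL2) : PhaseL2 :=
  mulV (fun v => v * omega v) Fx + mulV (deriv omega) (G + ε⁻¹ • Fv)
    + ε⁻¹ • mulV (fun v => v * deriv omega v) F

/-- `F`, periodic in `x`, with derivatives `Fx` and `Fv`, solves
`ε ∂ₜF + v ∂ₓF - ∂_v G = ε⁻¹ ∂_v (v F + ∂_v F)` for `t ≥ 0`. The equation is multiplied with `ω`
and integrated in time, so that it says that a flux has a velocity derivative in `L²`. -/
structure Sol (ε : ℝ) (F Fx Fv G : ℝ → PhaseL2) : Prop where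
  cont : Continuous F
  contX : Continuous Fx
  contV : Continuous Fv
  contG : Continuous G
  genX : ∀ t, Gen rotX (F t) (Fx t)
  genV : ∀ t, Gen transV (F t) (Fv t)
  evol : ∀ s t, 0 ≤ s → s ≤ t → Gen transV (∫ r in s..t, flux ε (F r) (Fv r) (G r))
    (ε • mulV omega (F t - F s) + ∫ r in s..t, source ε (F r) (Fx r) (Fv r) (G r))

lemma flux_sub (ε : ℝ) (F F₁ Fv Fv₁ G G₁ : PhaseL2) :
    flux ε (F - F₁) (Fv - Fv₁) (G - G₁) = flux ε F Fv G - flux ε F₁ Fv₁ G₁ := by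
  simp only [flux, map_sub, map_add, map_smul, smul_sub]
  abel

lemma source_sub (ε : ℝ) (F F₁ Fx Fx₁ Fv Fv₁ G G₁ : PhaseL2) :
    source ε (F - F₁) (Fx - Fx₁) (Fv - Fv₁) (G - G₁)
      = source ε F Fx Fv G - source ε F₁ Fx₁ Fv₁ G₁ := by
  simp only [source, map_sub, map_add, map_smul, smul_sub]
  abel

lemma flux_rotX (ε δ : ℝ) (F Fv G : PhaseL2) :
    flux ε (rotX δ F) (rotX δ Fv) (rotX δ G) = rotX δ (flux ε F Fv G) := by
  simp only [flux, map_add, map_smul, mulV_rotX bdd_omega, mulV_rotX bdd_id_mul_omega]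

lemma source_rotX (ε δ : ℝ) (F Fx Fv G : PhaseL2) :
    source ε (rotX δ F) (rotX δ Fx) (rotX δ Fv) (rotX δ G) = rotX δ (source ε F Fx Fv G) := by
  simp only [source, map_add, map_smul, mulV_rotX bdd_deriv_omega, mulV_rotX bdd_id_mul_omega,
    mulV_rotX bdd_id_mul_deriv_omega]

namespace Sol

variable {ε : ℝ} {F Fx Fv G : ℝ → PhaseL2}

lemma continuous_flux (h : Sol ε F Fx Fv G) : Continuous fun t => flux ε (F t) (Fv t) (G t) := by
  have := h.cont; have := h.contV; have := h.contG
  unfold flux; fun_prop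

lemma continuous_source (h : Sol ε F Fx Fv G) :
    Continuous fun t => source ε (F t) (Fx t) (Fv t) (G t) := by
  have := h.cont; have := h.contX; have := h.contV; have := h.contG
  unfold source; fun_prop

/-- Differences in `x` of a solution are solutions. -/
lemma rotX_sub (h : Sol ε F Fx Fv G) (δ : ℝ) :
    Sol ε (fun t => rotX δ (F t) - F t) (fun t => rotX δ (Fx t) - Fx t)
      (fun t => rotX δ (Fv t) - Fv t) (fun t => rotX δ (G t) - G t) where
  cont := ((rotX δ).continuous.comp h.cont).sub h.cont
  contX := ((rotX δ).continuous.comp h.contX).sub h.contX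
  contV := ((rotX δ).continuous.comp h.contV).sub h.contV
  contG := ((rotX δ).continuous.comp h.contG).sub h.contG
  genX t := Gen.sub isGroup_rotX ((h.genX t).map isGroup_rotX (rotX δ).toContinuousLinearMap
    fun s f => by simp [← isGroup_rotX.add, add_comm]) (h.genX t)
  genV t := Gen.sub isGroup_transV ((h.genV t).map isGroup_transV (rotX δ).toContinuousLinearMap
    fun s f => rotX_transV δ s f) (h.genV t)
  evol s t hs hst := by
    have h1 := (h.evol s t hs hst).map isGroup_transV (rotX δ).toContinuousLinearMap
      fun s f => rotX_transV δ s f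
    have h2 := Gen.sub isGroup_transV h1 (h.evol s t hs hst)
    have i1 := h.continuous_flux.intervalIntegrable (μ := volume) s t
    have i2 := h.continuous_source.intervalIntegrable (μ := volume) s t
    have j1 : IntervalIntegrable (fun r => rotX δ (flux ε (F r) (Fv r) (G r))) volume s t :=
      ((rotX δ).continuous.comp h.continuous_flux).intervalIntegrable s t
    have j2 : IntervalIntegrable (fun r => rotX δ (source ε (F r) (Fx r) (Fv r) (G r))) volume
        s t :=
      ((rotX δ).continuous.comp h.continuous_source).intervalIntegrable s t
    convert h2 using 1
    · simp only [flux_sub, flux_rotX]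
      rw [intervalIntegral.integral_sub j1 i1,
        ← (rotX δ).toContinuousLinearMap.intervalIntegral_comp_comm i1]
      rfl
    · simp only [source_sub, source_rotX]
      rw [intervalIntegral.integral_sub j2 i2, map_add,
        ← (rotX δ).toContinuousLinearMap.intervalIntegral_comp_comm i2]
      simp only [LinearIsometry.coe_toContinuousLinearMap, map_smul, map_sub, smul_sub,
        mulV_rotX bdd_omega]
      abel

/-- The equation tested with `ω Ψ`, where `Ψ` need not be regular in `x`. -/
lemma inner_diff (h : Sol ε F Fx Fv G) {s t : ℝ} (hs : 0 ≤ s) (hst : s ≤ t) {Ψ Ψ' : PhaseL2}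
    (hΨ : Gen transV Ψ Ψ') :
    ε * inner ℝ (F t - F s) (mulV omega Ψ)
      = -(inner ℝ (∫ r in s..t, source ε (F r) (Fx r) (Fv r) (G r)) Ψ
        + inner ℝ (∫ r in s..t, flux ε (F r) (Fv r) (G r)) Ψ') := by
  have h1 := Gen.inner_skew isGroup_transV (h.evol s t hs hst) hΨ
  rw [inner_add_left, real_inner_smul_left, inner_mulL_comm] at h1
  linarith

end Sol

lemma tendsto_average {X : Type*} [NormedAddCommGroup X] [NormedSpace ℝ X] [CompleteSpace X]
    {p : ℝ → X} (hp : Continuous p) (s : ℝ) :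
    Tendsto (fun t => (t - s)⁻¹ • ∫ r in s..t, p r) (𝓝[>] s) (𝓝 (p s)) := by
  have h := (hp.integral_hasStrictDerivAt s s).hasDerivAt
  rw [hasDerivAt_iff_tendsto_slope] at h
  refine (h.mono_left (nhdsWithin_mono _ fun t (ht : s < t) => ht.ne')).congr fun t => ?_
  simp [slope, vsub_eq_sub]

/-- The product rule: if the increments of `Θ` are obtained by testing the increments of `F`, then
`Θ` is differentiable from the right. -/
lemma Sol.hasDerivWithinAt {ε : ℝ} (hε : 0 < ε) {F Fx Fv G : ℝ → PhaseL2} (h : Sol ε F Fx Fv G)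
    {Θ : ℝ → ℝ} {Ψ₁ Ψ₁' Ψ₂ Ψ₂' : ℝ → PhaseL2} (hg₁ : ∀ t, Gen transV (Ψ₁ t) (Ψ₁' t))
    (hg₂ : ∀ t, Gen transV (Ψ₂ t) (Ψ₂' t)) (hc₁ : Continuous Ψ₁) (hc₁' : Continuous Ψ₁')
    (hΘ : ∀ s t, Θ t - Θ s = inner ℝ (F t - F s) (mulV omega (Ψ₁ t + Ψ₂ s)))
    {s : ℝ} (hs : 0 ≤ s) :
    HasDerivWithinAt Θ (-ε⁻¹ * (inner ℝ (source ε (F s) (Fx s) (Fv s) (G s)) (Ψ₁ s + Ψ₂ s)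
      + inner ℝ (flux ε (F s) (Fv s) (G s)) (Ψ₁' s + Ψ₂' s))) (Ioi s) s := by
  rw [hasDerivWithinAt_iff_tendsto_slope' (by simp)]
  have t1 := tendsto_average h.continuous_source s
  have t2 := tendsto_average h.continuous_flux s
  have t3 : Tendsto (fun t => Ψ₁ t + Ψ₂ s) (𝓝[>] s) (𝓝 (Ψ₁ s + Ψ₂ s)) :=
    ((hc₁.tendsto s).mono_left nhdsWithin_le_nhds).add_const _
  have t4 : Tendsto (fun t => Ψ₁' t + Ψ₂' s) (𝓝[>] s) (𝓝 (Ψ₁' s + Ψ₂' s)) :=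
    ((hc₁'.tendsto s).mono_left nhdsWithin_le_nhds).add_const _
  refine (((t1.inner t3).add (t2.inner t4)).const_mul (-ε⁻¹)).congr' ?_
  filter_upwards [self_mem_nhdsWithin] with t (ht : s < t)
  have h1 := h.inner_diff hs ht.le (Gen.add isGroup_transV (hg₁ t) (hg₂ s))
  rw [slope_def_field, hΘ, real_inner_smul_left, real_inner_smul_left]
  have h2 : inner ℝ (F t - F s) (mulV omega (Ψ₁ t + Ψ₂ s))
      = ε⁻¹ * (ε * inner ℝ (F t - F s) (mulV omega (Ψ₁ t + Ψ₂ s))) := by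
    field_simp
  rw [h2, h1]
  ring

/-- The fundamental theorem of calculus for `e^{rt} Θ(t)`, from right derivatives. -/
lemma exp_mul_eq_add_integral {Θ D : ℝ → ℝ} (hΘ : Continuous Θ) (hD : Continuous D)
    (h : ∀ s, 0 ≤ s → HasDerivWithinAt Θ (D s) (Ioi s) s) (r : ℝ) {t : ℝ} (ht : 0 ≤ t) :
    Real.exp (r * t) * Θ t
      = Θ 0 + ∫ s in (0 : ℝ)..t, Real.exp (r * s) * (r * Θ s + D s) := by
  have h1 : ∫ s in (0 : ℝ)..t, Real.exp (r * s) * (r * Θ s + D s)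
      = Real.exp (r * t) * Θ t - Real.exp (r * 0) * Θ 0 := by
    refine intervalIntegral.integral_eq_sub_of_hasDeriv_right_of_le ht
      (by fun_prop : Continuous fun s => Real.exp (r * s) * Θ s).continuousOn (fun s hs => ?_)
      ((by fun_prop : Continuous fun s => Real.exp (r * s) *
        (r * Θ s + D s)).intervalIntegrable 0 t)
    have h2 : HasDerivAt (fun s => Real.exp (r * s)) (Real.exp (r * s) * r) s := by
      simpa using ((hasDerivAt_id s).const_mul r).exp
    refine (h2.hasDerivWithinAt.mul (h s hs.1.le)).congr_deriv ?_
    ring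
  rw [h1]
  simp

/-! ### The weighted energy -/

/-- The weighted energy `∫ w_η F²`, which increases to `‖F / √M‖²` as `η` decreases to `0`. -/
def energy (η : ℝ) (F : PhaseL2) : ℝ := inner ℝ (mulV (regWeight η) F) F

/-- The operator `F ↦ w_η F` followed by integration against `M` in the velocity. -/
def densityOp (η : ℝ) : PhaseL2 →L[ℝ] SpaceL2 :=
  (moment (toL2 volume maxwellian)).comp (mulV (regWeight η))

/-- The microscopic part `∫ M (w_η F)² - ∫ (∫ M w_η F dv)² dx` of the energy. -/
def microEnergy (η : ℝ) (F : PhaseL2) : ℝ :=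
  inner ℝ (mulV (fun v => maxwellian v * regWeight η v ^ 2) F) F - ‖densityOp η F‖ ^ 2

/-- The error caused by the regularization of the Maxwellian. -/
def defect (η : ℝ) (F : PhaseL2) : ℝ :=
  inner ℝ (mulV (fun v => η * (1 + v ^ 2) * regWeight η v ^ 2) F) F

variable {η : ℝ}

lemma bdd_maxwellian_mul_regWeight_sq (hη : 0 < η) :
    Bdd fun v => maxwellian v * regWeight η v ^ 2 := by
  convert bdd_maxwellian.mul ((bdd_regWeight hη).mul (bdd_regWeight hη)) using 2
  ring

lemma bdd_defect (hη : 0 < η) : Bdd fun v => η * (1 + v ^ 2) * regWeight η v ^ 2 := by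
  convert ((bdd_one_add_sq_mul_regWeight hη).mul (bdd_regWeight hη)).const_mul η using 2
  ring

/-- The derivative of `w_η F` is `w_η` times the Fokker--Planck current `∂_v F - (q'/q) F`. -/
def current (η : ℝ) (F Fv : PhaseL2) : PhaseL2 :=
  Fv - mulV (fun v => regSlope η v * regWeight η v) F

lemma mulV_current (hη : 0 < η) (F Fv : PhaseL2) :
    mulV (regWeight η) (current η F Fv) = mulV (regWeightDeriv η) F + mulV (regWeight η) Fv := by
  rw [current, map_sub, mulL_mul (bdd_regWeight hη).comp_snd
    (bdd_regSlope_mul_regWeight hη).comp_snd]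
  have : mulL (fun z : ℝ × ℝ => regWeight η z.2 * (regSlope η z.2 * regWeight η z.2)) F
      = -mulV (regWeightDeriv η) F := by
    rw [← neg_one_smul ℝ, ← mulL_const_mul (bdd_regWeightDeriv hη).comp_snd]
    congr 2 with z
    rw [regWeightDeriv]; ring
  rw [this]; abel

lemma gen_mulV_regWeight (hη : 0 < η) {F Fv : PhaseL2} (h : Gen transV F Fv) :
    Gen transV (mulV (regWeight η) F) (mulV (regWeight η) (current η F Fv)) := by
  have h1 := h.mul_velocity (contDiff_regWeight hη) (bdd_regWeight hη)
    (by rw [deriv_regWeight hη]; exact bdd_regWeightDeriv hη)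
  rwa [deriv_regWeight hη, ← mulV_current hη] at h1

/-- The Fokker--Planck dissipation of the weighted energy. -/
lemma inner_current (hη : 0 < η) {F Fv : PhaseL2} (h : Gen transV F Fv) :
    inner ℝ Fv (mulV (regWeight η) (current η F Fv))
      + inner ℝ F (mulV (fun v => v * regWeightDeriv η v) F + mulV (fun v => v * regWeight η v) Fv)
      = energy η (current η F Fv) - 3 / 2 * defect η F := by
  have hw := (bdd_regWeight hη).comp_snd
  have hs := (bdd_regSlope_mul_regWeight hη).comp_snd
  have hd := (bdd_regWeightDeriv hη).comp_snd
  have hvd := (bdd_id_mul_regWeightDeriv hη).comp_snd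
  have hvw := (bdd_id_mul_regWeight hη).comp_snd
  have hβ := (bdd_crossCoeff hη).comp_snd
  have hβ' := (bdd_deriv_crossCoeff hη).comp_snd
  have hdef := (bdd_defect hη).comp_snd
  -- integration by parts for the cross term
  have h1 := Gen.inner_skew isGroup_transV
    (h.mul_velocity (contDiff_crossCoeff hη) (bdd_crossCoeff hη) (bdd_deriv_crossCoeff hη)) h
  rw [inner_add_left] at h1
  have h2 : inner ℝ (mulV (crossCoeff η) Fv) F = inner ℝ (mulV (crossCoeff η) F) Fv := by
    rw [inner_mulL_comm, real_inner_comm]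
  have e1 : inner ℝ Fv (mulV (regWeight η) (current η F Fv))
      = energy η (current η F Fv) + inner ℝ (mulV (fun v => regSlope η v * regWeight η v) F)
        (mulV (regWeightDeriv η) F + mulV (regWeight η) Fv) := by
    rw [← mulV_current hη, energy, inner_mulL_comm, ← inner_add_left, current]
    simp
  have e2 : inner ℝ (mulV (fun v => regSlope η v * regWeight η v) F)
        (mulV (regWeightDeriv η) F + mulV (regWeight η) Fv)
      + inner ℝ F (mulV (fun v => v * regWeightDeriv η v) F + mulV (fun v => v * regWeight η v) Fv)
      = -inner ℝ (mulV (fun v => crossCoeff η v * (regSlope η v * regWeight η v)) F) F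
        + inner ℝ (mulV (crossCoeff η) F) Fv := by
    rw [inner_add_right, inner_add_right, ← inner_mulL_comm, ← inner_mulL_comm, mulL_mul hd hs,
      ← inner_mulL_comm, ← inner_mulL_comm, mulL_mul hw hs]
    have a1 : mulL (fun z : ℝ × ℝ => crossCoeff η z.2 * (regSlope η z.2 * regWeight η z.2)) F
        = -(mulL (fun z : ℝ × ℝ => regWeightDeriv η z.2 * (regSlope η z.2 * regWeight η z.2)) F
          + mulL (fun z : ℝ × ℝ => z.2 * regWeightDeriv η z.2) F) := by
      rw [← mulL_add (hd.mul hs) hvd, ← neg_one_smul ℝ, ← mulL_const_mul ((hd.mul hs).add hvd)]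
      congr 2 with z
      rw [regWeightDeriv, crossCoeff]; ring
    have a2 : mulL (fun z : ℝ × ℝ => crossCoeff η z.2) F
        = mulL (fun z : ℝ × ℝ => regWeight η z.2 * (regSlope η z.2 * regWeight η z.2)) F
          + mulL (fun z : ℝ × ℝ => z.2 * regWeight η z.2) F := by
      rw [← mulL_add (hw.mul hs) hvw]
      congr 2 with z
      rw [crossCoeff]; ring
    rw [a1, a2, inner_neg_left, inner_add_left, inner_add_left]
    ring
  have e3 : inner ℝ (mulV (deriv (crossCoeff η)) F) F = 3 * defect η F
      - 2 * inner ℝ (mulV (fun v => crossCoeff η v * (regSlope η v * regWeight η v)) F) F := by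
    have : mulV (deriv (crossCoeff η)) F
        = (3 : ℝ) • mulV (fun v => η * (1 + v ^ 2) * regWeight η v ^ 2) F
          + (-2 : ℝ) • mulV (fun v => crossCoeff η v * (regSlope η v * regWeight η v)) F := by
      rw [← mulL_const_mul hdef, ← mulL_const_mul (hβ.mul hs),
        ← mulL_add (hdef.const_mul 3) ((hβ.mul hs).const_mul (-2))]
      refine congrArg (fun b => mulL b F) (funext fun z => ?_)
      rw [deriv_crossCoeff hη]; ring
    rw [this, inner_add_left, real_inner_smul_left, real_inner_smul_left, defect]
    ring
  linarith

/-- The Gaussian Poincaré inequality bounds the dissipation from below. -/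
lemma microEnergy_le (hη : 0 < η) {F Fv : PhaseL2} (h : Gen transV F Fv) :
    microEnergy η F ≤ energy η (current η F Fv) := by
  have hw := (bdd_regWeight hη).comp_snd
  have hM := bdd_maxwellian.comp_snd
  have h1 := gaussian_poincare (gen_mulV_regWeight hη h)
  have e : ∀ F : PhaseL2, inner ℝ (mulV maxwellian (mulV (regWeight η) F)) (mulV (regWeight η) F)
      = inner ℝ (mulV (fun v => maxwellian v * regWeight η v ^ 2) F) F := fun F => by
    rw [← inner_mulL_comm, mulL_mul hM hw, mulL_mul hw (hM.mul hw)]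
    congr 3 with z
    ring
  rw [e, e] at h1
  refine h1.trans (inner_mulL_mono (bdd_maxwellian_mul_regWeight_sq hη).comp_snd hw
    (fun z => ?_) _)
  rw [sq, ← mul_assoc]
  exact mul_le_of_le_one_left (regWeight_pos hη _).le (maxwellian_mul_regWeight_le hη _)

lemma microEnergy_nonneg (hη : 0 < η) (F : PhaseL2) : 0 ≤ microEnergy η F := by
  have hw := (bdd_regWeight hη).comp_snd
  have hm := bdd_rootM
  have h1 : densityOp η F = moment (toL2 volume rootM) (mulV rootM (mulV (regWeight η) F)) := by
    rw [moment_mulV hm, mulL_toL2 hm memLp_rootM]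
    simp only [rootM_mul_self]; rfl
  have h2 := norm_moment_le (toL2 volume rootM) (mulV rootM (mulV (regWeight η) F))
  rw [norm_rootM, one_mul, ← h1] at h2
  have h3 := pow_le_pow_left₀ (norm_nonneg _) h2 2
  rw [← real_inner_self_eq_norm_sq (mulV rootM _), ← inner_mulL_comm,
    mulL_mul hm.comp_snd hm.comp_snd,
    ← inner_mulL_comm, mulL_mul (hm.comp_snd.mul hm.comp_snd) hw,
    mulL_mul hw ((hm.comp_snd.mul hm.comp_snd).mul hw)] at h3
  rw [microEnergy, sub_nonneg]
  refine h3.trans_eq ?_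
  congr 3 with z
  rw [rootM_mul_self]; ring

lemma continuous_energy (η : ℝ) : Continuous (energy η) := by unfold energy; fun_prop

lemma continuous_microEnergy (η : ℝ) : Continuous (microEnergy η) := by unfold microEnergy; fun_prop

lemma continuous_defect (η : ℝ) : Continuous (defect η) := by unfold defect; fun_prop

lemma energy_nonneg (hη : 0 < η) (F : PhaseL2) : 0 ≤ energy η F :=
  inner_mulL_nonneg (bdd_regWeight hη).comp_snd (fun _ => (regWeight_pos hη _).le) F

/-- Right derivative of the weighted energy of a solution. -/
lemma Sol.hasDerivWithinAt_energy {ε : ℝ} (hε : 0 < ε) {F Fx Fv G : ℝ → PhaseL2}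
    (h : Sol ε F Fx Fv G) (hη : 0 < η) {s : ℝ} (hs : 0 ≤ s) :
    HasDerivWithinAt (fun t => energy η (F t))
      (-(2 / ε) * inner ℝ (G s) (mulV (regWeight η) (current η (F s) (Fv s)))
        - 2 / ε ^ 2 * energy η (current η (F s) (Fv s)) + 3 / ε ^ 2 * defect η (F s))
      (Ioi s) s := by
  set k : ℝ → ℝ := fun v => (1 + v ^ 2) * regWeight η v
  have hk : Bdd k := bdd_one_add_sq_mul_regWeight hη
  have hk' : Bdd (deriv k) := bdd_deriv_one_add_sq_mul_regWeight hη
  have hw := (bdd_regWeight hη).comp_snd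
  have ho := bdd_omega.comp_snd
  have ho' := bdd_deriv_omega.comp_snd
  have hvo := bdd_id_mul_omega.comp_snd
  have hvo' := bdd_id_mul_deriv_omega.comp_snd
  have hok : ∀ v, omega v * k v = regWeight η v := fun v => by
    simp only [k, omega]; rw [inv_mul_cancel_left₀ (one_add_sq_pos v).ne']
  have hok' : ∀ v, deriv omega v * k v + omega v * deriv k v = regWeightDeriv η v := fun v => by
    rw [← deriv_regWeight hη, ← deriv_fun_mul (hasDerivAt_omega v).differentiableAt
      ((contDiff_one_add_sq_mul_regWeight hη).differentiable (by simp) v)]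
    congr 1; funext v; rw [hok]
  have hgen : ∀ t, Gen transV (mulV k (F t)) (mulV (deriv k) (F t) + mulV k (Fv t)) := fun t =>
    (h.genV t).mul_velocity (contDiff_one_add_sq_mul_regWeight hη) hk hk'
  have hc := h.cont
  have hcv := h.contV
  refine (h.hasDerivWithinAt hε hgen hgen (by fun_prop) (by fun_prop) (fun s t => ?_)
    hs).congr_deriv ?_
  · rw [← map_add, mulL_mul ho hk.comp_snd]
    have c1 : inner ℝ (F t) (mulV (regWeight η) (F s))
        = inner ℝ (F s) (mulV (regWeight η) (F t)) := by
      rw [← inner_mulL_comm, real_inner_comm]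
    simp only [hok, energy, map_add, inner_add_right, inner_sub_left]
    rw [c1, inner_mulL_comm _ (F t), inner_mulL_comm _ (F s)]
    ring
  · have a1 : mulV (deriv omega) (mulV k (F s))
        + mulV omega (mulV (deriv k) (F s) + mulV k (Fv s))
        = mulV (regWeight η) (current η (F s) (Fv s)) := by
      rw [mulV_current hη, map_add, mulL_mul ho' hk.comp_snd, mulL_mul ho hk'.comp_snd,
        mulL_mul ho hk.comp_snd, ← add_assoc, ← mulL_add (ho'.mul hk.comp_snd)
        (ho.mul hk'.comp_snd)]
      simp only [hok, hok']
    have a2 : mulV (fun v => v * deriv omega v) (mulV k (F s))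
        + mulV (fun v => v * omega v) (mulV (deriv k) (F s) + mulV k (Fv s))
        = mulV (fun v => v * regWeightDeriv η v) (F s)
          + mulV (fun v => v * regWeight η v) (Fv s) := by
      rw [map_add, mulL_mul hvo' hk.comp_snd, mulL_mul hvo hk'.comp_snd,
        mulL_mul hvo hk.comp_snd, ← add_assoc, ← mulL_add (hvo'.mul hk.comp_snd)
        (hvo.mul hk'.comp_snd)]
      simp only [← hok, ← hok', mul_add, mul_assoc]
    -- transport in `x` does not contribute
    have a3 : inner ℝ (mulV (fun v => v * omega v) (Fx s)) (mulV k (F s)) = 0 := by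
      have hvw := bdd_id_mul_regWeight hη
      have h1 := Gen.inner_map_skew isGroup_rotX (h.genX s) (h.genX s)
        (mulV fun v => v * regWeight η v) fun r f => mulV_rotX hvw r f
      rw [inner_mulL_comm _ (F s), real_inner_comm] at h1
      rw [← inner_mulL_comm, mulL_mul hk.comp_snd hvo]
      have e : (fun z : ℝ × ℝ => k z.2 * (z.2 * omega z.2)) = fun z => z.2 * regWeight η z.2 := by
        funext z; rw [← hok]; ring
      rw [e, real_inner_comm]
      exact self_eq_neg.1 (eq_neg_of_add_eq_zero_left h1)
    have a4 := inner_current hη (h.genV s)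
    rw [← a1, ← a2] at a4
    rw [← a1]
    simp only [source, flux, ← two_smul ℝ, inner_smul_right, inner_add_left, real_inner_smul_left,
      map_add, map_smul, a3, inner_add_right, inner_mulL_comm _ (G s), inner_mulL_comm _ (Fv s),
      inner_mulL_comm _ (F s)] at a4 ⊢
    field_simp
    linarith

/-- The quadratic form that controls the growth of `e^{rt}` times the weighted energy. -/
def growth (ε η r : ℝ) (F : PhaseL2) : ℝ :=
  r * energy η F - (ε ^ 2)⁻¹ * microEnergy η F + 3 * (ε ^ 2)⁻¹ * defect η F

lemma continuous_growth (ε η r : ℝ) : Continuous (growth ε η r) := by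
  have := continuous_energy η; have := continuous_microEnergy η; have := continuous_defect η
  unfold growth; fun_prop

/-- The weighted energy inequality. -/
lemma Sol.energy_le {ε : ℝ} (hε : 0 < ε) {F Fx Fv G : ℝ → PhaseL2} (h : Sol ε F Fx Fv G)
    (hη : 0 < η) (r : ℝ) {t : ℝ} (ht : 0 ≤ t) :
    Real.exp (r * t) * energy η (F t) ≤ energy η (F 0)
      + ∫ s in (0 : ℝ)..t, Real.exp (r * s) * (growth ε η r (F s) + energy η (G s)) := by
  have c0 := h.cont; have c1 := h.contV; have c2 := h.contG
  have c3 := continuous_energy η; have c4 := continuous_growth ε η r; have c5 := continuous_defect η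
  have c6 : Continuous fun s => current η (F s) (Fv s) := by unfold current; fun_prop
  rw [exp_mul_eq_add_integral (Θ := fun t => energy η (F t)) (by fun_prop)
    (by fun_prop) (fun s hs => h.hasDerivWithinAt_energy hε hη hs) r ht]
  gcongr
  refine intervalIntegral.integral_mono_on ht (by apply Continuous.intervalIntegrable; fun_prop)
    (by apply Continuous.intervalIntegrable; fun_prop) fun s _ => ?_
  refine mul_le_mul_of_nonneg_left ?_ (Real.exp_pos _).le
  have h1 := microEnergy_le hη (h.genV s)
  set W := current η (F s) (Fv s)
  -- Young's inequality in the form `0 ≤ ∫ w (G + W / ε)²`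
  have h2 := energy_nonneg hη (G s + ε⁻¹ • W)
  have h3 : energy η (G s + ε⁻¹ • W) = energy η (G s)
      + 2 / ε * inner ℝ (G s) (mulV (regWeight η) W) + (ε ^ 2)⁻¹ * energy η W := by
    simp only [energy, map_add, map_smul, inner_add_left, inner_add_right, real_inner_smul_left,
      inner_smul_right]
    rw [inner_mulL_comm _ (G s) W, inner_mulL_comm _ W (G s), ← inner_mulL_comm _ W (G s),
      real_inner_comm (G s) (mulL _ W)]
    field_simp
    ring
  have h4 : (ε ^ 2)⁻¹ * microEnergy η (F s) ≤ (ε ^ 2)⁻¹ * energy η W := by gcongr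
  rw [growth]
  have e1 : 2 / ε ^ 2 * energy η W = 2 * ((ε ^ 2)⁻¹ * energy η W) := by ring
  have e2 : 3 / ε ^ 2 * defect η (F s) = 3 * (ε ^ 2)⁻¹ * defect η (F s) := by ring
  linarith

/-! ### Energy inequalities for a solution and its spatial derivative -/

/-- A bounded field `e(t, x)`, Lipschitz on the circle, with values and Lipschitz constant at most
`c`. -/
structure IsField (e : ℝ → ℝ → ℝ) (c : ℝ) : Prop where
  measurable : ∀ t, Measurable (e t)
  bound : ∀ t x, |e t x| ≤ c
  lipschitz : ∀ t, ∀ δ ∈ Icc (0 : ℝ) 1, ∀ x ∈ Ioo (0 : ℝ) 1,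
    |e t (Int.fract (x + δ)) - e t x| ≤ c * δ
  cont : ∀ x, Continuous fun t => e t x

/-- The product `e(t, x) F(t)`. -/
def force (e : ℝ → ℝ → ℝ) (F : ℝ → PhaseL2) (t : ℝ) : PhaseL2 :=
  mulL (fun z : ℝ × ℝ => e t z.1) (F t)

section

variable {e : ℝ → ℝ → ℝ} {c : ℝ}

lemma IsField.nonneg (he : IsField e c) : 0 ≤ c := (abs_nonneg _).trans (he.bound 0 0)

lemma IsField.bdd (he : IsField e c) (t : ℝ) : Bdd fun z : ℝ × ℝ => e t z.1 :=
  ⟨(he.measurable t).comp measurable_fst, c, fun z => he.bound t z.1⟩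

lemma IsField.continuous_force (he : IsField e c) {F : ℝ → PhaseL2} (hF : Continuous F) :
    Continuous (force e F) := by
  refine continuous_iff_continuousAt.2 fun s => ?_
  have h1 : Tendsto (fun t => mulL (fun z : ℝ × ℝ => e t z.1) (F s)) (𝓝 s) (𝓝 (force e F s)) :=
    tendsto_mulL (fun t => he.bdd t) (he.bdd s) (fun t z => he.bound t z.1)
      (fun z => (he.cont z.1).tendsto s) (F s)
  have h2 : Tendsto (fun t => mulL (fun z : ℝ × ℝ => e t z.1) (F t - F s)) (𝓝 s) (𝓝 0) := by
    refine squeeze_zero_norm (fun t => norm_mulL_le (he.bdd t) (fun z => he.bound t z.1) _) ?_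
    have h3 : Tendsto (fun t => c * ‖F t - F s‖) (𝓝 s) (𝓝 (c * ‖F s - F s‖)) :=
      ((hF.sub continuous_const).norm.const_mul c).tendsto s
    simpa using h3
  have h4 := h2.add h1
  rw [zero_add] at h4
  refine h4.congr fun t => ?_
  rw [map_sub, sub_add_cancel]; rfl

variable {η : ℝ}

lemma IsField.energy_force_le (he : IsField e c) (hη : 0 < η) (F : ℝ → PhaseL2) (t : ℝ) :
    energy η (force e F t) ≤ c ^ 2 * energy η (F t) := by
  have hw := (bdd_regWeight hη).comp_snd
  have hb := he.bdd t
  have h1 : energy η (force e F t)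
      = inner ℝ (mulL (fun z : ℝ × ℝ => e t z.1 * (regWeight η z.2 * e t z.1)) (F t)) (F t) := by
    rw [energy, force, ← inner_mulL_comm, mulL_mul hw hb, mulL_mul hb (hw.mul hb)]
  rw [h1, energy, ← real_inner_smul_left, ← mulL_const_mul hw]
  refine inner_mulL_mono (hb.mul (hw.mul hb)) (hw.const_mul _) (fun z => ?_) _
  have h2 : e t z.1 ^ 2 ≤ c ^ 2 := sq_le_sq.2 ((he.bound t z.1).trans (le_abs_self c))
  calc _ = e t z.1 ^ 2 * regWeight η z.2 := by ring
    _ ≤ _ := mul_le_mul_of_nonneg_right h2 (regWeight_pos hη _).le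

/-- Increments in `x` of the force, by the product rule for difference quotients. -/
lemma IsField.energy_rotX_force_le (he : IsField e c) (hη : 0 < η) (F : ℝ → PhaseL2) (t : ℝ)
    {δ : ℝ} (hδ : δ ∈ Icc (0 : ℝ) 1) :
    energy η (rotX δ (force e F t) - force e F t)
      ≤ 2 * c ^ 2 * (energy η (rotX δ (F t) - F t) + δ ^ 2 * energy η (F t)) := by
  have hw := (bdd_regWeight hη).comp_snd
  set D := rotX δ (F t) - F t
  have key : ∀ᵐ z ∂phaseMeasure, (rotX δ (force e F t) - force e F t : PhaseL2) z ^ 2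
      ≤ 2 * c ^ 2 * (D z ^ 2 + δ ^ 2 * F t z ^ 2) := by
    have q := (measurePreserving_rotX δ).quasiMeasurePreserving
    filter_upwards [Lp.coeFn_sub (rotX δ (force e F t)) (force e F t), rotX_coe δ (force e F t),
      Lp.coeFn_sub (rotX δ (F t)) (F t), rotX_coe δ (F t), mulL_coe (he.bdd t) (F t),
      q.ae_eq_comp (mulL_coe (he.bdd t) (F t)), ae_mem_phaseSpace] with z h1 h2 h3 h4 h5 h6 h7
    simp only [Function.comp_apply] at h6
    have hz : |e t (Int.fract (z.1 + δ)) - e t z.1| ≤ c * δ := he.lipschitz t δ hδ z.1 h7.1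
    have h8 : (rotX δ (force e F t) - force e F t : PhaseL2) z
        = e t (Int.fract (z.1 + δ)) * D z + (e t (Int.fract (z.1 + δ)) - e t z.1) * F t z := by
      rw [h1, Pi.sub_apply, h2, h3, Pi.sub_apply, h4]
      simp only [force]
      rw [h5, h6]; ring
    have a1 := sq_le_sq.2 ((he.bound t (Int.fract (z.1 + δ))).trans (le_abs_self c))
    have a2 := sq_le_sq.2 (hz.trans (le_abs_self _))
    rw [h8]
    calc _ ≤ 2 * (e t (Int.fract (z.1 + δ)) ^ 2 * D z ^ 2
          + (e t (Int.fract (z.1 + δ)) - e t z.1) ^ 2 * F t z ^ 2) := by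
          nlinarith [sq_nonneg (e t (Int.fract (z.1 + δ)) * D z
            - (e t (Int.fract (z.1 + δ)) - e t z.1) * F t z)]
      _ ≤ 2 * (c ^ 2 * D z ^ 2 + (c * δ) ^ 2 * F t z ^ 2) := by gcongr
      _ = _ := by ring
  simp only [energy]
  rw [inner_mulL hw, inner_mulL hw, inner_mulL hw, ← integral_const_mul, ← integral_add
    (integrable_mulL hw _ _) ((integrable_mulL hw _ _).const_mul _), ← integral_const_mul]
  refine integral_mono_ae (integrable_mulL hw _ _) (((integrable_mulL hw _ _).add
    ((integrable_mulL hw _ _).const_mul _)).const_mul _) ?_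
  filter_upwards [key] with z hz
  have := mul_le_mul_of_nonneg_left hz (regWeight_pos hη z.2).le
  calc _ = regWeight η z.2 * (rotX δ (force e F t) - force e F t : PhaseL2) z ^ 2 := by ring
    _ ≤ _ := this
    _ = _ := by ring

end

lemma energy_smul (η a : ℝ) (F : PhaseL2) : energy η (a • F) = a ^ 2 * energy η F := by
  simp only [energy, map_smul, real_inner_smul_left, real_inner_smul_right]; ring

lemma growth_smul (ε η r a : ℝ) (F : PhaseL2) : growth ε η r (a • F) = a ^ 2 * growth ε η r F := by
  simp only [growth, energy_smul, microEnergy, defect, map_smul, real_inner_smul_left,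
    real_inner_smul_right, norm_smul, mul_pow, Real.norm_eq_abs, sq_abs]
  ring

lemma growth_add (ε η r r' : ℝ) (F : PhaseL2) :
    growth ε η (r + r') F = growth ε η r F + r' * energy η F := by
  simp only [growth]; ring

/-- A continuous quadratic form is bounded. -/
lemma exists_abs_le_of_quadratic {X : Type*} [NormedAddCommGroup X] [NormedSpace ℝ X] {Φ : X → ℝ}
    (hc : Continuous Φ) (hh : ∀ (a : ℝ) F, Φ (a • F) = a ^ 2 * Φ F) :
    ∃ C, 0 ≤ C ∧ ∀ F, |Φ F| ≤ C * ‖F‖ ^ 2 := by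
  have h0 : Φ 0 = 0 := by simpa using hh 0 0
  obtain ⟨ρ, hρ, h⟩ := Metric.continuousAt_iff.1 hc.continuousAt 1 one_pos
  refine ⟨(2 / ρ) ^ 2, by positivity, fun F => ?_⟩
  rcases eq_or_ne F 0 with rfl | hF
  · simp [h0]
  have hF' : 0 < ‖F‖ := norm_pos_iff.2 hF
  have h1 := @h ((ρ / 2 / ‖F‖) • F) (by
    rw [dist_zero_right, norm_smul, Real.norm_of_nonneg (by positivity),
      div_mul_cancel₀ _ hF'.ne']
    linarith)
  rw [h0, dist_zero_right, hh, Real.norm_eq_abs, abs_mul, abs_of_nonneg (by positivity)] at h1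
  calc |Φ F| = (2 / ρ) ^ 2 * ‖F‖ ^ 2 * ((ρ / 2 / ‖F‖) ^ 2 * |Φ F|) := by field_simp
    _ ≤ (2 / ρ) ^ 2 * ‖F‖ ^ 2 * 1 := by gcongr
    _ = _ := by ring

section

variable {ε : ℝ} {F Fx Fv : ℝ → PhaseL2} {e : ℝ → ℝ → ℝ} {c η : ℝ}

/-- The energy inequality for a solution in a force field. -/
lemma Sol.energy_le_of_field (hε : 0 < ε) (h : Sol ε F Fx Fv (force e F)) (he : IsField e c)
    (hη : 0 < η) (r : ℝ) {t : ℝ} (ht : 0 ≤ t) :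
    Real.exp (r * t) * energy η (F t) ≤ energy η (F 0)
      + ∫ s in (0 : ℝ)..t, Real.exp (r * s) * growth ε η (r + c ^ 2) (F s) := by
  have c0 := h.cont; have c2 := h.contG
  have c3 := continuous_energy η; have c4 := continuous_growth ε η r
  have c5 := continuous_growth ε η (r + c ^ 2)
  refine (h.energy_le hε hη r ht).trans ?_
  gcongr
  refine intervalIntegral.integral_mono_on ht (by apply Continuous.intervalIntegrable; fun_prop)
    (by apply Continuous.intervalIntegrable; fun_prop) fun s _ => ?_
  rw [growth_add]
  exact mul_le_mul_of_nonneg_left (add_le_add_right (he.energy_force_le hη F s) _)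
    (Real.exp_pos _).le

/-- The energy inequality for the spatial derivative, as the limit of the inequalities for the
difference quotients. -/
lemma Sol.energy_deriv_le_of_field (hε : 0 < ε) (h : Sol ε F Fx Fv (force e F))
    (he : IsField e c) (hη : 0 < η) (r : ℝ) {t : ℝ} (ht : 0 ≤ t) :
    Real.exp (r * t) * energy η (Fx t) ≤ energy η (Fx 0)
      + ∫ s in (0 : ℝ)..t, Real.exp (r * s) * (growth ε η (r + 2 * c ^ 2) (Fx s)
        + 2 * c ^ 2 * energy η (F s)) := by
  have c0 := h.cont; have c1 := h.contX; have c2 := h.contG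
  have c3 := continuous_energy η; have c4 := continuous_growth ε η r
  have c5 := continuous_growth ε η (r + 2 * c ^ 2)
  set u : ℕ → ℝ := fun n => 1 / ((n : ℝ) + 1)
  have hu0 : ∀ n, 0 < u n := fun n => by positivity
  have hu1 : ∀ n, u n ∈ Icc (0 : ℝ) 1 := fun n =>
    ⟨(hu0 n).le, by rw [div_le_one (by positivity)]; linarith [n.cast_nonneg (α := ℝ)]⟩
  have hu : Tendsto u atTop (𝓝[>] 0) := tendsto_nhdsWithin_iff.2
    ⟨tendsto_one_div_add_atTop_nhds_zero_nat, Eventually.of_forall hu0⟩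
  set Q : ℕ → ℝ → PhaseL2 := fun n s => (u n)⁻¹ • (rotX (u n) (F s) - F s)
  have hQ : ∀ s, Tendsto (fun n => Q n s) atTop (𝓝 (Fx s)) := fun s =>
    (h.genX s).tendsto_div isGroup_rotX hu
  have hQc : ∀ n, Continuous (Q n) := fun n =>
    (((rotX (u n)).continuous.comp c0).sub c0 :
      Continuous fun s => rotX (u n) (F s) - F s).const_smul (u n)⁻¹
  have hQn : ∀ n s, ‖Q n s‖ ≤ ‖Fx s‖ := fun n s => by
    rw [norm_smul, Real.norm_of_nonneg (inv_nonneg.2 (hu0 n).le), inv_mul_le_iff₀ (hu0 n)]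
    exact (h.genX s).norm_sub_le (hu1 n)
  -- the inequality for the difference quotients
  have key : ∀ n, Real.exp (r * t) * energy η (Q n t) ≤ energy η (Q n 0)
      + ∫ s in (0 : ℝ)..t, Real.exp (r * s) * (growth ε η (r + 2 * c ^ 2) (Q n s)
        + 2 * c ^ 2 * energy η (F s)) := by
    intro n
    have h1 := (h.rotX_sub (u n)).energy_le hε hη r ht
    have hsq : (u n)⁻¹ ^ 2 * u n ^ 2 = 1 := by rw [← mul_pow, inv_mul_cancel₀ (hu0 n).ne', one_pow]
    have h2 := mul_le_mul_of_nonneg_left h1 (sq_nonneg (u n)⁻¹)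
    rw [mul_add, ← intervalIntegral.integral_const_mul] at h2
    have c6 : Continuous fun s => rotX (u n) (F s) - F s :=
      ((rotX (u n)).continuous.comp c0).sub c0
    have c7 : Continuous fun s => rotX (u n) (force e F s) - force e F s :=
      ((rotX (u n)).continuous.comp c2).sub c2
    have c8 := hQc n
    have e1 : Real.exp (r * t) * energy η (Q n t)
        = (u n)⁻¹ ^ 2 * (Real.exp (r * t) * energy η (rotX (u n) (F t) - F t)) := by
      rw [energy_smul]; ring
    rw [e1, energy_smul]
    refine h2.trans ?_
    gcongr
    refine intervalIntegral.integral_mono_on ht (by apply Continuous.intervalIntegrable; fun_prop)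
      (by apply Continuous.intervalIntegrable; fun_prop) fun s _ => ?_
    have h3 := he.energy_rotX_force_le hη F s (hu1 n)
    rw [growth_add, growth_smul, energy_smul, mul_left_comm]
    refine mul_le_mul_of_nonneg_left ?_ (Real.exp_pos _).le
    calc _ ≤ (u n)⁻¹ ^ 2 * (growth ε η r (rotX (u n) (F s) - F s)
          + 2 * c ^ 2 * (energy η (rotX (u n) (F s) - F s) + u n ^ 2 * energy η (F s))) := by gcongr
      _ = (u n)⁻¹ ^ 2 * growth ε η r (rotX (u n) (F s) - F s)
          + 2 * c ^ 2 * ((u n)⁻¹ ^ 2 * energy η (rotX (u n) (F s) - F s))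
          + 2 * c ^ 2 * ((u n)⁻¹ ^ 2 * u n ^ 2) * energy η (F s) := by ring
      _ = _ := by rw [hsq]; ring
  obtain ⟨C, hC0, hC⟩ := exists_abs_le_of_quadratic c5 (growth_smul ε η (r + 2 * c ^ 2))
  refine le_of_tendsto_of_tendsto' (((c3.tendsto _).comp (hQ t)).const_mul _)
    (((c3.tendsto _).comp (hQ 0)).add ?_) key
  refine intervalIntegral.tendsto_integral_filter_of_dominated_convergence
    (fun s => Real.exp (r * s) * (C * ‖Fx s‖ ^ 2 + |2 * c ^ 2 * energy η (F s)|))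
    (Eventually.of_forall fun n => ?_) (Eventually.of_forall fun n => Eventually.of_forall
      fun s _ => ?_) (by apply Continuous.intervalIntegrable; fun_prop)
    (Eventually.of_forall fun s _ => ?_)
  · have := hQc n
    exact (by fun_prop : Continuous fun s => Real.exp (r * s) * (growth ε η (r + 2 * c ^ 2) (Q n s)
        + 2 * c ^ 2 * energy η (F s))).aestronglyMeasurable
  · rw [Real.norm_eq_abs, abs_mul, abs_of_pos (Real.exp_pos _)]
    refine mul_le_mul_of_nonneg_left ((abs_add_le _ _).trans ?_) (Real.exp_pos _).le
    gcongr
    refine (hC _).trans ?_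
    gcongr
    exact hQn n s
  · exact (((c5.tendsto _).comp (hQ s)).add_const _).const_mul _

end

/-! ### From weak solutions to the evolution equation -/

/-- The electric field, extended by zero in `x` and constantly to negative times. -/
def fieldExt (E : ℝ → ℝ → ℝ) (t : ℝ) : ℝ → ℝ := (Icc (0 : ℝ) 1).indicator (E (max t 0))

/-- Only the bounds on `E` and `∂ₓE` and the values at both ends enter: on the circle `E` is
bounded and Lipschitz with the constant `C_E / 2`. -/
lemma isField_fieldExt {E : ℝ → ℝ → ℝ} {C_E lam C_s : ℝ} (hE : FieldAssumption E C_E lam C_s) :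
    IsField (fieldExt E) (C_E / 2) := by
  have hcont : ∀ t, ContinuousOn (E (max t 0)) (Icc 0 1) := fun t =>
    (hE.contDiffOn _ (le_max_right t 0)).continuousOn
  have hin : ∀ t, ∀ x ∈ Icc (0 : ℝ) 1, fieldExt E t x = E (max t 0) x := fun t x hx =>
    indicator_of_mem hx _
  have hlip : ∀ t, ∀ x ∈ Icc (0 : ℝ) 1, ∀ y ∈ Icc (0 : ℝ) 1,
      |E (max t 0) y - E (max t 0) x| ≤ C_E / 2 * |y - x| := fun t x hx y hy => by
    refine (convex_Icc (0 : ℝ) 1).norm_image_sub_le_of_norm_derivWithin_le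
      ((hE.contDiffOn _ (le_max_right t 0)).differentiableOn (by norm_num)) (fun z hz => ?_) hx hy
    have := hE.bound_one _ (le_max_right t 0) z hz
    rwa [iteratedDerivWithin_one] at this
  have h0 : 0 ≤ C_E / 2 := (abs_nonneg _).trans (hE.bound_zero 0 le_rfl 0 (by simp))
  refine ⟨fun t => ?_, fun t x => ?_, fun t δ hδ x hx => ?_, fun x => ?_⟩
  · rw [fieldExt, ← piecewise_eq_indicator]
    exact (hcont t).measurable_piecewise continuousOn_const measurableSet_Icc
  · by_cases hx : x ∈ Icc (0 : ℝ) 1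
    · rw [hin t x hx]
      exact hE.bound_zero _ (le_max_right t 0) x hx
    · rw [fieldExt, indicator_of_notMem hx, abs_zero]
      exact h0
  · have hx' := Ioo_subset_Icc_self hx
    have hf : Int.fract (x + δ) ∈ Icc (0 : ℝ) 1 := ⟨Int.fract_nonneg _, (Int.fract_lt_one _).le⟩
    rw [hin t _ hf, hin t x hx']
    rcases lt_or_ge (x + δ) 1 with h | h
    · rw [Int.fract_eq_self.2 ⟨by linarith [hx.1, hδ.1], h⟩]
      refine (hlip t x hx' (x + δ) ⟨by linarith [hx.1, hδ.1], h.le⟩).trans_eq ?_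
      rw [add_sub_cancel_left, abs_of_nonneg hδ.1]
    -- the field vanishes at both ends, so the increment across the end point splits
    · have e : Int.fract (x + δ) = x + δ - 1 := by
        rw [Int.fract_eq_iff]
        exact ⟨by linarith, by linarith [hx.2, hδ.2], 1, by push_cast; ring⟩
      rw [e] at hf ⊢
      have h1 := hlip t 0 (by simp) _ hf
      have h2 := hlip t x hx' 1 (by simp)
      rw [hE.left_zero _ (le_max_right t 0), sub_zero, sub_zero, abs_of_nonneg hf.1] at h1
      rw [hE.right_zero _ (le_max_right t 0), abs_of_nonneg (by linarith [hx.2] : 0 ≤ 1 - x),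
        zero_sub] at h2
      calc _ ≤ |E (max t 0) (x + δ - 1)| + |-E (max t 0) x| := by
            rw [sub_eq_add_neg]; exact abs_add_le _ _
        _ ≤ _ := by linarith
  · by_cases hx : x ∈ Icc (0 : ℝ) 1
    · have h1 : Continuous fun t : ℝ => (max t 0, x) := by fun_prop
      refine (hE.continuousOn.comp_continuous h1 fun t => ⟨le_max_right t 0, hx⟩).congr
        fun t => (hin t x hx).symm
    · refine continuous_const (y := (0 : ℝ)) |>.congr fun t => ?_
      rw [fieldExt, indicator_of_notMem hx]

/-- A continuous function on `(0, ∞)` whose distributional derivative vanishes is constant: it is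
tested with `ζ - ζ(· - p)`, which is the derivative of a test function. -/
lemma eq_of_integral_deriv_mul_eq_zero {H : ℝ → ℝ} (hH : Continuous H)
    (h : ∀ χ : ℝ → ℝ, ContDiff ℝ ∞ χ → HasCompactSupport χ → tsupport χ ⊆ Ioi 0 →
      ∫ t, deriv χ t * H t = 0) {s t : ℝ} (hs : 0 ≤ s) (hst : s ≤ t) : H t = H s := by
  set p := t - s
  have hp : 0 ≤ p := sub_nonneg.2 hst
  have key : ∀ᵐ x : ℝ, x ∈ Ioi (0 : ℝ) → H x - H (x + p) = 0 := by
    refine isOpen_Ioi.ae_eq_zero_of_integral_contDiff_smul_eq_zero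
      ((hH.sub (hH.comp (continuous_add_const p))).locallyIntegrable.locallyIntegrableOn _)
      fun ζ h1 h2 h3 => ?_
    rcases (tsupport ζ).eq_empty_or_nonempty with h0 | h0
    · rw [tsupport_eq_empty_iff.1 h0]; simp
    have hK : IsCompact (tsupport ζ) := h2
    obtain ⟨a, ha, ha'⟩ := hK.exists_isLeast h0
    obtain ⟨L, hL⟩ := hK.bddAbove
    have hz : ∀ x, x < a ∨ L < x → ζ x = 0 := fun x hx => image_eq_zero_of_notMem_tsupport
      fun hx' => hx.elim (fun hx => (ha' hx').not_gt hx) fun hx => (hL hx').not_gt hx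
    set Z : ℝ → ℝ := fun x => ∫ y in (0 : ℝ)..x, ζ y
    have hZd : ∀ x, HasDerivAt Z (ζ x) x := fun x =>
      (h1.continuous.integral_hasStrictDerivAt 0 x).hasDerivAt
    have hZ : ContDiff ℝ ∞ Z := contDiff_infty_iff_deriv.2
      ⟨fun x => (hZd x).differentiableAt, by rw [funext fun x => (hZd x).deriv]; exact h1⟩
    have hi : ∀ a b, IntervalIntegrable ζ volume a b := fun a b =>
      h1.continuous.intervalIntegrable _ _
    have hZa : ∀ x y, x ≤ y → y < a ∨ L < x → Z y - Z x = 0 := fun x y hxy hx => by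
      rw [intervalIntegral.integral_interval_sub_left (hi _ _) (hi _ _)]
      refine intervalIntegral.integral_zero_ae (Eventually.of_forall fun r hr => hz r ?_)
      rw [uIoc_of_le hxy] at hr
      exact hx.imp (fun hx => hr.2.trans_lt hx) fun hx => hx.trans hr.1
    set χ : ℝ → ℝ := fun x => Z x - Z (x - p)
    have hχ : ∀ x ∉ Icc a (L + p), χ x = 0 := fun x hx => by
      refine hZa _ _ (by linarith) ?_
      by_contra! hcon
      exact hx ⟨hcon.1, by linarith [hcon.2]⟩
    have hχd : ∀ x, HasDerivAt χ (ζ x - ζ (x - p)) x := fun x =>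
      (hZd x).sub ((hZd (x - p)).comp_sub_const x p)
    have hts : tsupport χ ⊆ Icc a (L + p) := closure_minimal
      (fun x hx => by_contra fun hx' => hx (hχ x hx')) isClosed_Icc
    have := h χ (hZ.sub (hZ.comp (contDiff_id.sub contDiff_const)))
      (HasCompactSupport.intro isCompact_Icc hχ) (hts.trans fun x hx => (h3 ha).trans_le hx.1)
    simp only [fun x => (hχd x).deriv, sub_mul, smul_eq_mul, mul_sub] at this ⊢
    have i1 : Integrable fun x => ζ x * H x :=
      (h1.continuous.mul hH).integrable_of_hasCompactSupport h2.mul_right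
    have i2 : Integrable fun x => ζ x * H (x + p) :=
      (h1.continuous.mul (hH.comp (continuous_add_const p))).integrable_of_hasCompactSupport
        h2.mul_right
    have e : ∀ x, ζ (x - p) * H x = (fun x => ζ x * H (x + p)) (x - p) := fun x => by simp
    have i3 : Integrable fun x => ζ (x - p) * H x := by
      simp only [e]; exact i2.comp_sub_right p
    rw [integral_sub i1 i3] at this
    rw [integral_sub i1 i2]
    simp only [e] at this
    rwa [integral_sub_right_eq_self (fun x => ζ x * H (x + p)) p] at this
  have h1 : EqOn (fun x => H x - H (x + p)) (fun _ => 0) (Ioi 0) :=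
    Measure.eqOn_open_of_ae_eq ((ae_restrict_iff' measurableSet_Ioi).2 key) isOpen_Ioi
      (hH.sub (hH.comp (continuous_add_const p))).continuousOn continuousOn_const
  have h2 := h1.closure (hH.sub (hH.comp (continuous_add_const p))) continuous_const
  rw [closure_Ioi] at h2
  have h3 := h2 hs
  simp only [p] at h3
  rw [add_sub_cancel] at h3
  linarith

/-- A weak equation `g' = b` on `(0, ∞)` in integrated form, up to and including time `0`. -/
lemma sub_eq_integral_of_weak_deriv {g b : ℝ → ℝ} (hg : Continuous g) (hb : Continuous b)
    (h : ∀ χ : ℝ → ℝ, ContDiff ℝ ∞ χ → HasCompactSupport χ → tsupport χ ⊆ Ioi 0 →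
      ∫ t, (deriv χ t * g t + χ t * b t) = 0) {s t : ℝ} (hs : 0 ≤ s) (hst : s ≤ t) :
    g t - g s = ∫ r in s..t, b r := by
  set B : ℝ → ℝ := fun x => ∫ r in (0 : ℝ)..x, b r
  have hBd : ∀ x, HasDerivAt B (b x) x := fun x =>
    (hb.integral_hasStrictDerivAt 0 x).hasDerivAt
  have hB : Continuous B := continuous_iff_continuousAt.2 fun x => (hBd x).continuousAt
  have h1 := eq_of_integral_deriv_mul_eq_zero (hg.sub hB) (fun χ h1 h2 h3 => by
    have hd : Continuous (deriv χ) := (contDiff_deriv h1).continuous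
    have i1 : Integrable fun t => deriv χ t * g t :=
      (hd.mul hg).integrable_of_hasCompactSupport h2.deriv.mul_right
    have i2 : Integrable fun t => χ t * b t :=
      (h1.continuous.mul hb).integrable_of_hasCompactSupport h2.mul_right
    have i3 : Integrable fun t => deriv χ t * B t :=
      (hd.mul hB).integrable_of_hasCompactSupport h2.deriv.mul_right
    have i4 : Integrable fun t => χ t * B t :=
      (h1.continuous.mul hB).integrable_of_hasCompactSupport h2.mul_right
    have h4 := integral_mul_deriv_eq_deriv_mul_of_integrable
      (fun x _ => (h1.differentiable (by simp) x).hasDerivAt) (fun x _ => hBd x) i2 i3 i4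
    have h5 := h χ h1 h2 h3
    rw [integral_add i1 i2, h4] at h5
    simp only [Pi.sub_apply, mul_sub]
    rw [integral_sub i1 i3]
    linarith) hs hst
  simp only [Pi.sub_apply] at h1
  have h2 : B t - B s = ∫ r in s..t, b r :=
    intervalIntegral.integral_interval_sub_left (hb.intervalIntegrable _ _)
      (hb.intervalIntegrable _ _)
  linarith

lemma hasDerivAt_slice_fst {φ : ℝ × ℝ → ℝ} (hφ : ContDiff ℝ ∞ φ) (x v : ℝ) :
    HasDerivAt (fun y => φ (y, v)) (fderiv ℝ φ (x, v) (1, 0)) x := by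
  have h1 : HasDerivAt (fun y : ℝ => (y, v)) ((1 : ℝ), (0 : ℝ)) x :=
    (hasDerivAt_id x).prodMk (hasDerivAt_const x v)
  exact (hφ.differentiable (by simp) (x, v)).hasFDerivAt.comp_hasDerivAt x h1

lemma hasDerivAt_slice_snd {φ : ℝ × ℝ → ℝ} (hφ : ContDiff ℝ ∞ φ) (x v : ℝ) :
    HasDerivAt (fun w => φ (x, w)) (fderiv ℝ φ (x, v) (0, 1)) v := by
  have h1 : HasDerivAt (fun w : ℝ => (x, w)) ((0 : ℝ), (1 : ℝ)) v :=
    (hasDerivAt_const v x).prodMk (hasDerivAt_id v)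
  exact (hφ.differentiable (by simp) (x, v)).hasFDerivAt.comp_hasDerivAt v h1

lemma fokkerPlanckAdjoint_slice {φ : ℝ × ℝ → ℝ} (hφ : IsTest φ) (a : ℝ) (z : ℝ × ℝ) :
    fokkerPlanckAdjoint (fun w => a * φ (z.1, w)) z.2
      = a * (fderiv ℝ (fun z => fderiv ℝ φ z (0, 1)) z (0, 1) - z.2 * fderiv ℝ φ z (0, 1)) := by
  have h1 : deriv (fun w => a * φ (z.1, w)) = fun w => a * fderiv ℝ φ (z.1, w) (0, 1) :=
    funext fun w => ((hasDerivAt_slice_snd hφ.smooth z.1 w).const_mul a).deriv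
  have h2 := (hasDerivAt_maxwellian z.2).mul
    ((hasDerivAt_slice_snd (hφ.fderiv_apply (0, 1)).smooth z.1 z.2).const_mul a)
  rw [fokkerPlanckAdjoint, h1]
  have h3 : deriv (fun w => maxwellian w * (a * fderiv ℝ φ (z.1, w) (0, 1))) z.2 = _ := h2.deriv
  rw [h3]
  have := (maxwellian_pos z.2).ne'
  field_simp
  ring

lemma inner_mulV_test {b : ℝ → ℝ} (hb : Bdd b) {φ : ℝ × ℝ → ℝ} (hφ : IsTest φ) (f : PhaseL2) :
    inner ℝ (mulV b f) (toL2 phaseMeasure φ) = ∫ z, f z * (b z.2 * φ z) ∂phaseMeasure := by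
  rw [inner_test hφ]
  refine integral_congr_ae ?_
  filter_upwards [mulL_coe hb.comp_snd f] with z hz
  rw [hz]; ring

lemma integrable_test_Lp (f : PhaseL2) {φ : ℝ × ℝ → ℝ} (hφ : IsTest φ) :
    Integrable (fun z => f z * φ z) phaseMeasure :=
  LocallyIntegrableOn.integrable_test (locallyIntegrableOn_of_memLp (Lp.memLp f)) hφ

/-- The equation tested with a function of `(x, v)`: the right-hand side. -/
def weakForce (ε : ℝ) (F G : PhaseL2) (ψ : ℝ × ℝ → ℝ) : ℝ :=
  (∫ z, F z * (z.2 * fderiv ℝ ψ z (1, 0)) ∂phaseMeasure)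
    - (∫ z, G z * fderiv ℝ ψ z (0, 1) ∂phaseMeasure)
    + ε⁻¹ * ((∫ z, F z * fderiv ℝ (fun z => fderiv ℝ ψ z (0, 1)) z (0, 1) ∂phaseMeasure)
      - ∫ z, F z * (z.2 * fderiv ℝ ψ z (0, 1)) ∂phaseMeasure)

/-- Integrations by parts turn the right-hand side into bounded operators applied to the
derivatives of `F`. -/
lemma weakForce_eq {ε : ℝ} {F Fx Fv G : PhaseL2} (hx : HasWeakPartial F (1, 0) Fx)
    (hv : HasWeakPartial F (0, 1) Fv) {φ : ℝ × ℝ → ℝ} (hφ : IsTest φ) :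
    weakForce ε F G (fun z => omega z.2 * φ z)
      = -(inner ℝ (source ε F Fx Fv G) (toL2 phaseMeasure φ)
        + inner ℝ (flux ε F Fv G) (toL2 phaseMeasure fun z => fderiv ℝ φ z (0, 1))) := by
  set ψ : ℝ × ℝ → ℝ := fun z => omega z.2 * φ z
  have hψ : IsTest ψ := hφ.mul_snd contDiff_omega
  have hφv := hφ.fderiv_apply (0, 1)
  have hψv := hψ.fderiv_apply (0, 1)
  have hid : ContDiff ℝ ∞ (fun v : ℝ => v) := contDiff_id
  have hdo := contDiff_deriv contDiff_omega
  -- the derivative of the test function in `v`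
  have d2 : ∀ z, fderiv ℝ ψ z (0, 1) = omega z.2 * fderiv ℝ φ z (0, 1) + deriv omega z.2 * φ z :=
    fun z => by rw [deriv_comp_snd contDiff_omega hφ]; simp
  have e0 : ∀ g : PhaseL2, ∫ z, g z * fderiv ℝ ψ z (0, 1) ∂phaseMeasure
      = inner ℝ (mulV omega g) (toL2 phaseMeasure fun z => fderiv ℝ φ z (0, 1))
        + inner ℝ (mulV (deriv omega) g) (toL2 phaseMeasure φ) := fun g => by
    rw [inner_mulV_test bdd_omega hφv, inner_mulV_test bdd_deriv_omega hφ,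
      ← integral_add (integrable_test_Lp g (hφv.mul_snd contDiff_omega))
        (integrable_test_Lp g (hφ.mul_snd hdo))]
    simp only [d2, mul_add]
  have e1 : ∫ z, F z * (z.2 * fderiv ℝ ψ z (0, 1)) ∂phaseMeasure
      = inner ℝ (mulV (fun v => v * omega v) F) (toL2 phaseMeasure fun z => fderiv ℝ φ z (0, 1))
        + inner ℝ (mulV (fun v => v * deriv omega v) F) (toL2 phaseMeasure φ) := by
    rw [inner_mulV_test bdd_id_mul_omega hφv, inner_mulV_test bdd_id_mul_deriv_omega hφ,
      ← integral_add (integrable_test_Lp F (hφv.mul_snd (hid.mul contDiff_omega)))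
        (integrable_test_Lp F (hφ.mul_snd (hid.mul hdo)))]
    simp only [d2, mul_add, mul_assoc]
  have e2 : ∫ z, F z * (z.2 * fderiv ℝ ψ z (1, 0)) ∂phaseMeasure
      = -inner ℝ (mulV (fun v => v * omega v) Fx) (toL2 phaseMeasure φ) := by
    have hvψ := hψ.mul_snd hid
    have h1 := hx.2.2 _ hvψ.smooth hvψ.compact hvψ.support
    simp only [deriv_comp_snd hid hψ] at h1
    rw [inner_mulV_test bdd_id_mul_omega hφ]
    simpa [ψ, mul_assoc] using h1
  have e3 : ∫ z, F z * fderiv ℝ (fun z => fderiv ℝ ψ z (0, 1)) z (0, 1) ∂phaseMeasure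
      = -∫ z, Fv z * fderiv ℝ ψ z (0, 1) ∂phaseMeasure :=
    hv.2.2 _ hψv.smooth hψv.compact hψv.support
  rw [weakForce, e2, e3, e0, e0, e1]
  simp only [source, flux, inner_add_left, map_add, map_smul, real_inner_smul_left]
  ring

/-- Testing with products `χ(t) ψ(x, v)`. -/
lemma SolvesVFP.integral_eq_zero {ε : ℝ} {E : ℝ → ℝ → ℝ} {f : ℝ → PhaseL2}
    (h : SolvesVFP ε E f) {G : ℝ → PhaseL2}
    (hG : ∀ t, 0 < t → G t =ᵐ[phaseMeasure] fun z => E t z.1 * f t z)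
    {ψ : ℝ × ℝ → ℝ} (hψ : IsTest ψ) {χ : ℝ → ℝ} (h1 : ContDiff ℝ ∞ χ) (h2 : HasCompactSupport χ)
    (h3 : tsupport χ ⊆ Ioi 0) :
    ∫ t in Ioi (0 : ℝ), (deriv χ t * (ε * ∫ z, f t z * ψ z ∂phaseMeasure)
      + χ t * weakForce ε (f t) (G t) ψ) = 0 := by
  have hid : ContDiff ℝ ∞ (fun v : ℝ => v) := contDiff_id
  have hK : IsCompact (tsupport χ ×ˢ tsupport ψ) := IsCompact.prod h2 hψ.compact
  have hz : ∀ p ∉ tsupport χ ×ˢ tsupport ψ, χ p.1 * ψ p.2 = 0 := fun p hp => by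
    rw [mem_prod, not_and_or] at hp
    rcases hp with hp | hp
    · rw [image_eq_zero_of_notMem_tsupport hp, zero_mul]
    · rw [image_eq_zero_of_notMem_tsupport hp, mul_zero]
  have hts : tsupport (fun p : ℝ × ℝ × ℝ => χ p.1 * ψ p.2) ⊆ tsupport χ ×ˢ tsupport ψ :=
    closure_minimal (fun p hp => by_contra fun hp' => hp (hz p hp')) hK.isClosed
  have hφ := h (fun p => χ p.1 * ψ p.2) ((h1.comp contDiff_fst).mul (hψ.smooth.comp contDiff_snd))
    (HasCompactSupport.intro hK hz)
    (hts.trans (prod_mono h3 hψ.support))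
  refine Eq.trans ?_ hφ
  refine setIntegral_congr_fun measurableSet_Ioi fun t ht => ?_
  have hψx := hψ.fderiv_apply (1, 0)
  have hψv := hψ.fderiv_apply (0, 1)
  have hψvv := hψv.fderiv_apply (0, 1)
  have i1 := integrable_test_Lp (f t) hψ
  have i2 := integrable_test_Lp (f t) (hψx.mul_snd hid)
  have i3 := integrable_test_Lp (G t) hψv
  have i4 := integrable_test_Lp (f t) hψvv
  have i5 := integrable_test_Lp (f t) (hψv.mul_snd hid)
  have e1 : ∀ z : ℝ × ℝ, deriv (fun s => χ s * ψ (z.1, z.2)) t = deriv χ t * ψ z := fun z =>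
    ((h1.differentiable (by simp) t).hasDerivAt.mul_const _).deriv
  have e2 : ∀ z : ℝ × ℝ, deriv (fun y => χ t * ψ (y, z.2)) z.1 = χ t * fderiv ℝ ψ z (1, 0) :=
    fun z => ((hasDerivAt_slice_fst hψ.smooth z.1 z.2).const_mul _).deriv
  have e3 : ∀ z : ℝ × ℝ, deriv (fun w => χ t * ψ (z.1, w)) z.2 = χ t * fderiv ℝ ψ z (0, 1) :=
    fun z => ((hasDerivAt_slice_snd hψ.smooth z.1 z.2).const_mul _).deriv
  have j1 : Integrable (fun z => f t z * (z.2 * fderiv ℝ ψ z (1, 0))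
      - G t z * fderiv ℝ ψ z (0, 1)) phaseMeasure := i2.sub i3
  have j2 : Integrable (fun z => ε⁻¹ * (f t z * fderiv ℝ (fun z => fderiv ℝ ψ z (0, 1)) z (0, 1)
      - f t z * (z.2 * fderiv ℝ ψ z (0, 1)))) phaseMeasure := (i4.sub i5).const_mul _
  have j3 : Integrable (fun z => χ t * (f t z * (z.2 * fderiv ℝ ψ z (1, 0))
      - G t z * fderiv ℝ ψ z (0, 1)
      + ε⁻¹ * (f t z * fderiv ℝ (fun z => fderiv ℝ ψ z (0, 1)) z (0, 1)
      - f t z * (z.2 * fderiv ℝ ψ z (0, 1))))) phaseMeasure := (j1.add j2).const_mul _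
  simp only [e1, e2, e3, fokkerPlanckAdjoint_slice hψ, weakForce]
  rw [← integral_sub i2 i3, ← integral_sub i4 i5, ← integral_const_mul, ← integral_const_mul,
    ← integral_const_mul, ← integral_add j1 j2, ← integral_const_mul,
    ← integral_add ((i1.const_mul _).const_mul _) j3]
  refine integral_congr_ae ?_
  filter_upwards [hG t ht] with z hz
  simp only [hz]
  ring

/-- Equality of the traces at both ends makes a function weakly periodic. -/
lemma weakPeriodic_of_feedbackBC {K : Matrix (Fin 2) (Fin 2) ℝ} (hK : K = !![0, 1; 1, 0])
    {f fx : PhaseL2} (hx : HasWeakPartial f (1, 0) fx) (h : FeedbackBC K f) :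
    WeakPeriodic f fx := by
  obtain ⟨γ₀, γ₁, ⟨-, -, gx, -, hgx, htr⟩, h0, h1⟩ := h
  have hγ : γ₀ =ᵐ[volume] γ₁ := by
    filter_upwards [h0, h1, Measure.ae_ne volume (0 : ℝ)] with v a b hv
    rcases lt_or_gt_of_ne hv with hv | hv
    · simpa [hK, eq_comm] using b hv
    · simpa [hK] using a hv
  intro φ hφ1 hφ2 hφ3
  have h2 := htr φ hφ1 hφ2
  have e1 : ∫ v, γ₀ v * φ (0, v) = ∫ v, γ₁ v * φ (1, v) := by
    refine integral_congr_ae ?_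
    filter_upwards [hγ] with v hv
    rw [hv, hφ3]
  have e2 : ∫ z, gx z * φ z ∂phaseMeasure = ∫ z, fx z * φ z ∂phaseMeasure := by
    refine integral_congr_ae ?_
    filter_upwards [hgx.unique hx] with z hz
    rw [hz]
  rw [e1, e2, sub_self] at h2
  linarith

/-- A weak solution, extended constantly to negative times, satisfies the evolution equation. -/
lemma IsWeakSolution.exists_sol {ε : ℝ} {E : ℝ → ℝ → ℝ} {c : ℝ}
    (he : IsField (fieldExt E) c) {K : Matrix (Fin 2) (Fin 2) ℝ} (hK : K = !![0, 1; 1, 0])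
    {f : ℝ → PhaseL2} (hf : IsWeakSolution ε E K f) :
    ∃ Fx Fv : ℝ → PhaseL2, Sol ε (fun t => f (max t 0)) Fx Fv
      (force (fieldExt E) fun t => f (max t 0)) ∧
      ∀ t, HasWeakPartial (f (max t 0)) (1, 0) (Fx t) := by
  obtain ⟨fx, fv, c1, c2, c3, hw⟩ := hf.continuousInH1
  have hmax : Continuous fun t : ℝ => max t 0 := by fun_prop
  have hcl : ∀ g : ℝ → PhaseL2, ContinuousOn g (Ici 0) → Continuous fun t => g (max t 0) :=
    fun g hg => hg.comp_continuous hmax fun t => le_max_right t 0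
  set F : ℝ → PhaseL2 := fun t => f (max t 0)
  set Fx : ℝ → PhaseL2 := fun t => fx (max t 0)
  set Fv : ℝ → PhaseL2 := fun t => fv (max t 0)
  set G := force (fieldExt E) F
  have hF : Continuous F := hcl f c1
  have hFx : Continuous Fx := hcl fx c2
  have hFv : Continuous Fv := hcl fv c3
  have hG : Continuous G := he.continuous_force hF
  have hwx : ∀ t, HasWeakPartial (F t) (1, 0) (Fx t) := fun t => (hw _ (le_max_right t 0)).1
  have hwv : ∀ t, HasWeakPartial (F t) (0, 1) (Fv t) := fun t => (hw _ (le_max_right t 0)).2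
  have hfl : Continuous fun t => flux ε (F t) (Fv t) (G t) := by unfold flux; fun_prop
  have hso : Continuous fun t => source ε (F t) (Fx t) (Fv t) (G t) := by unfold source; fun_prop
  refine ⟨Fx, Fv, ⟨hF, hFx, hFv, hG, fun t => gen_rotX_of_weakPeriodic
    (weakPeriodic_of_feedbackBC hK (hwx t) (hf.boundary _ (le_max_right t 0))), fun t =>
    gen_transV_of_hasWeakPartial (hwv t), fun s t hs hst => gen_transV_of_hasWeakPartial
    ⟨locallyIntegrableOn_of_memLp (Lp.memLp _), locallyIntegrableOn_of_memLp (Lp.memLp _),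
      fun φ h1 h2 h3 => ?_⟩⟩, hwx⟩
  have hφ : IsTest φ := ⟨h1, h2, h3⟩
  have hφv := hφ.fderiv_apply (0, 1)
  -- testing the equation with `χ(t) ω(v) φ(x, v)` gives the weighted equation, weakly in time
  have hψ : IsTest fun z => omega z.2 * φ z := hφ.mul_snd contDiff_omega
  have hGae : ∀ t, 0 < t → G t =ᵐ[phaseMeasure] fun z => E t z.1 * f t z := fun t ht => by
    filter_upwards [mulL_coe (he.bdd t) (F t), ae_mem_phaseSpace] with z h4 h5
    have h6 : fieldExt E t z.1 = E t z.1 := by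
      rw [fieldExt, indicator_of_mem (Ioo_subset_Icc_self h5.1), max_eq_left ht.le]
    simp only [G, force]
    rw [h4, h6]
    simp only [F, max_eq_left ht.le]
  have hforce : ∀ r, weakForce ε (F r) (G r) (fun z => omega z.2 * φ z)
      = -(inner ℝ (source ε (F r) (Fx r) (Fv r) (G r)) (toL2 phaseMeasure φ)
        + inner ℝ (flux ε (F r) (Fv r) (G r)) (toL2 phaseMeasure fun z => fderiv ℝ φ z (0, 1))) :=
    fun r => weakForce_eq (hwx r) (hwv r) hφ
  have hb : Continuous fun r => weakForce ε (F r) (G r) (fun z => omega z.2 * φ z) := by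
    simp only [hforce]; fun_prop
  have hg : ∀ r, ∫ z, F r z * (omega z.2 * φ z) ∂phaseMeasure
      = inner ℝ (mulV omega (F r)) (toL2 phaseMeasure φ) := fun r =>
    (inner_mulV_test bdd_omega hφ (F r)).symm
  have hgc : Continuous fun r => ε * ∫ z, F r z * (omega z.2 * φ z) ∂phaseMeasure := by
    simp only [hg]; fun_prop
  have key := sub_eq_integral_of_weak_deriv hgc hb (fun χ c1 c2 c3 => by
    have h4 := hf.solves.integral_eq_zero hGae hψ c1 c2 c3
    rw [← setIntegral_eq_integral_of_forall_compl_eq_zero (s := Ioi (0 : ℝ))]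
    · refine Eq.trans ?_ h4
      refine setIntegral_congr_fun measurableSet_Ioi fun t ht => ?_
      have ht' : (0 : ℝ) ≤ t := (mem_Ioi.1 ht).le
      simp only [F, max_eq_left ht']
    · intro t ht
      have hχ : χ t = 0 := image_eq_zero_of_notMem_tsupport fun h => ht (c3 h)
      have hχ' : deriv χ t = 0 := image_eq_zero_of_notMem_tsupport
        fun h => ht (c3 (tsupport_deriv_subset h))
      rw [hχ, hχ', zero_mul, zero_mul, zero_add]) hs hst
  simp only [hforce, hg] at key
  have i1 : ∀ p : ℝ → PhaseL2, Continuous p → ∀ g : PhaseL2,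
      inner ℝ (∫ r in s..t, p r) g = ∫ r in s..t, inner ℝ (p r) g := fun p hp g => by
    have := (innerSL ℝ g).intervalIntegral_comp_comm
      (hp.intervalIntegrable (μ := volume) s t)
    simp only [innerSL_apply_apply] at this
    exact (real_inner_comm _ _).trans (this.symm.trans
      (intervalIntegral.integral_congr fun r _ => real_inner_comm _ _))
  have i2 : Continuous fun r => inner ℝ (source ε (F r) (Fx r) (Fv r) (G r))
    (toL2 phaseMeasure φ) := by fun_prop
  have i3 : Continuous fun r => inner ℝ (flux ε (F r) (Fv r) (G r))
    (toL2 phaseMeasure fun z => fderiv ℝ φ z (0, 1)) := by fun_prop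
  rw [intervalIntegral.integral_neg, intervalIntegral.integral_add (i2.intervalIntegrable _ _)
    (i3.intervalIntegrable _ _), ← i1 _ hso, ← i1 _ hfl] at key
  rw [← inner_test hφv, ← inner_test hφ, inner_add_left, real_inner_smul_left, map_sub,
    inner_sub_left]
  linarith

/-! ### Removing the regularization -/

lemma defect_le_energy {η : ℝ} (hη : 0 < η) (F : PhaseL2) : defect η F ≤ energy η F := by
  refine inner_mulL_mono (bdd_defect hη).comp_snd (bdd_regWeight hη).comp_snd (fun z => ?_) F
  rw [sq (regWeight η z.2), ← mul_assoc]
  exact mul_le_of_le_one_left (regWeight_pos hη _).le (eta_mul_regWeight_le hη _)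

lemma growth_le {ε η r : ℝ} (hη : 0 < η) (F : PhaseL2) :
    growth ε η r F ≤ (r + 3 * (ε ^ 2)⁻¹) * energy η F := by
  have h1 := microEnergy_nonneg hη F
  have h2 := defect_le_energy hη F
  have h3 : 0 ≤ (ε ^ 2)⁻¹ := by positivity
  rw [growth]
  nlinarith [mul_nonneg h3 h1, mul_le_mul_of_nonneg_left h2 h3]

/-- With a sufficiently negative rate the energy inequality gives a bound that is uniform in the
regularization. -/
lemma Sol.energy_add_energy_le {ε : ℝ} {F Fx Fv : ℝ → PhaseL2} {e : ℝ → ℝ → ℝ} {c η : ℝ}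
    (hε : 0 < ε) (h : Sol ε F Fx Fv (force e F)) (he : IsField e c) (hη : 0 < η) {t : ℝ}
    (ht : 0 ≤ t) :
    energy η (F t) + energy η (Fx t)
      ≤ Real.exp ((3 * (ε ^ 2)⁻¹ + 4 * c ^ 2) * t) * (energy η (F 0) + energy η (Fx 0)) := by
  set r := -(3 * (ε ^ 2)⁻¹ + 4 * c ^ 2)
  have h1 := h.energy_le_of_field hε he hη r ht
  have h2 := h.energy_deriv_le_of_field hε he hη r ht
  have c0 := h.cont; have c1 := h.contX
  have c3 := continuous_energy η; have c4 := continuous_growth ε η (r + c ^ 2)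
  have c5 := continuous_growth ε η (r + 2 * c ^ 2)
  have h3 : (∫ s in (0 : ℝ)..t, Real.exp (r * s) * growth ε η (r + c ^ 2) (F s))
      + ∫ s in (0 : ℝ)..t, Real.exp (r * s) * (growth ε η (r + 2 * c ^ 2) (Fx s)
        + 2 * c ^ 2 * energy η (F s)) ≤ 0 := by
    rw [← intervalIntegral.integral_add (by apply Continuous.intervalIntegrable; fun_prop)
      (by apply Continuous.intervalIntegrable; fun_prop)]
    have : ∫ s in (0 : ℝ)..t, (Real.exp (r * s) * growth ε η (r + c ^ 2) (F s)
        + Real.exp (r * s) * (growth ε η (r + 2 * c ^ 2) (Fx s) + 2 * c ^ 2 * energy η (F s)))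
        ≤ ∫ s in (0 : ℝ)..t, 0 := by
      refine intervalIntegral.integral_mono_on ht
        (by apply Continuous.intervalIntegrable; fun_prop) (by simp) fun s _ => ?_
      rw [← mul_add]
      refine mul_nonpos_of_nonneg_of_nonpos (Real.exp_pos _).le ?_
      have g1 := growth_le (ε := ε) (r := r + c ^ 2) hη (F s)
      have g2 := growth_le (ε := ε) (r := r + 2 * c ^ 2) hη (Fx s)
      have e1 := mul_nonneg (sq_nonneg c) (energy_nonneg hη (F s))
      have e2 := mul_nonneg (sq_nonneg c) (energy_nonneg hη (Fx s))
      simp only [r] at g1 g2 ⊢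
      linarith
    simpa using this
  have h4 : Real.exp (r * t) * (energy η (F t) + energy η (Fx t))
      ≤ energy η (F 0) + energy η (Fx 0) := by rw [mul_add]; linarith
  have h5 : Real.exp ((3 * (ε ^ 2)⁻¹ + 4 * c ^ 2) * t) * Real.exp (r * t) = 1 := by
    rw [← Real.exp_add, ← add_mul]; simp [r]
  calc _ = Real.exp ((3 * (ε ^ 2)⁻¹ + 4 * c ^ 2) * t) * Real.exp (r * t)
        * (energy η (F t) + energy η (Fx t)) := by rw [h5, one_mul]
    _ ≤ _ := by rw [mul_assoc]; exact mul_le_mul_of_nonneg_left h4 (Real.exp_pos _).le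

/-- A sequence of positive regularization parameters with limit `0`. -/
def etaSeq (n : ℕ) : ℝ := 1 / ((n : ℝ) + 1)

lemma etaSeq_pos (n : ℕ) : 0 < etaSeq n := by unfold etaSeq; positivity

lemma etaSeq_le_one (n : ℕ) : etaSeq n ≤ 1 := by
  rw [etaSeq, div_le_one (by positivity)]; linarith [n.cast_nonneg (α := ℝ)]

lemma tendsto_etaSeq : Tendsto etaSeq atTop (𝓝 0) := tendsto_one_div_add_atTop_nhds_zero_nat

lemma tendsto_regWeight (v : ℝ) :
    Tendsto (fun n => regWeight (etaSeq n) v) atTop (𝓝 (maxwellian v)⁻¹) := by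
  have h : Tendsto (fun n => maxwellian v + etaSeq n * (1 + v ^ 2)) atTop
      (𝓝 (maxwellian v + 0 * (1 + v ^ 2))) := (tendsto_etaSeq.mul_const _).const_add _
  rw [zero_mul, add_zero] at h
  exact h.inv₀ (maxwellian_pos v).ne'

lemma tendsto_maxwellian_mul_regWeight (v : ℝ) :
    Tendsto (fun n => maxwellian v * regWeight (etaSeq n) v) atTop (𝓝 1) := by
  have h := (tendsto_regWeight v).const_mul (maxwellian v)
  rwa [mul_inv_cancel₀ (maxwellian_pos v).ne'] at h

lemma energy_rootM {η : ℝ} (hη : 0 < η) (h : PhaseL2) :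
    energy η (mulV rootM h) = inner ℝ (mulV (fun v => maxwellian v * regWeight η v) h) h := by
  have hm := bdd_rootM.comp_snd
  have hw := (bdd_regWeight hη).comp_snd
  rw [energy, ← inner_mulL_comm, mulL_mul hw hm, mulL_mul hm (hw.mul hm)]
  congr 3 with z
  simp only [← rootM_mul_self]
  ring

lemma defect_rootM {η : ℝ} (hη : 0 < η) (h : PhaseL2) :
    defect η (mulV rootM h) = inner ℝ (mulV (fun v => η * (1 + v ^ 2) * regWeight η v
      * (maxwellian v * regWeight η v)) h) h := by
  have hm := bdd_rootM.comp_snd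
  have hw := (bdd_defect hη).comp_snd
  rw [defect, ← inner_mulL_comm, mulL_mul hw hm, mulL_mul hm (hw.mul hm)]
  congr 3 with z
  simp only [← rootM_mul_self]
  ring

lemma memLp_mul_rootM {b : ℝ → ℝ} (hb : Bdd b) : MemLp (fun v => b v * rootM v) 2 volume :=
  (hb.memLp (toL2 volume rootM)).ae_eq (by
    filter_upwards [toL2_coe memLp_rootM] with v hv
    rw [hv])

lemma bdd_maxwellian_mul_regWeight {η : ℝ} (hη : 0 < η) :
    Bdd fun v => maxwellian v * regWeight η v := bdd_maxwellian.mul (bdd_regWeight hη)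

lemma densityOp_rootM {η : ℝ} (hη : 0 < η) (h : PhaseL2) :
    densityOp η (mulV rootM h)
      = moment (mulL (fun v => maxwellian v * regWeight η v) (toL2 volume rootM)) h := by
  rw [densityOp, ContinuousLinearMap.comp_apply, moment_mulV (bdd_regWeight hη),
    moment_mulV bdd_rootM, mulL_toL2 (bdd_regWeight hη) memLp_maxwellian,
    mulL_toL2 (bdd_maxwellian_mul_regWeight hη) memLp_rootM, mulL_toL2 bdd_rootM]
  · congr 3 with v
    ring
  · exact (memLp_mul_rootM ((bdd_regWeight hη).mul bdd_rootM)).congr_norm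
      ((contDiff_regWeight hη).continuous.mul continuous_maxwellian).aestronglyMeasurable
      (Eventually.of_forall fun v => by rw [← rootM_mul_self, mul_assoc])

lemma microEnergy_rootM {η : ℝ} (hη : 0 < η) (h : PhaseL2) :
    microEnergy η (mulV rootM h)
      = inner ℝ (mulV (fun v => (maxwellian v * regWeight η v) ^ 2) h) h
      - ‖moment (mulL (fun v => maxwellian v * regWeight η v) (toL2 volume rootM)) h‖ ^ 2 := by
  have hm := bdd_rootM.comp_snd
  have hw := (bdd_maxwellian_mul_regWeight_sq hη).comp_snd
  rw [microEnergy, densityOp_rootM hη, ← inner_mulL_comm, mulL_mul hw hm, mulL_mul hm (hw.mul hm)]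
  congr 4 with z
  simp only [← rootM_mul_self]
  ring

lemma energy_rootM_le {η : ℝ} (hη : 0 < η) (h : PhaseL2) : energy η (mulV rootM h) ≤ ‖h‖ ^ 2 := by
  rw [energy_rootM hη, ← real_inner_self_eq_norm_sq]
  nth_rw 3 [← mulL_one h]
  exact inner_mulL_mono (bdd_maxwellian_mul_regWeight hη).comp_snd (.const 1)
    (fun z => maxwellian_mul_regWeight_le hη _) h

lemma abs_maxwellian_mul_regWeight_le {η : ℝ} (hη : 0 < η) (v : ℝ) :
    |maxwellian v * regWeight η v| ≤ 1 := by
  rw [abs_of_pos (mul_pos (maxwellian_pos v) (regWeight_pos hη v))]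
  exact maxwellian_mul_regWeight_le hη v

lemma tendsto_energy_rootM (h : PhaseL2) :
    Tendsto (fun n => energy (etaSeq n) (mulV rootM h)) atTop (𝓝 (‖h‖ ^ 2)) := by
  simp only [energy_rootM (etaSeq_pos _)]
  rw [← real_inner_self_eq_norm_sq]
  nth_rw 3 [← mulL_one h]
  refine Tendsto.inner (𝕜 := ℝ) ?_ tendsto_const_nhds
  exact tendsto_mulL (fun n => (bdd_maxwellian_mul_regWeight (etaSeq_pos n)).comp_snd) (.const 1)
    (fun n z => abs_maxwellian_mul_regWeight_le (etaSeq_pos n) z.2)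
    (fun z => tendsto_maxwellian_mul_regWeight z.2) h

lemma tendsto_defect_rootM (h : PhaseL2) :
    Tendsto (fun n => defect (etaSeq n) (mulV rootM h)) atTop (𝓝 0) := by
  simp only [defect_rootM (etaSeq_pos _)]
  have e : 𝓝 (0 : ℝ) = 𝓝 (inner ℝ (mulL (fun _ : ℝ × ℝ => (0 : ℝ)) h) h) := by
    rw [mulL_zero, inner_zero_left]
  rw [e]
  refine Tendsto.inner (𝕜 := ℝ) ?_ tendsto_const_nhds
  refine tendsto_mulL (C := 1) (fun n => ?_) (.const 0) (fun n z => ?_) (fun z => ?_) h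
  · have h1 := (((bdd_one_add_sq_mul_regWeight (etaSeq_pos n)).const_mul (etaSeq n)).mul
      (bdd_maxwellian_mul_regWeight (etaSeq_pos n))).comp_snd
    convert h1 using 3
    ring
  · have h0 := etaSeq_pos n
    have h1 := regWeight_pos h0 z.2
    rw [abs_mul, abs_of_pos (by have := one_add_sq_pos z.2; positivity)]
    exact mul_le_one₀ (eta_mul_regWeight_le h0 _) (abs_nonneg _)
      (abs_maxwellian_mul_regWeight_le h0 _)
  · have h1 := ((tendsto_etaSeq.mul_const (1 + z.2 ^ 2)).mul (tendsto_regWeight z.2)).mul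
      (tendsto_maxwellian_mul_regWeight z.2)
    simpa using h1

lemma tendsto_microEnergy_rootM (h : PhaseL2) :
    Tendsto (fun n => microEnergy (etaSeq n) (mulV rootM h)) atTop
      (𝓝 (‖h‖ ^ 2 - ‖moment (toL2 volume rootM) h‖ ^ 2)) := by
  simp only [microEnergy_rootM (etaSeq_pos _)]
  refine Tendsto.sub ?_ ((tendsto_moment (l := atTop) ?_ h).norm.pow 2)
  · rw [← real_inner_self_eq_norm_sq]
    nth_rw 3 [← mulL_one h]
    refine Tendsto.inner (𝕜 := ℝ) ?_ tendsto_const_nhds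
    refine tendsto_mulL (C := 1) (fun n => ?_) (.const 1) (fun n z => ?_) (fun z => ?_) h
    · have h1 := ((bdd_maxwellian_mul_regWeight (etaSeq_pos n)).mul
        (bdd_maxwellian_mul_regWeight (etaSeq_pos n))).comp_snd
      convert h1 using 3
      ring
    · rw [abs_pow]
      exact pow_le_one₀ (abs_nonneg _) (abs_maxwellian_mul_regWeight_le (etaSeq_pos n) _)
    · simpa using (tendsto_maxwellian_mul_regWeight z.2).pow 2
  · have h1 := tendsto_mulL (l := atTop)
      (fun n => bdd_maxwellian_mul_regWeight (etaSeq_pos n)) (.const 1)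
      (fun n v => abs_maxwellian_mul_regWeight_le (etaSeq_pos n) v)
      tendsto_maxwellian_mul_regWeight (toL2 volume rootM)
    rwa [mulL_one] at h1

/-- A uniform bound on the regularized energies is a bound on `F / √M` in `L²`. -/
lemma exists_rootM_of_energy_le {F : PhaseL2} {C : ℝ} (hC : ∀ η, 0 < η → energy η F ≤ C) :
    ∃ h : PhaseL2, mulV rootM h = F := by
  have hF := measurable_Lp F
  have hd : Measurable fun z : ℝ × ℝ => F z / rootM z.2 :=
    hF.div (contDiff_rootM.continuous.measurable.comp measurable_snd)
  have h1 : ∫⁻ z, ENNReal.ofReal ((F z / rootM z.2) ^ 2) ∂phaseMeasure ≤ ENNReal.ofReal C := by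
    -- the regularized weights converge to `1 / M`, and Fatou's lemma applies
    have e : ∀ z : ℝ × ℝ, ENNReal.ofReal ((F z / rootM z.2) ^ 2)
        = liminf (fun n => ENNReal.ofReal (regWeight (etaSeq n) z.2 * F z * F z)) atTop := by
      intro z
      refine (Tendsto.liminf_eq ?_).symm
      have h2 := ((tendsto_regWeight z.2).mul_const (F z)).mul_const (F z)
      refine (ENNReal.continuous_ofReal.tendsto _).comp ?_
      convert h2 using 2
      rw [← rootM_mul_self]
      have := (rootM_pos z.2).ne'
      field_simp
    simp only [e]
    refine (lintegral_liminf_le fun n => ?_).trans (liminf_le_of_frequently_le'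
      (Frequently.of_forall fun n => ?_))
    · have := (contDiff_regWeight (etaSeq_pos n)).continuous.measurable
      fun_prop
    · have hw := (bdd_regWeight (etaSeq_pos n)).comp_snd
      rw [← ofReal_integral_eq_lintegral_ofReal (integrable_mulL hw F F)
        (Eventually.of_forall fun z => ?_), ← inner_mulL hw]
      · exact ENNReal.ofReal_le_ofReal (hC _ (etaSeq_pos n))
      · simp only [Pi.zero_apply]
        rw [mul_assoc]
        exact mul_nonneg (regWeight_pos (etaSeq_pos n) _).le (mul_self_nonneg _)
  have h2 : MemLp (fun z : ℝ × ℝ => F z / rootM z.2) 2 phaseMeasure := by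
    rw [memLp_two_iff_integrable_sq hd.aestronglyMeasurable]
    refine ⟨(hd.pow_const 2).aestronglyMeasurable, ?_⟩
    rw [hasFiniteIntegral_iff_ofReal (Eventually.of_forall fun z => sq_nonneg _)]
    exact h1.trans_lt ENNReal.ofReal_lt_top
  refine ⟨toL2 phaseMeasure fun z => F z / rootM z.2, Lp.ext ?_⟩
  filter_upwards [mulL_coe bdd_rootM.comp_snd (toL2 phaseMeasure fun z => F z / rootM z.2),
    toL2_coe h2] with z h3 h4
  rw [h3, h4, mul_div_cancel₀ _ (rootM_pos z.2).ne']

/-- `h` and `hx` are `F / √M` and `Fx / √M`. The weight does not depend on `x`, so `hx = ∂ₓh`. -/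
lemma gen_rotX_of_rootM {h hx : PhaseL2} (hg : Gen rotX (mulV rootM h) (mulV rootM hx)) :
    Gen rotX h hx := by
  intro s hs
  rw [← sub_eq_zero]
  refine mulL_injective bdd_rootM.comp_snd (fun z => (rootM_pos z.2).ne') ?_
  have h1 := hg s hs
  have h2 := (mulV rootM).intervalIntegral_comp_comm
    ((isGroup_rotX.continuous hx).intervalIntegrable (μ := volume) 0 s)
  simp only [mulV_rotX bdd_rootM] at h2
  rw [map_sub, map_sub, mulV_rotX bdd_rootM, h1, ← h2, sub_self]

/-- The weighted solution stays in `L²`, together with its derivative in `x`. -/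
lemma Sol.exists_rootM {ε : ℝ} {F Fx Fv : ℝ → PhaseL2} {e : ℝ → ℝ → ℝ} {c : ℝ}
    (hε : 0 < ε) (h : Sol ε F Fx Fv (force e F)) (he : IsField e c) {h₀ hx₀ : PhaseL2}
    (h0 : mulV rootM h₀ = F 0) (hx0 : mulV rootM hx₀ = Fx 0) :
    ∃ g gx : ℝ → PhaseL2, ∀ t, 0 ≤ t → mulV rootM (g t) = F t ∧ mulV rootM (gx t) = Fx t ∧
      ‖g t‖ ^ 2 + ‖gx t‖ ^ 2
        ≤ Real.exp ((3 * (ε ^ 2)⁻¹ + 4 * c ^ 2) * t) * (‖h₀‖ ^ 2 + ‖hx₀‖ ^ 2) := by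
  have key : ∀ t, ∃ g gx : PhaseL2, 0 ≤ t → mulV rootM g = F t ∧ mulV rootM gx = Fx t ∧
      ‖g‖ ^ 2 + ‖gx‖ ^ 2
        ≤ Real.exp ((3 * (ε ^ 2)⁻¹ + 4 * c ^ 2) * t) * (‖h₀‖ ^ 2 + ‖hx₀‖ ^ 2) := by
    intro t
    by_cases ht : 0 ≤ t
    swap
    · exact ⟨0, 0, fun h => absurd h ht⟩
    have hb : ∀ η, 0 < η → energy η (F t) + energy η (Fx t)
        ≤ Real.exp ((3 * (ε ^ 2)⁻¹ + 4 * c ^ 2) * t) * (‖h₀‖ ^ 2 + ‖hx₀‖ ^ 2) := fun η hη => by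
      refine (h.energy_add_energy_le hε he hη ht).trans ?_
      rw [← h0, ← hx0]
      have := energy_rootM_le hη h₀
      have := energy_rootM_le hη hx₀
      gcongr
    obtain ⟨g, hg⟩ := exists_rootM_of_energy_le (F := F t) fun η hη =>
      (le_add_of_nonneg_right (energy_nonneg hη (Fx t))).trans (hb η hη)
    obtain ⟨gx, hgx⟩ := exists_rootM_of_energy_le (F := Fx t) fun η hη =>
      (le_add_of_nonneg_left (energy_nonneg hη (F t))).trans (hb η hη)
    refine ⟨g, gx, fun _ => ⟨hg, hgx, ?_⟩⟩
    refine le_of_tendsto' ((tendsto_energy_rootM g).add (tendsto_energy_rootM gx)) fun n => ?_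
    rw [hg, hgx]
    exact hb _ (etaSeq_pos n)
  choose g gx hg using key
  exact ⟨g, gx, hg⟩

/-! ### The evolution of velocity moments -/

/-- Velocity profiles which may be tested against a solution: together with the needed
derivatives they decay fast enough to be multiplied with `1 + v²`. -/
structure IsProfile (c : ℝ → ℝ) : Prop where
  contDiff : ContDiff ℝ ∞ c
  memLp : MemLp (fun v => (1 + v ^ 2) * c v) 2 volume
  memLp_deriv : MemLp (fun v => (1 + v ^ 2) * deriv c v) 2 volume
  memLp_deriv_deriv : MemLp (deriv (deriv c)) 2 volume

lemma Bdd.memLp_mul {α : Type*} [MeasurableSpace α] {μ : Measure α} {b c : α → ℝ} (hb : Bdd b)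
    (hc : MemLp c 2 μ) : MemLp (fun x => b x * c x) 2 μ :=
  (hb.memLp (hc.toLp c)).ae_eq (by
    filter_upwards [hc.coeFn_toLp] with x hx
    rw [hx])

lemma omega_mul_one_add_sq (v : ℝ) : omega v * (1 + v ^ 2) = 1 :=
  inv_mul_cancel₀ (one_add_sq_pos v).ne'

lemma memLp_of_one_add_sq {c : ℝ → ℝ} (h : MemLp (fun v => (1 + v ^ 2) * c v) 2 volume) :
    MemLp c 2 volume := by
  refine (bdd_omega.memLp_mul h).ae_eq (Eventually.of_forall fun v => ?_)
  rw [← mul_assoc, omega_mul_one_add_sq, one_mul]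

lemma memLp_id_mul_of_one_add_sq {c : ℝ → ℝ} (h : MemLp (fun v => (1 + v ^ 2) * c v) 2 volume) :
    MemLp (fun v => v * c v) 2 volume := by
  refine (bdd_id_mul_omega.memLp_mul h).ae_eq (Eventually.of_forall fun v => ?_)
  simp only
  rw [show v * omega v * ((1 + v ^ 2) * c v) = omega v * (1 + v ^ 2) * (v * c v) by ring,
    omega_mul_one_add_sq, one_mul]

/-- `∂_v (u(x) c(v)) = u(x) c'(v)`, where `u` need not be regular. -/
lemma gen_tensor (u : SpaceL2) {c : ℝ → ℝ} (h : ContDiff ℝ ∞ c) (h0 : MemLp c 2 volume)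
    (h1 : MemLp (deriv c) 2 volume) :
    Gen transV (tensor u (toL2 volume c)) (tensor u (toL2 volume (deriv c))) := by
  refine gen_transV_of_hasWeakPartial ?_
  have hr : LocallyIntegrableOn (fun z : ℝ × ℝ => (rootM z.2)⁻¹ * tensor u (toL2 volume rootM) z)
      phaseSpace := by
    refine (locallyIntegrableOn_of_memLp (Lp.memLp _)).continuousOn_mul ?_
      isOpen_phaseSpace.isLocallyClosed
    exact ((contDiff_rootM.continuous.comp continuous_snd).inv₀
      fun z => (rootM_pos z.2).ne').continuousOn
  have hloc : LocallyIntegrableOn (fun z : ℝ × ℝ => u z.1) phaseSpace := by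
    intro z hz
    obtain ⟨s, hs, hi⟩ := hr z hz
    refine ⟨s ∩ phaseSpace, inter_mem hs self_mem_nhdsWithin, ?_⟩
    have hi' := hi.mono_set (inter_subset_left (t := phaseSpace))
    refine IntegrableOn.congr_fun_ae hi' ?_
    refine ae_restrict_of_ae_restrict_of_subset inter_subset_right ?_
    change ∀ᵐ z ∂phaseMeasure, _
    filter_upwards [tensor_coe u (toL2 volume rootM), ae_snd (toL2_coe memLp_rootM)] with z hz h2
    rw [hz, h2]
    field_simp [(rootM_pos z.2).ne']
  have hw : HasWeakPartial (fun z : ℝ × ℝ => u z.1) (0, 1) (fun _ => 0) := by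
    refine ⟨hloc, locallyIntegrableOn_zero, fun φ h1 h2 h3 => ?_⟩
    have hφ : IsTest φ := ⟨h1, h2, h3⟩
    rw [integral_phase_prod (LocallyIntegrableOn.integrable_test hloc (hφ.fderiv_apply _))]
    simp only [zero_mul, integral_zero, neg_zero]
    refine integral_eq_zero_of_ae (Eventually.of_forall fun x => ?_)
    simp only [integral_const_mul, Pi.zero_apply]
    have hemb : Topology.IsClosedEmbedding fun v : ℝ => (x, v) :=
      (Isometry.of_dist_eq fun v w => by simp [Prod.dist_eq]).isClosedEmbedding
    have hi : ∀ {ψ : ℝ × ℝ → ℝ}, IsTest ψ → Integrable fun v => ψ (x, v) := fun hψ =>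
      (hψ.smooth.continuous.comp hemb.continuous).integrable_of_hasCompactSupport
        (hψ.compact.comp_isClosedEmbedding hemb)
    rw [integral_eq_zero_of_hasDerivAt_of_integrable (fun v => hasDerivAt_slice_snd h1 x v)
      (hi (hφ.fderiv_apply _)) (hi hφ), mul_zero]
  refine (hw.mul_snd h).congr ?_ ?_
  · filter_upwards [tensor_coe u (toL2 volume c), ae_snd (toL2_coe h0)] with z hz h2
    rw [hz, h2, mul_comm]
  · filter_upwards [tensor_coe u (toL2 volume (deriv c)), ae_snd (toL2_coe h1)] with z hz h2
    rw [hz, h2]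
    ring

/-- The terms of the equation tested with `u(x) c(v)`, up to the sign and after integration by parts
in `v`: they are the pairing of this function of `x` with `u`. -/
def momentRate (ε : ℝ) (F Fx G : PhaseL2) (c : ℝ → ℝ) : SpaceL2 :=
  moment (toL2 volume fun v => v * c v) Fx + moment (toL2 volume (deriv c)) G
    + ε⁻¹ • moment (toL2 volume fun v => v * deriv c v - deriv (deriv c) v) F

lemma deriv_omega_mul (v : ℝ) : deriv omega v * (1 + v ^ 2) + 2 * (v * omega v) = 0 := by
  have h := omega_mul_one_add_sq v
  rw [deriv_omega]
  linear_combination (-2 * v * omega v) * h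

lemma toL2_sub {b d : ℝ → ℝ} (hb : MemLp b 2 volume) (hd : MemLp d 2 volume) :
    toL2 volume (fun v => b v - d v) = toL2 volume b - toL2 volume d := by
  refine Lp.ext ?_
  filter_upwards [Lp.coeFn_sub (toL2 volume b) (toL2 volume d), toL2_coe hb, toL2_coe hd,
    toL2_coe (hb.sub hd)] with v e1 e2 e3 e4
  rw [e1, Pi.sub_apply, e2, e3]
  exact e4

namespace IsProfile

variable {c : ℝ → ℝ}

/-- The test function which after division by `1 + v²` is `u(x) c(v)`. -/
def weight (c : ℝ → ℝ) (u : SpaceL2) : PhaseL2 := tensor u (toL2 volume fun v => (1 + v ^ 2) * c v)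

/-- The derivative in velocity of `IsProfile.weight`. -/
def weightDeriv (c : ℝ → ℝ) (u : SpaceL2) : PhaseL2 :=
  tensor u (toL2 volume fun v => 2 * (v * c v) + (1 + v ^ 2) * deriv c v)

lemma memLp_weightDeriv (h : IsProfile c) :
    MemLp (fun v => 2 * (v * c v) + (1 + v ^ 2) * deriv c v) 2 volume :=
  ((memLp_id_mul_of_one_add_sq h.memLp).const_mul 2).add h.memLp_deriv

lemma gen_weight (h : IsProfile c) (u : SpaceL2) :
    Gen transV (weight c u) (weightDeriv c u) := by
  have e : deriv (fun v => (1 + v ^ 2) * c v)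
      = fun v => 2 * (v * c v) + (1 + v ^ 2) * deriv c v := by
    funext v
    have hc := ((h.contDiff.differentiable (by simp)) v).hasDerivAt
    have h1 : HasDerivAt (fun v : ℝ => 1 + v ^ 2) (2 * v) v := by
      simpa using (hasDerivAt_pow 2 v).const_add 1
    exact (h1.mul hc).deriv.trans (by ring)
  have h2 := gen_tensor u (c := fun v => (1 + v ^ 2) * c v)
    ((contDiff_const.add (contDiff_id.pow 2)).mul h.contDiff) h.memLp (e ▸ h.memLp_weightDeriv)
  rwa [e] at h2

lemma mulV_weight (h : IsProfile c) (u : SpaceL2) :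
    mulV omega (weight c u) = tensor u (toL2 volume c) := by
  rw [weight, mulV_tensor bdd_omega, mulL_toL2 bdd_omega h.memLp]
  simp only [← mul_assoc, omega_mul_one_add_sq, one_mul]

/-- Two multiples of the test function and of its derivative, brought together. -/
lemma mulV_weight_add (h : IsProfile c) (u : SpaceL2) {b b' d : ℝ → ℝ} (hb : Bdd b) (hb' : Bdd b')
    (hd : ∀ v, b' v * ((1 + v ^ 2) * c v) + b v * (2 * (v * c v) + (1 + v ^ 2) * deriv c v) = d v) :
    mulV b' (weight c u) + mulV b (weightDeriv c u) = tensor u (toL2 volume d) := by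
  rw [weight, weightDeriv, mulV_tensor hb, mulV_tensor hb', mulL_toL2 hb' h.memLp,
    mulL_toL2 hb h.memLp_weightDeriv, ← map_add]
  congr 1
  refine Lp.ext ?_
  have h1 := hb'.memLp_mul h.memLp
  have h2 := hb.memLp_mul h.memLp_weightDeriv
  have h3 : MemLp d 2 volume := (h1.add h2).ae_eq (Eventually.of_forall hd)
  filter_upwards [Lp.coeFn_add (toL2 volume fun v => b' v * ((1 + v ^ 2) * c v))
    (toL2 volume fun v => b v * (2 * (v * c v) + (1 + v ^ 2) * deriv c v)), toL2_coe h1,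
    toL2_coe h2, toL2_coe h3] with v e1 e2 e3 e4
  rw [e1, Pi.add_apply, e2, e3, e4, hd]

/-- Testing the weighted equation with `u(x) (1 + v²) c(v)` removes the weight `ω`. -/
lemma source_add_flux (h : IsProfile c) (ε : ℝ) {F Fv : PhaseL2} (hF : Gen transV F Fv)
    (Fx G : PhaseL2) (u : SpaceL2) :
    inner ℝ (source ε F Fx Fv G) (weight c u) + inner ℝ (flux ε F Fv G) (weightDeriv c u)
      = inner ℝ (momentRate ε F Fx G c) u := by
  have a1 : mulV (fun v => v * omega v) (weight c u) = tensor u (toL2 volume fun v => v * c v) := by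
    rw [weight, mulV_tensor bdd_id_mul_omega, mulL_toL2 bdd_id_mul_omega h.memLp]
    congr 3
    funext v
    linear_combination (v * c v) * omega_mul_one_add_sq v
  have a2 := h.mulV_weight_add u bdd_omega bdd_deriv_omega (d := deriv c) fun v => by
    linear_combination c v * deriv_omega_mul v + deriv c v * omega_mul_one_add_sq v
  have a3 := h.mulV_weight_add u bdd_id_mul_omega bdd_id_mul_deriv_omega
    (d := fun v => v * deriv c v) fun v => by
    linear_combination v * c v * deriv_omega_mul v + v * deriv c v * omega_mul_one_add_sq v
  have a4 := hF.inner_skew isGroup_transV (gen_tensor u (contDiff_deriv h.contDiff)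
    (memLp_of_one_add_sq h.memLp_deriv) h.memLp_deriv_deriv)
  rw [momentRate, toL2_sub (memLp_id_mul_of_one_add_sq h.memLp_deriv) h.memLp_deriv_deriv,
    moment_sub]
  simp only [source, flux, inner_add_left, inner_smul_left, inner_mulL_comm, map_add, map_smul,
    inner_sub_left, inner_moment, RCLike.conj_to_real]
  rw [← a1, ← a2, ← a3]
  rw [← a2] at a4
  simp only [inner_add_right] at a4 ⊢
  linear_combination ε⁻¹ * a4

end IsProfile

/-! ### Moments against Gaussians, and their balance laws -/

/-- The Gaussian `exp(-η v²)`, which cuts off large velocities. -/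
def gauss (η v : ℝ) : ℝ := Real.exp (-(η * v ^ 2))

/-- The Gaussian times the velocity. -/
def gaussV (η v : ℝ) : ℝ := v * gauss η v

variable {η : ℝ}

lemma contDiff_gauss : ContDiff ℝ ∞ (gauss η) := by unfold gauss; fun_prop

lemma contDiff_gaussV : ContDiff ℝ ∞ (gaussV η) := contDiff_id.mul contDiff_gauss

lemma gauss_pos (v : ℝ) : 0 < gauss η v := Real.exp_pos _

lemma gauss_le_one (hη : 0 < η) (v : ℝ) : gauss η v ≤ 1 :=
  Real.exp_le_one_iff.2 (by have := sq_nonneg v; nlinarith)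

lemma hasDerivAt_gauss (v : ℝ) : HasDerivAt (gauss η) (-(2 * η * v) * gauss η v) v := by
  have h := (((hasDerivAt_pow 2 v).const_mul η).neg).exp
  refine h.congr_deriv ?_
  simp only [gauss, Pi.neg_apply]
  push_cast
  ring

lemma deriv_gauss : deriv (gauss η) = fun v => -(2 * η * v) * gauss η v :=
  funext fun v => (hasDerivAt_gauss v).deriv

lemma deriv_deriv_gauss :
    deriv (deriv (gauss η)) = fun v => (4 * η ^ 2 * v ^ 2 - 2 * η) * gauss η v := by
  rw [deriv_gauss]
  funext v
  have h := (((hasDerivAt_id v).const_mul (2 * η)).neg).mul (hasDerivAt_gauss (η := η) v)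
  refine Eq.trans h.deriv ?_
  simp only [Pi.neg_apply, id]
  ring

lemma deriv_gaussV : deriv (gaussV η) = fun v => (1 - 2 * η * v ^ 2) * gauss η v := by
  funext v
  refine Eq.trans ((hasDerivAt_id v).mul (hasDerivAt_gauss v)).deriv ?_
  simp only [id]
  ring

lemma deriv_deriv_gaussV :
    deriv (deriv (gaussV η)) = fun v => (4 * η ^ 2 * v ^ 3 - 6 * η * v) * gauss η v := by
  rw [deriv_gaussV]
  funext v
  have h := (((hasDerivAt_pow 2 v).const_mul (2 * η)).const_sub 1).mul
    (hasDerivAt_gauss (η := η) v)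
  refine Eq.trans h.deriv ?_
  push_cast
  ring

lemma memLp_pow_mul_gauss (hη : 0 < η) (n : ℕ) :
    MemLp (fun v => v ^ n * gauss η v) 2 volume := by
  refine (memLp_two_iff_integrable_sq
    ((continuous_pow n).mul contDiff_gauss.continuous).aestronglyMeasurable).2 ?_
  have h := integrable_rpow_mul_exp_neg_mul_sq (b := 2 * η) (by positivity) (s := (2 * n : ℕ))
    (by have : (0 : ℝ) ≤ (2 * n : ℕ) := Nat.cast_nonneg _
        linarith)
  refine h.congr (Eventually.of_forall fun v => ?_)
  change v ^ ((2 * n : ℕ) : ℝ) * _ = (v ^ n * gauss η v) ^ 2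
  rw [Real.rpow_natCast, gauss, mul_pow, ← Real.exp_nat_mul, pow_mul']
  congr 2
  push_cast
  ring

lemma memLp_polynomial_mul_gauss (hη : 0 < η) (p : Polynomial ℝ) :
    MemLp (fun v => p.eval v * gauss η v) 2 volume := by
  induction p using Polynomial.induction_on' with
  | add p q hp hq =>
    refine (hp.add hq).ae_eq (Eventually.of_forall fun v => ?_)
    simp only [Pi.add_apply, Polynomial.eval_add]
    ring
  | monomial n a =>
    refine ((memLp_pow_mul_gauss hη n).const_mul a).ae_eq (Eventually.of_forall fun v => ?_)
    simp only [Polynomial.eval_monomial]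
    ring

open Polynomial in
lemma isProfile_gauss (hη : 0 < η) : IsProfile (gauss η) where
  contDiff := contDiff_gauss
  memLp := by
    refine (memLp_polynomial_mul_gauss hη (1 + X ^ 2)).ae_eq (Eventually.of_forall fun v => ?_)
    simp
  memLp_deriv := by
    refine (memLp_polynomial_mul_gauss hη ((1 + X ^ 2) * (C (-(2 * η)) * X))).ae_eq
      (Eventually.of_forall fun v => ?_)
    simp only [deriv_gauss, eval_add, eval_mul, eval_one, eval_pow, eval_X, eval_C]
    ring
  memLp_deriv_deriv := by
    refine (memLp_polynomial_mul_gauss hη (C (4 * η ^ 2) * X ^ 2 - C (2 * η))).ae_eq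
      (Eventually.of_forall fun v => ?_)
    simp only [deriv_deriv_gauss, eval_sub, eval_mul, eval_pow, eval_X, eval_C]

open Polynomial in
lemma isProfile_gaussV (hη : 0 < η) : IsProfile (gaussV η) where
  contDiff := contDiff_gaussV
  memLp := by
    refine (memLp_polynomial_mul_gauss hη ((1 + X ^ 2) * X)).ae_eq
      (Eventually.of_forall fun v => ?_)
    simp only [gaussV, eval_add, eval_mul, eval_one, eval_pow, eval_X]
    ring
  memLp_deriv := by
    refine (memLp_polynomial_mul_gauss hη ((1 + X ^ 2) * (1 - C (2 * η) * X ^ 2))).ae_eq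
      (Eventually.of_forall fun v => ?_)
    simp only [deriv_gaussV, eval_add, eval_sub, eval_mul, eval_one, eval_pow, eval_X, eval_C]
    ring
  memLp_deriv_deriv := by
    refine (memLp_polynomial_mul_gauss hη (C (4 * η ^ 2) * X ^ 3 - C (6 * η) * X)).ae_eq
      (Eventually.of_forall fun v => ?_)
    simp only [deriv_deriv_gaussV, eval_sub, eval_mul, eval_pow, eval_X, eval_C]

/-- The regularized density `∫ F exp(-η v²) dv`. -/
def massMoment (η : ℝ) : PhaseL2 →L[ℝ] SpaceL2 := moment (toL2 volume (gauss η))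

/-- The regularized current `∫ v F exp(-η v²) dv`. -/
def currentMoment (η : ℝ) : PhaseL2 →L[ℝ] SpaceL2 := moment (toL2 volume (gaussV η))

/-- The regularized pairing of the current with the derivative of the density. It makes up for the
missing dissipation of the density. -/
def crossTerm (η : ℝ) (F Fx : PhaseL2) : ℝ := inner ℝ (currentMoment η F) (massMoment η Fx)

/-- The time derivative of `crossTerm`, up to the factor `ε`. -/
def crossRate (ε η : ℝ) (F Fx G : PhaseL2) : ℝ :=
  inner ℝ (momentRate ε F Fx G (gauss η)) (currentMoment η Fx)
    - inner ℝ (momentRate ε F Fx G (gaussV η)) (massMoment η Fx)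

lemma inner_massMoment (u : SpaceL2) (F : PhaseL2) :
    inner ℝ u (massMoment η F) = inner ℝ (tensor u (toL2 volume (gauss η))) F := by
  rw [real_inner_comm, massMoment, inner_moment, real_inner_comm]

lemma currentMoment_skew {F Fx F₁ Fx₁ : PhaseL2} (h : Gen rotX F Fx) (h₁ : Gen rotX F₁ Fx₁) :
    inner ℝ (currentMoment η F) (massMoment η Fx₁)
      = -inner ℝ (currentMoment η Fx) (massMoment η F₁) := by
  have h2 := h.inner_map_skew isGroup_rotX h₁
    ((tensor.flip (toL2 volume (gauss η))).comp (currentMoment η)) fun s f => by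
      simp only [ContinuousLinearMap.comp_apply, ContinuousLinearMap.flip_apply, currentMoment,
        moment_rotX, tensor_rotS]
  simp only [ContinuousLinearMap.comp_apply, ContinuousLinearMap.flip_apply] at h2
  rw [inner_massMoment, inner_massMoment]
  linarith

lemma Sol.hasDerivWithinAt_crossTerm {ε : ℝ} (hε : 0 < ε) {F Fx Fv G : ℝ → PhaseL2}
    (h : Sol ε F Fx Fv G) (hη : 0 < η) {s : ℝ} (hs : 0 ≤ s) :
    HasDerivWithinAt (fun t => crossTerm η (F t) (Fx t))
      (ε⁻¹ * crossRate ε η (F s) (Fx s) (G s)) (Ioi s) s := by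
  have hx := h.contX
  have p0 := isProfile_gauss hη
  have p1 := isProfile_gaussV hη
  refine (h.hasDerivWithinAt hε (Θ := fun t => crossTerm η (F t) (Fx t))
    (Ψ₁ := fun t => IsProfile.weight (gaussV η) (massMoment η (Fx t)))
    (Ψ₂ := fun t => IsProfile.weight (gauss η) (-currentMoment η (Fx t)))
    (fun t => p1.gen_weight _) (fun t => p0.gen_weight _) (by unfold IsProfile.weight; fun_prop)
    (by unfold IsProfile.weightDeriv; fun_prop) (fun s t => ?_) hs).congr_deriv ?_
  · have h1 := currentMoment_skew (η := η) (h.genX s) (Gen.sub isGroup_rotX (h.genX t) (h.genX s))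
    rw [map_add, p0.mulV_weight, p1.mulV_weight, inner_add_right, ← inner_moment, ← inner_moment,
      inner_neg_right, real_inner_comm (currentMoment η (Fx s))]
    change _ = inner ℝ (currentMoment η (F t - F s)) (massMoment η (Fx t))
      + -inner ℝ (currentMoment η (Fx s)) (massMoment η (F t - F s))
    rw [← h1]
    simp only [crossTerm, map_sub, inner_sub_left, inner_sub_right]
    ring
  · have h0 := p0.source_add_flux ε (h.genV s) (Fx s) (G s) (-currentMoment η (Fx s))
    have h1 := p1.source_add_flux ε (h.genV s) (Fx s) (G s) (massMoment η (Fx s))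
    simp only [inner_add_right]
    rw [inner_neg_right] at h0
    rw [crossRate]
    linear_combination -ε⁻¹ * h0 - ε⁻¹ * h1

/-- The constant function `1` of `x`. -/
def oneS : SpaceL2 := toL2 unitMeasure fun _ => 1

lemma oneS_coe : oneS =ᵐ[unitMeasure] fun _ => 1 := toL2_coe (memLp_const 1)

lemma rotS_oneS (s : ℝ) : rotS s oneS = oneS := by
  refine Lp.ext ?_
  filter_upwards [rotS_coe s oneS, oneS_coe,
    (measurePreserving_fract s).quasiMeasurePreserving.ae oneS_coe] with x h1 h2 h3
  rw [h1, h2, h3]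

lemma gen_tensor_oneS (c : VelL2) : Gen rotX (tensor oneS c) 0 := by
  intro s _
  rw [← tensor_rotS, rotS_oneS]
  simp

lemma Sol.hasDerivWithinAt_mass {ε : ℝ} (hε : 0 < ε) {F Fx Fv G : ℝ → PhaseL2}
    (h : Sol ε F Fx Fv G) (hη : 0 < η) {s : ℝ} (hs : 0 ≤ s) :
    HasDerivWithinAt (fun t => inner ℝ (massMoment η (F t)) oneS)
      (-ε⁻¹ * inner ℝ (momentRate ε (F s) 0 (G s) (gauss η)) oneS) (Ioi s) s := by
  have p0 := isProfile_gauss hη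
  refine (h.hasDerivWithinAt hε (Θ := fun t => inner ℝ (massMoment η (F t)) oneS)
    (Ψ₁ := fun _ => IsProfile.weight (gauss η) oneS)
    (Ψ₂ := fun _ => IsProfile.weight (gauss η) 0)
    (fun t => p0.gen_weight _) (fun t => p0.gen_weight _) continuous_const
    continuous_const (fun s t => ?_) hs).congr_deriv ?_
  · rw [map_add, p0.mulV_weight, p0.mulV_weight, map_zero, zero_apply,
      add_zero, ← inner_moment, map_sub, inner_sub_left]
    rfl
  · have h0 := p0.source_add_flux ε (h.genV s) (Fx s) (G s) oneS
    have h1 := (h.genX s).inner_skew isGroup_rotX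
      (gen_tensor_oneS (toL2 volume fun v => v * gauss η v))
    rw [inner_zero_right, add_zero, ← inner_moment] at h1
    simp only [IsProfile.weight, IsProfile.weightDeriv, map_zero, zero_apply,
      add_zero] at h0 ⊢
    rw [h0]
    simp only [momentRate, inner_add_left, h1, map_zero, inner_zero_left]

/-! ### Removing the cutoff in velocity -/

/-- The density `∫ h √M dv`. -/
def density : PhaseL2 →L[ℝ] SpaceL2 := moment (toL2 volume rootM)

/-- The current `∫ v h √M dv`. -/
def momentum : PhaseL2 →L[ℝ] SpaceL2 := moment (toL2 volume fun v => rootM v * v)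

/-- The pressure `∫ v² h √M dv`. -/
def pressure : PhaseL2 →L[ℝ] SpaceL2 := moment (toL2 volume fun v => rootM v * v ^ 2)

lemma memLp_rootM_mul_pow (n : ℕ) : MemLp (fun v => rootM v * v ^ n) 2 volume := by
  refine (memLp_two_iff_integrable_sq
    (contDiff_rootM.continuous.mul (continuous_pow n)).aestronglyMeasurable).2 ?_
  refine (integrable_pow_mul_maxwellian (2 * n)).congr (Eventually.of_forall fun v => ?_)
  change v ^ (2 * n) * maxwellian v = (rootM v * v ^ n) ^ 2
  rw [← rootM_mul_self]
  ring

lemma memLp_rootM_mul_id : MemLp (fun v => rootM v * v) 2 volume := by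
  simpa using memLp_rootM_mul_pow 1

lemma memLp_rootM_mul_quartic :
    MemLp (fun v => 10 * (rootM v * (1 + v ^ 2) ^ 2)) 2 volume := by
  refine ((((memLp_rootM_mul_pow 0).add ((memLp_rootM_mul_pow 2).const_mul 2)).add
    (memLp_rootM_mul_pow 4)).const_mul 10).ae_eq (Eventually.of_forall fun v => ?_)
  simp only [Pi.add_apply]
  ring

lemma moment_rootM {b : ℝ → ℝ} (hb : MemLp b 2 volume) (h : PhaseL2) :
    moment (toL2 volume b) (mulV rootM h) = moment (toL2 volume fun v => rootM v * b v) h := by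
  rw [moment_mulV bdd_rootM, mulL_toL2 bdd_rootM hb]

/-- Moments of `√M h` against profiles of at most quartic growth pass to the limit. -/
lemma tendsto_moment_rootM {b : ℕ → ℝ → ℝ} {b₀ : ℝ → ℝ} (hb : ∀ n, MemLp (b n) 2 volume)
    (hb₀ : MemLp (fun v => rootM v * b₀ v) 2 volume)
    (hC : ∀ n v, |b n v| ≤ 10 * (1 + v ^ 2) ^ 2)
    (hlim : ∀ v, Tendsto (fun n => b n v) atTop (𝓝 (b₀ v))) :
    (∀ h, Tendsto (fun n => moment (toL2 volume (b n)) (mulV rootM h)) atTop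
        (𝓝 (moment (toL2 volume fun v => rootM v * b₀ v) h))) ∧
      ∃ P, 0 ≤ P ∧ ∀ n h, ‖moment (toL2 volume (b n)) (mulV rootM h)‖ ≤ P * ‖h‖ := by
  have hm : ∀ n, MemLp (fun v => rootM v * b n v) 2 volume := fun n =>
    bdd_rootM.memLp_mul (hb n)
  have hC' : ∀ n v, |rootM v * b n v| ≤ 10 * (rootM v * (1 + v ^ 2) ^ 2) := fun n v => by
    rw [abs_mul, abs_of_pos (rootM_pos v)]
    have := mul_le_mul_of_nonneg_left (hC n v) (rootM_pos v).le
    linarith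
  have hlim' : ∀ v, Tendsto (fun n => rootM v * b n v) atTop (𝓝 (rootM v * b₀ v)) :=
    fun v => (hlim v).const_mul _
  have key : Tendsto (fun n => toL2 volume fun v => rootM v * b n v) atTop
      (𝓝 (toL2 volume fun v => rootM v * b₀ v)) := by
    refine tendsto_Lp_of_dominated memLp_rootM_mul_quartic (Eventually.of_forall fun n => ?_) ?_ ?_
    · filter_upwards [toL2_coe (hm n)] with v hv
      rw [hv]
      exact hC' n v
    · filter_upwards [toL2_coe hb₀] with v hv
      rw [hv]
      exact le_of_tendsto (hlim' v).abs (Eventually.of_forall fun n => hC' n v)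
    · filter_upwards [toL2_coe hb₀, ae_all_iff.2 fun n => toL2_coe (hm n)] with v hv hn
      rw [hv]
      simpa only [hn] using hlim' v
  simp only [moment_rootM (hb _)]
  refine ⟨fun h => tendsto_moment key h, ?_⟩
  obtain ⟨P, hP⟩ := key.norm.bddAbove_range
  refine ⟨P, (norm_nonneg _).trans (hP ⟨0, rfl⟩), fun n h => (norm_moment_le _ _).trans ?_⟩
  exact mul_le_mul_of_nonneg_right (hP ⟨n, rfl⟩) (norm_nonneg _)

lemma tendsto_gauss (v : ℝ) : Tendsto (fun n => gauss (etaSeq n) v) atTop (𝓝 1) := by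
  have h := (Real.continuous_exp.tendsto _).comp (tendsto_etaSeq.mul_const (v ^ 2)).neg
  simpa [gauss, Function.comp_def] using h

lemma abs_mul_gauss_le {η : ℝ} (hη : 0 < η) {p B v : ℝ} (hp : |p| ≤ B) : |p * gauss η v| ≤ B := by
  rw [abs_mul, abs_of_pos (gauss_pos v)]
  exact (mul_le_of_le_one_right (abs_nonneg _) (gauss_le_one hη v)).trans hp

lemma toL2_zero : toL2 volume (fun _ : ℝ => (0 : ℝ)) = 0 := by
  refine Lp.ext ?_
  filter_upwards [toL2_coe (MemLp.zero' (μ := volume) (p := 2) (α := ℝ) (ε := ℝ)),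
    Lp.coeFn_zero ℝ 2 (volume : Measure ℝ)] with v h1 h2
  rw [h1, h2]
  rfl

lemma tendsto_massMoment :
    (∀ h, Tendsto (fun n => massMoment (etaSeq n) (mulV rootM h)) atTop (𝓝 (density h))) ∧
      ∃ P, 0 ≤ P ∧ ∀ n h, ‖massMoment (etaSeq n) (mulV rootM h)‖ ≤ P * ‖h‖ := by
  have h := tendsto_moment_rootM (b := fun n => gauss (etaSeq n)) (b₀ := fun _ => 1)
    (fun n => memLp_of_one_add_sq (isProfile_gauss (etaSeq_pos n)).memLp)
    (by simpa using memLp_rootM)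
    (fun n v => by
      rw [abs_of_pos (gauss_pos v)]
      have := gauss_le_one (etaSeq_pos n) v
      nlinarith [sq_nonneg v])
    tendsto_gauss
  simp only [mul_one] at h
  exact h

lemma tendsto_currentMoment :
    (∀ h, Tendsto (fun n => currentMoment (etaSeq n) (mulV rootM h)) atTop (𝓝 (momentum h))) ∧
      ∃ P, 0 ≤ P ∧ ∀ n h, ‖currentMoment (etaSeq n) (mulV rootM h)‖ ≤ P * ‖h‖ :=
  tendsto_moment_rootM (b := fun n => gaussV (etaSeq n)) (b₀ := fun v => v)
    (fun n => memLp_of_one_add_sq (isProfile_gaussV (etaSeq_pos n)).memLp) memLp_rootM_mul_id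
    (fun n v => abs_mul_gauss_le (etaSeq_pos n) (by
      have := abs_le_one_add_sq v
      nlinarith [sq_nonneg v]))
    (fun v => by simpa [gaussV] using (tendsto_gauss v).const_mul v)

/-- The moment rates of a profile converge if the coefficients do. -/
lemma tendsto_momentRate {c : ℕ → ℝ → ℝ} {b₁ b₂ b₃ : ℝ → ℝ} (hc : ∀ n, IsProfile (c n))
    (m₁ : MemLp (fun v => rootM v * b₁ v) 2 volume) (m₂ : MemLp (fun v => rootM v * b₂ v) 2 volume)
    (m₃ : MemLp (fun v => rootM v * b₃ v) 2 volume)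
    (h₁ : ∀ n v, |v * c n v| ≤ 10 * (1 + v ^ 2) ^ 2)
    (h₂ : ∀ n v, |deriv (c n) v| ≤ 10 * (1 + v ^ 2) ^ 2)
    (h₃ : ∀ n v, |v * deriv (c n) v - deriv (deriv (c n)) v| ≤ 10 * (1 + v ^ 2) ^ 2)
    (t₁ : ∀ v, Tendsto (fun n => v * c n v) atTop (𝓝 (b₁ v)))
    (t₂ : ∀ v, Tendsto (fun n => deriv (c n) v) atTop (𝓝 (b₂ v)))
    (t₃ : ∀ v, Tendsto (fun n => v * deriv (c n) v - deriv (deriv (c n)) v) atTop (𝓝 (b₃ v)))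
    {ε : ℝ} (hε : 0 < ε) :
    (∀ h hx g, Tendsto (fun n => momentRate ε (mulV rootM h) (mulV rootM hx) (mulV rootM g) (c n))
        atTop (𝓝 (moment (toL2 volume fun v => rootM v * b₁ v) hx
          + moment (toL2 volume fun v => rootM v * b₂ v) g
          + ε⁻¹ • moment (toL2 volume fun v => rootM v * b₃ v) h))) ∧
      ∃ P, 0 ≤ P ∧ ∀ n h hx g,
        ‖momentRate ε (mulV rootM h) (mulV rootM hx) (mulV rootM g) (c n)‖
          ≤ P * (‖h‖ + ‖hx‖ + ‖g‖) := by
  obtain ⟨l₁, P₁, p₁, q₁⟩ := tendsto_moment_rootM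
    (fun n => memLp_id_mul_of_one_add_sq (hc n).memLp) m₁ h₁ t₁
  obtain ⟨l₂, P₂, p₂, q₂⟩ := tendsto_moment_rootM
    (fun n => memLp_of_one_add_sq (hc n).memLp_deriv) m₂ h₂ t₂
  obtain ⟨l₃, P₃, p₃, q₃⟩ := tendsto_moment_rootM
    (fun n => (memLp_id_mul_of_one_add_sq (hc n).memLp_deriv).sub (hc n).memLp_deriv_deriv)
    m₃ h₃ t₃
  refine ⟨fun h hx g => ((l₁ hx).add (l₂ g)).add ((l₃ h).const_smul ε⁻¹),
    P₁ + P₂ + ε⁻¹ * P₃, by positivity, fun n h hx g => ?_⟩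
  have e : ‖ε⁻¹‖ = ε⁻¹ := by rw [Real.norm_eq_abs, abs_of_pos (inv_pos.2 hε)]
  refine (norm_add₃_le).trans ?_
  rw [norm_smul, e]
  have a₁ := q₁ n hx
  have a₂ := q₂ n g
  have a₃ := mul_le_mul_of_nonneg_left (q₃ n h) (inv_pos.2 hε).le
  have : 0 ≤ ε⁻¹ * P₃ := by positivity
  have n1 := norm_nonneg h
  have n2 := norm_nonneg hx
  have n3 := norm_nonneg g
  calc _ ≤ P₁ * ‖hx‖ + P₂ * ‖g‖ + ε⁻¹ * (P₃ * ‖h‖) := add_le_add (add_le_add a₁ a₂) a₃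
    _ ≤ P₁ * (‖h‖ + ‖hx‖ + ‖g‖) + P₂ * (‖h‖ + ‖hx‖ + ‖g‖)
        + ε⁻¹ * (P₃ * (‖h‖ + ‖hx‖ + ‖g‖)) := by gcongr <;> linarith
    _ = _ := by ring

lemma tendsto_momentRate_gauss {ε : ℝ} (hε : 0 < ε) :
    (∀ h hx g, Tendsto (fun n => momentRate ε (mulV rootM h) (mulV rootM hx) (mulV rootM g)
        (gauss (etaSeq n))) atTop (𝓝 (momentum hx))) ∧
      ∃ P, 0 ≤ P ∧ ∀ n h hx g,
        ‖momentRate ε (mulV rootM h) (mulV rootM hx) (mulV rootM g) (gauss (etaSeq n))‖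
          ≤ P * (‖h‖ + ‖hx‖ + ‖g‖) := by
  have hz : MemLp (fun v : ℝ => rootM v * 0) 2 volume := by simp
  have key := tendsto_momentRate (c := fun n => gauss (etaSeq n)) (b₁ := fun v => v)
    (b₂ := fun _ => 0) (b₃ := fun _ => 0) (fun n => isProfile_gauss (etaSeq_pos n))
    memLp_rootM_mul_id hz hz
    (fun n v => abs_mul_gauss_le (etaSeq_pos n) (by
      have := abs_le_one_add_sq v
      nlinarith [sq_nonneg v]))
    (fun n v => by
      rw [deriv_gauss]
      have h0 := etaSeq_pos n
      have h1 := etaSeq_le_one n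
      refine abs_mul_gauss_le h0 ?_
      have h2 : |-(2 * etaSeq n * v)| ≤ 2 * (1 + v ^ 2) := by
        rw [abs_neg, abs_mul, abs_of_pos (by positivity)]
        exact mul_le_mul (by linarith) (abs_le_one_add_sq v) (abs_nonneg _) (by norm_num)
      nlinarith [sq_nonneg v])
    (fun n v => by
      rw [deriv_deriv_gauss, deriv_gauss]
      have h0 := etaSeq_pos n
      have h1 := etaSeq_le_one n
      simp only [← mul_assoc, ← sub_mul]
      refine abs_mul_gauss_le h0 ?_
      have h2 := mul_le_of_le_one_left (sq_nonneg v) h1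
      have h3 := mul_le_of_le_one_left (sq_nonneg v) (pow_le_one₀ h0.le h1 (n := 2))
      have h4 : 0 ≤ etaSeq n * v ^ 2 := by positivity
      have h5 : 0 ≤ etaSeq n ^ 2 * v ^ 2 := by positivity
      have h6 := sq_nonneg (v ^ 2)
      rw [abs_le]
      constructor <;> nlinarith [sq_nonneg v])
    (fun v => by simpa using (tendsto_gauss v).const_mul v)
    (fun v => by
      rw [show (0 : ℝ) = -(2 * 0 * v) * 1 by ring]
      simp only [deriv_gauss]
      exact (((tendsto_etaSeq.const_mul 2).mul_const v).neg).mul (tendsto_gauss v))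
    (fun v => by
      rw [show (0 : ℝ) = v * (-(2 * 0 * v) * 1) - (4 * 0 ^ 2 * v ^ 2 - 2 * 0) * 1 by ring]
      simp only [deriv_deriv_gauss]
      simp only [deriv_gauss]
      exact ((((tendsto_etaSeq.const_mul 2).mul_const v).neg).mul (tendsto_gauss v)).const_mul v
        |>.sub (((((tendsto_etaSeq.pow 2).const_mul 4).mul_const _).sub
          (tendsto_etaSeq.const_mul 2)).mul (tendsto_gauss v)))
    hε
  simp only [mul_zero, toL2_zero] at key
  have hm : moment 0 = 0 := by
    have := moment_sub (0 : VelL2) 0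
    ext1 f
    simpa using this f
  simp only [hm, zero_apply, smul_zero, add_zero] at key
  exact key

lemma tendsto_momentRate_gaussV {ε : ℝ} (hε : 0 < ε) :
    (∀ h hx g, Tendsto (fun n => momentRate ε (mulV rootM h) (mulV rootM hx) (mulV rootM g)
        (gaussV (etaSeq n))) atTop (𝓝 (pressure hx + density g + ε⁻¹ • momentum h))) ∧
      ∃ P, 0 ≤ P ∧ ∀ n h hx g,
        ‖momentRate ε (mulV rootM h) (mulV rootM hx) (mulV rootM g) (gaussV (etaSeq n))‖
          ≤ P * (‖h‖ + ‖hx‖ + ‖g‖) := by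
  have key := tendsto_momentRate (c := fun n => gaussV (etaSeq n)) (b₁ := fun v => v ^ 2)
    (b₂ := fun _ => 1) (b₃ := fun v => v) (fun n => isProfile_gaussV (etaSeq_pos n))
    (memLp_rootM_mul_pow 2) (by simpa using memLp_rootM) memLp_rootM_mul_id
    (fun n v => by
      simp only [gaussV, ← mul_assoc]
      refine abs_mul_gauss_le (etaSeq_pos n) (abs_le.2 ⟨?_, ?_⟩) <;> nlinarith [sq_nonneg v])
    (fun n v => by
      rw [deriv_gaussV]
      have h0 := etaSeq_pos n
      have h1 := etaSeq_le_one n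
      refine abs_mul_gauss_le h0 ?_
      have h2 := mul_le_of_le_one_left (sq_nonneg v) h1
      have h4 : 0 ≤ etaSeq n * v ^ 2 := by positivity
      have h6 := sq_nonneg (v ^ 2)
      rw [abs_le]
      constructor <;> nlinarith [sq_nonneg v])
    (fun n v => by
      rw [deriv_deriv_gaussV, deriv_gaussV]
      have h0 := etaSeq_pos n
      have h1 := etaSeq_le_one n
      simp only [← mul_assoc, ← sub_mul]
      refine abs_mul_gauss_le h0 ?_
      have h2 := mul_le_of_le_one_left (sq_nonneg v) h1
      have h3 := mul_le_of_le_one_left (sq_nonneg v) (pow_le_one₀ h0.le h1 (n := 2))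
      have h4 : 0 ≤ etaSeq n * v ^ 2 := by positivity
      have h5 : 0 ≤ etaSeq n ^ 2 * v ^ 2 := by positivity
      have h7 : |1 + 6 * etaSeq n - 2 * (etaSeq n * v ^ 2) - 4 * (etaSeq n ^ 2 * v ^ 2)|
          ≤ 10 * (1 + v ^ 2) := by
        rw [abs_le]
        constructor <;> linarith [sq_nonneg v]
      rw [show v * (1 - 2 * etaSeq n * v ^ 2) - (4 * etaSeq n ^ 2 * v ^ 3 - 6 * etaSeq n * v)
        = v * (1 + 6 * etaSeq n - 2 * (etaSeq n * v ^ 2) - 4 * (etaSeq n ^ 2 * v ^ 2)) by ring,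
        abs_mul]
      exact (mul_le_mul (abs_le_one_add_sq v) h7 (abs_nonneg _) (one_add_sq_pos v).le).trans_eq
        (by ring))
    (fun v => by simpa [gaussV, pow_two] using ((tendsto_gauss v).const_mul v).const_mul v)
    (fun v => by
      have h := (((tendsto_etaSeq.const_mul 2).mul_const (v ^ 2)).const_sub 1).mul
        (tendsto_gauss v)
      simpa [deriv_gaussV] using h)
    (fun v => by
      have h := (((((tendsto_etaSeq.const_mul 2).mul_const (v ^ 2)).const_sub 1).mul
        (tendsto_gauss v)).const_mul v).sub
        (((((tendsto_etaSeq.pow 2).const_mul 4).mul_const (v ^ 3)).sub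
          ((tendsto_etaSeq.const_mul 6).mul_const v)).mul (tendsto_gauss v))
      simp only [deriv_deriv_gaussV]
      simpa [deriv_gaussV] using h)
    hε
  simp only [mul_one] at key
  exact key

/-- The limit of `crossRate`. -/
def limitRate (ε : ℝ) (h hx g : PhaseL2) : ℝ :=
  ‖momentum hx‖ ^ 2 - inner ℝ (pressure hx + density g + ε⁻¹ • momentum h) (density hx)

lemma tendsto_crossTerm (h hx : PhaseL2) :
    Tendsto (fun n => crossTerm (etaSeq n) (mulV rootM h) (mulV rootM hx)) atTop
      (𝓝 (inner ℝ (momentum h) (density hx))) :=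
  (tendsto_currentMoment.1 h).inner (tendsto_massMoment.1 hx)

lemma tendsto_crossRate {ε : ℝ} (hε : 0 < ε) (h hx g : PhaseL2) :
    Tendsto (fun n => crossRate ε (etaSeq n) (mulV rootM h) (mulV rootM hx) (mulV rootM g)) atTop
      (𝓝 (limitRate ε h hx g)) := by
  rw [limitRate, ← real_inner_self_eq_norm_sq]
  exact (((tendsto_momentRate_gauss hε).1 h hx g).inner (tendsto_currentMoment.1 hx)).sub
    (((tendsto_momentRate_gaussV hε).1 h hx g).inner (tendsto_massMoment.1 hx))

lemma exists_abs_crossTerm_le : ∃ P, 0 ≤ P ∧ ∀ n h hx,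
    |crossTerm (etaSeq n) (mulV rootM h) (mulV rootM hx)| ≤ P * (‖h‖ * ‖hx‖) := by
  obtain ⟨-, P, p, q⟩ := tendsto_currentMoment
  obtain ⟨-, P₁, p₁, q₁⟩ := tendsto_massMoment
  refine ⟨P * P₁, by positivity, fun n h hx => (abs_real_inner_le_norm _ _).trans ?_⟩
  calc _ ≤ (P * ‖h‖) * (P₁ * ‖hx‖) := by gcongr <;> simp only [q, q₁]
    _ = _ := by ring

lemma exists_abs_crossRate_le {ε : ℝ} (hε : 0 < ε) : ∃ P, 0 ≤ P ∧ ∀ n h hx g,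
    |crossRate ε (etaSeq n) (mulV rootM h) (mulV rootM hx) (mulV rootM g)|
      ≤ P * ((‖h‖ + ‖hx‖ + ‖g‖) * ‖hx‖) := by
  obtain ⟨-, P, p, q⟩ := tendsto_currentMoment
  obtain ⟨-, P₁, p₁, q₁⟩ := tendsto_massMoment
  obtain ⟨-, P₂, p₂, q₂⟩ := tendsto_momentRate_gauss hε
  obtain ⟨-, P₃, p₃, q₃⟩ := tendsto_momentRate_gaussV hε
  refine ⟨P₂ * P + P₃ * P₁, by positivity, fun n h hx g => (abs_sub _ _).trans ?_⟩
  refine (add_le_add (abs_real_inner_le_norm _ _) (abs_real_inner_le_norm _ _)).trans ?_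
  calc _ ≤ (P₂ * (‖h‖ + ‖hx‖ + ‖g‖)) * (P * ‖hx‖) + (P₃ * (‖h‖ + ‖hx‖ + ‖g‖)) * (P₁ * ‖hx‖) := by
        gcongr <;> simp only [q, q₁, q₂, q₃]
    _ = _ := by ring

/-! ### Coercivity -/

lemma inner_rootM_mul {b : ℝ → ℝ} (hb : MemLp (fun v => rootM v * b v) 2 volume) :
    inner ℝ (toL2 volume rootM) (toL2 volume fun v => rootM v * b v) = ∫ v, b v * maxwellian v := by
  rw [inner_toL2 memLp_rootM hb]
  refine integral_congr_ae (Eventually.of_forall fun v => ?_)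
  simp only [← rootM_mul_self]
  ring

lemma norm_sq_rootM_mul {b : ℝ → ℝ} (hb : MemLp (fun v => rootM v * b v) 2 volume) :
    ‖toL2 volume fun v => rootM v * b v‖ ^ 2 = ∫ v, b v ^ 2 * maxwellian v := by
  rw [← real_inner_self_eq_norm_sq, inner_toL2 hb hb]
  refine integral_congr_ae (Eventually.of_forall fun v => ?_)
  simp only [← rootM_mul_self]
  ring

lemma inner_tensor_rootM (h : PhaseL2) :
    inner ℝ h (tensor (density h) (toL2 volume rootM)) = ‖density h‖ ^ 2 := by
  rw [← inner_moment, ← real_inner_self_eq_norm_sq]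
  rfl

/-- The squared distance to local equilibrium. -/
lemma norm_sub_tensor_sq (h : PhaseL2) :
    ‖h - tensor (density h) (toL2 volume rootM)‖ ^ 2 = ‖h‖ ^ 2 - ‖density h‖ ^ 2 := by
  rw [norm_sub_sq_real, inner_tensor_rootM, ← real_inner_self_eq_norm_sq (tensor _ _), inner_tensor,
    real_inner_self_eq_norm_sq, real_inner_self_eq_norm_sq, norm_rootM]
  ring

/-- Moments against profiles orthogonal to `√M` only see the deviation from local equilibrium. -/
lemma norm_moment_sq_le {c : VelL2} (hc : inner ℝ (toL2 volume rootM) c = 0) (h : PhaseL2) :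
    ‖moment c h‖ ^ 2 ≤ ‖c‖ ^ 2 * (‖h‖ ^ 2 - ‖density h‖ ^ 2) := by
  have e : moment c h = moment c (h - tensor (density h) (toL2 volume rootM)) := by
    rw [map_sub, moment_tensor, hc, zero_smul, sub_zero]
  rw [e, ← norm_sub_tensor_sq, ← mul_pow]
  gcongr
  exact norm_moment_le _ _

lemma norm_density_le (h : PhaseL2) : ‖density h‖ ^ 2 ≤ ‖h‖ ^ 2 := by
  have := norm_sub_tensor_sq h
  have := sq_nonneg ‖h - tensor (density h) (toL2 volume rootM)‖
  linarith

/-- The profile `v √M` is a unit vector orthogonal to `√M`, so the momentum only sees the microscopic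
part. -/
lemma norm_momentum_sq_le (h : PhaseL2) : ‖momentum h‖ ^ 2 ≤ ‖h‖ ^ 2 - ‖density h‖ ^ 2 := by
  have h1 := norm_moment_sq_le (c := toL2 volume fun v => rootM v * v)
    (by rw [inner_rootM_mul memLp_rootM_mul_id, integral_id_mul_maxwellian]) h
  rwa [norm_sq_rootM_mul memLp_rootM_mul_id, integral_sq_mul_maxwellian, one_mul] at h1

/-- The profile `(v² - 1) √M` is orthogonal to `√M` and has squared norm `2`. -/
lemma norm_pressure_sub_density_sq_le (h : PhaseL2) :
    ‖pressure h - density h‖ ^ 2 ≤ 2 * (‖h‖ ^ 2 - ‖density h‖ ^ 2) := by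
  have hm : MemLp (fun v => rootM v * (v ^ 2 - 1)) 2 volume :=
    ((memLp_rootM_mul_pow 2).sub memLp_rootM).ae_eq (Eventually.of_forall fun v => by
      simp only [Pi.sub_apply]
      ring)
  have e : pressure h - density h = moment (toL2 volume fun v => rootM v * (v ^ 2 - 1)) h := by
    rw [pressure, density, ← moment_sub, ← toL2_sub (memLp_rootM_mul_pow 2) memLp_rootM]
    simp only [mul_sub, mul_one]
  have i2 := integrable_pow_mul_maxwellian 2
  have i4 := integrable_pow_mul_maxwellian 4
  have h0 : ∫ v, (v ^ 2 - 1) * maxwellian v = 0 := by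
    have := integral_sub i2 integrable_maxwellian
    rw [integral_sq_mul_maxwellian, integral_maxwellian, sub_self] at this
    rw [← this]
    simp only [sub_mul, one_mul]
  have h2 : ∫ v, (v ^ 2 - 1) ^ 2 * maxwellian v = 2 := by
    have := (integral_sub_add_const_mul i4 i2 integrable_maxwellian 2 1).2
    rw [integral_pow_four_mul_maxwellian, integral_sq_mul_maxwellian, integral_maxwellian] at this
    refine Eq.trans (integral_congr_ae (Eventually.of_forall fun v => ?_))
      (this.trans (by norm_num))
    simp only
    ring
  have h1 := norm_moment_sq_le (c := toL2 volume fun v => rootM v * (v ^ 2 - 1))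
    (by rw [inner_rootM_mul hm, h0]) h
  rwa [norm_sq_rootM_mul hm, h2, ← e] at h1

/-- Integrability for Fubini's theorem: the shear `(s, x) ↦ (s, x + s)` of the torus preserves the
measure. -/
lemma integrable_fract_mul (σ : SpaceL2) :
    Integrable (fun p : ℝ × ℝ => σ (Int.fract (p.2 + p.1)) * σ p.2)
      (unitMeasure.prod unitMeasure) := by
  have h1 : MeasurePreserving (fun p : ℝ × ℝ => (p.1, Int.fract (p.2 + p.1)))
      (unitMeasure.prod unitMeasure) (unitMeasure.prod unitMeasure) :=
    MeasurePreserving.skew_product (MeasurePreserving.id _)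
      (g := fun s x => Int.fract (x + s))
      (measurable_fract.comp (measurable_snd.add measurable_fst))
      (Eventually.of_forall fun s => (measurePreserving_fract s).map_eq)
  have h2 : MemLp (fun p : ℝ × ℝ => σ (Int.fract (p.2 + p.1))) 2 (unitMeasure.prod unitMeasure) :=
    ((Lp.memLp σ).comp_snd unitMeasure).comp_measurePreserving h1
  exact h2.integrable_mul ((Lp.memLp σ).comp_snd unitMeasure)

lemma inner_oneS (σ : SpaceL2) : inner ℝ σ oneS = ∫ x, σ x ∂unitMeasure := by
  rw [inner_eq_integral]
  refine integral_congr_ae ?_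
  filter_upwards [oneS_coe] with x hx
  rw [hx, mul_one]

/-- The average of all translates of a function is its mean. -/
lemma integral_inner_rotS {σ : SpaceL2} (h : inner ℝ σ oneS = 0) :
    Integrable (fun s => inner ℝ (rotS s σ) σ) unitMeasure ∧
      ∫ s, inner ℝ (rotS s σ) σ ∂unitMeasure = 0 := by
  have e : ∀ s, inner ℝ (rotS s σ) σ = ∫ x, σ (Int.fract (x + s)) * σ x ∂unitMeasure := fun s => by
    rw [inner_eq_integral]
    refine integral_congr_ae ?_
    filter_upwards [rotS_coe s σ] with x hx
    rw [hx]
  simp only [e]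
  have hi := integrable_fract_mul σ
  refine ⟨hi.integral_prod_left, ?_⟩
  rw [integral_integral_swap hi]
  refine integral_eq_zero_of_ae (Eventually.of_forall fun x => ?_)
  simp only [Pi.zero_apply]
  rw [integral_mul_const]
  have h1 := integral_map (measurePreserving_fract x).aemeasurable
    (f := σ) (by rw [(measurePreserving_fract x).map_eq]; exact Lp.aestronglyMeasurable σ)
  rw [(measurePreserving_fract x).map_eq, ← inner_oneS, h] at h1
  simp only [add_comm x, ← h1, zero_mul]

/-- The Poincaré inequality on the circle, with a constant which is not optimal. -/
lemma norm_le_of_gen_rotS {σ σx : SpaceL2} (hg : Gen rotS σ σx) (h : inner ℝ σ oneS = 0) :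
    ‖σ‖ ≤ ‖σx‖ := by
  obtain ⟨hi, h0⟩ := integral_inner_rotS h
  have key : ∀ᵐ s ∂unitMeasure, 2 * ‖σ‖ ^ 2 - 2 * inner ℝ (rotS s σ) σ ≤ ‖σx‖ ^ 2 := by
    filter_upwards [ae_restrict_mem measurableSet_Ioo] with s hs
    have h1 : ‖rotS s σ - σ‖ ≤ ‖σx‖ :=
      (hg.norm_sub_le (Ioo_subset_Icc_self hs)).trans
        (mul_le_of_le_one_left (norm_nonneg _) hs.2.le)
    have h2 := pow_le_pow_left₀ (norm_nonneg _) h1 2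
    rw [norm_sub_sq_real, (rotS s).norm_map] at h2
    linarith
  have h1 := integral_mono_ae ((integrable_const (2 * ‖σ‖ ^ 2)).sub (hi.const_mul 2))
    (integrable_const (‖σx‖ ^ 2)) key
  rw [integral_sub' (integrable_const _) (hi.const_mul 2), integral_const_mul,
    integral_const_mul, h0] at h1
  have hu : unitMeasure.real univ = 1 := by simp
  simp only [integral_const, hu, one_smul, mul_zero, sub_zero] at h1
  refine (pow_le_pow_iff_left₀ (norm_nonneg _) (norm_nonneg _) two_ne_zero).1 ?_
  nlinarith [sq_nonneg ‖σ‖]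

lemma gen_density {h hx : PhaseL2} (hg : Gen rotX h hx) : Gen rotS (density h) (density hx) :=
  hg.map isGroup_rotX density fun s f => moment_rotX s _ f

/-! ### Conservation of mass and the limiting differential inequality -/

lemma tendsto_integral_exp_mul {Λ : ℕ → ℝ → ℝ} {Λ₀ : ℝ → ℝ} (hc : ∀ n, Continuous (Λ n)) (r : ℝ)
    {t K : ℝ} (ht : 0 ≤ t) (hb : ∀ n, ∀ s ∈ Icc 0 t, |Λ n s| ≤ K)
    (hlim : ∀ s ∈ Icc 0 t, Tendsto (fun n => Λ n s) atTop (𝓝 (Λ₀ s))) :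
    Tendsto (fun n => ∫ s in (0 : ℝ)..t, Real.exp (r * s) * Λ n s) atTop
      (𝓝 (∫ s in (0 : ℝ)..t, Real.exp (r * s) * Λ₀ s)) := by
  have hs : ∀ s ∈ uIoc 0 t, s ∈ Icc 0 t := fun s hs => by
    rw [uIoc_of_le ht] at hs
    exact Ioc_subset_Icc_self hs
  refine intervalIntegral.tendsto_integral_filter_of_dominated_convergence
    (fun s => Real.exp (r * s) * K) (Eventually.of_forall fun n => ?_)
    (Eventually.of_forall fun n => Eventually.of_forall fun s h => ?_)
    (Continuous.intervalIntegrable (by fun_prop) _ _)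
    (Eventually.of_forall fun s h => (hlim s (hs s h)).const_mul _)
  · have := hc n
    exact (by fun_prop : Continuous fun s => Real.exp (r * s) * Λ n s).aestronglyMeasurable
  · rw [norm_mul, Real.norm_eq_abs, Real.norm_eq_abs, Real.abs_exp]
    exact mul_le_mul_of_nonneg_left (hb n s (hs s h)) (Real.exp_pos _).le

lemma integral_exp_mul_add (r t : ℝ) {p q u : ℝ → ℝ} (hp : Continuous p) (hq : Continuous q)
    (hu : Continuous u) (k : ℝ) :
    ∫ s in (0 : ℝ)..t, Real.exp (r * s) * (p s + q s + k * u s)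
      = (∫ s in (0 : ℝ)..t, Real.exp (r * s) * p s) + (∫ s in (0 : ℝ)..t, Real.exp (r * s) * q s)
        + k * ∫ s in (0 : ℝ)..t, Real.exp (r * s) * u s := by
  have i : ∀ {f : ℝ → ℝ}, Continuous f →
      IntervalIntegrable (fun s => Real.exp (r * s) * f s) volume 0 t := fun hf =>
    Continuous.intervalIntegrable (by fun_prop) _ _
  rw [← intervalIntegral.integral_add (i hp) (i hq), ← intervalIntegral.integral_const_mul,
    ← intervalIntegral.integral_add ((i hp).add (i hq)) ((i hu).const_mul k)]
  refine intervalIntegral.integral_congr fun s _ => ?_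
  ring

/-- `F = √M g` and `Fx = √M gx`, with bounds on `g` and `gx` that are uniform on bounded time
intervals. -/
structure IsWeighted (F Fx g gx : ℝ → PhaseL2) : Prop where
  eq : ∀ t, 0 ≤ t → mulV rootM (g t) = F t
  eqX : ∀ t, 0 ≤ t → mulV rootM (gx t) = Fx t
  bound : ∀ t, ∃ R, ∀ s ∈ Icc 0 t, ‖g s‖ ≤ R ∧ ‖gx s‖ ≤ R

variable {ε : ℝ} {F Fx Fv : ℝ → PhaseL2} {e : ℝ → ℝ → ℝ} {c : ℝ} {g gx : ℝ → PhaseL2}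

lemma Sol.exists_isWeighted (hε : 0 < ε) (h : Sol ε F Fx Fv (force e F)) (he : IsField e c)
    {h₀ hx₀ : PhaseL2} (h0 : mulV rootM h₀ = F 0) (hx0 : mulV rootM hx₀ = Fx 0) :
    ∃ g gx, IsWeighted F Fx g gx := by
  obtain ⟨g, gx, hg⟩ := h.exists_rootM hε he h0 hx0
  refine ⟨g, gx, fun t ht => (hg t ht).1, fun t ht => (hg t ht).2.1, fun t => ?_⟩
  refine ⟨√(Real.exp ((3 * (ε ^ 2)⁻¹ + 4 * c ^ 2) * t) * (‖h₀‖ ^ 2 + ‖hx₀‖ ^ 2)), fun s hs => ?_⟩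
  have h1 := (hg s hs.1).2.2
  have h2 : Real.exp ((3 * (ε ^ 2)⁻¹ + 4 * c ^ 2) * s) * (‖h₀‖ ^ 2 + ‖hx₀‖ ^ 2)
      ≤ Real.exp ((3 * (ε ^ 2)⁻¹ + 4 * c ^ 2) * t) * (‖h₀‖ ^ 2 + ‖hx₀‖ ^ 2) := by
    gcongr
    exact hs.2
  constructor <;> refine Real.le_sqrt_of_sq_le ?_ <;>
    linarith [sq_nonneg ‖g s‖, sq_nonneg ‖gx s‖]

lemma IsWeighted.force_eq (hw : IsWeighted F Fx g gx) (he : IsField e c) {t : ℝ} (ht : 0 ≤ t) :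
    mulV rootM (force e g t) = force e F t := by
  rw [force, force, ← hw.eq t ht, mulL_mul bdd_rootM.comp_snd (he.bdd t),
    mulL_mul (he.bdd t) bdd_rootM.comp_snd]
  simp only [mul_comm]

lemma norm_force_le (he : IsField e c) (t : ℝ) : ‖force e g t‖ ≤ c * ‖g t‖ :=
  norm_mulL_le (he.bdd t) (fun z => he.bound t z.1) _

lemma IsWeighted.gen (hw : IsWeighted F Fx g gx) (h : Sol ε F Fx Fv (force e F)) {t : ℝ}
    (ht : 0 ≤ t) : Gen rotX (g t) (gx t) :=
  gen_rotX_of_rootM (by rw [hw.eq t ht, hw.eqX t ht]; exact h.genX t)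

/-- The equation conserves mass. -/
lemma IsWeighted.mass_eq (hw : IsWeighted F Fx g gx) (hε : 0 < ε) (h : Sol ε F Fx Fv (force e F))
    (he : IsField e c) {t : ℝ} (ht : 0 ≤ t) :
    inner ℝ (density (g t)) oneS = inner ℝ (density (g 0)) oneS := by
  have hF := h.cont
  have hG := h.contG
  obtain ⟨R, hR⟩ := hw.bound t
  have hR0 : 0 ≤ R := (norm_nonneg _).trans (hR 0 ⟨le_rfl, ht⟩).1
  obtain ⟨hl, P, hP, hb⟩ := tendsto_momentRate_gauss hε
  have hc0 := he.nonneg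
  have key : ∀ n, Real.exp (0 * t) * inner ℝ (massMoment (etaSeq n) (F t)) oneS
      = inner ℝ (massMoment (etaSeq n) (F 0)) oneS + ∫ s in (0 : ℝ)..t, Real.exp (0 * s) *
        (0 * inner ℝ (massMoment (etaSeq n) (F s)) oneS + -ε⁻¹ * inner ℝ
          (momentRate ε (F s) 0 (force e F s) (gauss (etaSeq n))) oneS) := fun n =>
    exp_mul_eq_add_integral (Θ := fun t => inner ℝ (massMoment (etaSeq n) (F t)) oneS)
      (D := fun s => -ε⁻¹ * inner ℝ (momentRate ε (F s) 0 (force e F s) (gauss (etaSeq n))) oneS)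
      (by fun_prop) (by unfold momentRate; fun_prop)
      (fun s hs => h.hasDerivWithinAt_mass hε (etaSeq_pos n) hs) 0 ht
  simp only [zero_mul, Real.exp_zero, one_mul, zero_add] at key
  have l1 : ∀ s, 0 ≤ s → Tendsto (fun n => inner ℝ (massMoment (etaSeq n) (F s)) oneS) atTop
      (𝓝 (inner ℝ (density (g s)) oneS)) := fun s hs => by
    rw [← hw.eq s hs]
    exact (tendsto_massMoment.1 (g s)).inner tendsto_const_nhds
  have e1 : ∀ s, 0 ≤ s → ∀ n, momentRate ε (F s) 0 (force e F s) (gauss (etaSeq n))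
      = momentRate ε (mulV rootM (g s)) (mulV rootM 0) (mulV rootM (force e g s))
        (gauss (etaSeq n)) := fun s hs n => by
    rw [hw.eq s hs, hw.force_eq he hs, map_zero]
  have l2 := tendsto_integral_exp_mul (Λ₀ := fun _ => 0) (K := ε⁻¹ * (P * (R + c * R) * ‖oneS‖))
    (Λ := fun n s => -ε⁻¹ * inner ℝ (momentRate ε (F s) 0 (force e F s) (gauss (etaSeq n))) oneS)
    (fun n => by unfold momentRate; fun_prop) 0 ht
    (fun n s hs => by
      rw [abs_mul, abs_neg, abs_of_pos (inv_pos.2 hε)]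
      refine mul_le_mul_of_nonneg_left ((abs_real_inner_le_norm _ _).trans ?_) (inv_pos.2 hε).le
      refine mul_le_mul_of_nonneg_right ?_ (norm_nonneg _)
      rw [e1 s hs.1]
      refine (hb n _ _ _).trans (mul_le_mul_of_nonneg_left ?_ hP)
      have a1 := norm_force_le (g := g) he s
      have a2 := (hR s hs).1
      have a3 := mul_le_mul_of_nonneg_left a2 hc0
      rw [norm_zero]
      linarith)
    (fun s hs => by
      simp only [e1 s hs.1]
      have := ((hl (g s) 0 (force e g s)).inner (𝕜 := ℝ)
        (tendsto_const_nhds (x := oneS))).const_mul (-ε⁻¹)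
      rwa [map_zero momentum, inner_zero_left, mul_zero] at this)
  simp only [zero_mul, Real.exp_zero, one_mul, intervalIntegral.integral_zero] at l2
  have l3 := ((l1 0 le_rfl).add l2).congr fun n => (key n).symm
  rw [add_zero] at l3
  exact tendsto_nhds_unique (l1 t ht) l3

/-- The limit of the growth rate of
`‖h‖² + ‖∂ₓh‖² + 2 a ε ⟨∫ v h √M dv, ∂ₓ ∫ h √M dv⟩`, weighted with `exp (r t)`. -/
def totalGrowth (ε r c a : ℝ) (h hx k : PhaseL2) : ℝ :=
  (r + 3 * c ^ 2) * ‖h‖ ^ 2 + (r + 2 * c ^ 2) * ‖hx‖ ^ 2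
    - (ε ^ 2)⁻¹ * ((‖h‖ ^ 2 - ‖density h‖ ^ 2) + (‖hx‖ ^ 2 - ‖density hx‖ ^ 2))
    + 2 * a * (r * ε * inner ℝ (momentum h) (density hx) + limitRate ε h hx k)

lemma tendsto_growth (ε r : ℝ) (h : PhaseL2) :
    Tendsto (fun n => growth ε (etaSeq n) r (mulV rootM h)) atTop
      (𝓝 (r * ‖h‖ ^ 2 - (ε ^ 2)⁻¹ * (‖h‖ ^ 2 - ‖density h‖ ^ 2))) := by
  have := (((tendsto_energy_rootM h).const_mul r).sub
    ((tendsto_microEnergy_rootM h).const_mul (ε ^ 2)⁻¹)).add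
    ((tendsto_defect_rootM h).const_mul (3 * (ε ^ 2)⁻¹))
  rw [mul_zero, add_zero] at this
  exact this

lemma abs_growth_le (ε r : ℝ) {η : ℝ} (hη : 0 < η) (h : PhaseL2) :
    |growth ε η r (mulV rootM h)| ≤ (|r| + 4 * (ε ^ 2)⁻¹) * ‖h‖ ^ 2 := by
  have h1 := energy_nonneg hη (mulV rootM h)
  have h2 := energy_rootM_le hη h
  have h3 := microEnergy_nonneg hη (mulV rootM h)
  have h4 := defect_le_energy hη (mulV rootM h)
  have h5 : 0 ≤ defect η (mulV rootM h) :=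
    inner_mulL_nonneg (bdd_defect hη).comp_snd (fun z => by
      have := regWeight_pos hη z.2
      have := one_add_sq_pos z.2
      positivity) _
  have h6 : microEnergy η (mulV rootM h) ≤ ‖h‖ ^ 2 := by
    rw [microEnergy_rootM hη]
    have h7 : inner ℝ (mulV (fun v => (maxwellian v * regWeight η v) ^ 2) h) h ≤ ‖h‖ ^ 2 := by
      rw [← real_inner_self_eq_norm_sq]
      nth_rw 3 [← mulL_one h]
      refine inner_mulL_mono ?_ (.const 1) (fun z => ?_) h
      · have := ((bdd_maxwellian_mul_regWeight hη).mul (bdd_maxwellian_mul_regWeight hη)).comp_snd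
        simpa only [pow_two] using this
      · simp only
        rw [← sq_abs]
        exact pow_le_one₀ (abs_nonneg _) (abs_maxwellian_mul_regWeight_le hη _)
    linarith [sq_nonneg ‖moment (mulL (fun v => maxwellian v * regWeight η v)
      (toL2 volume rootM)) h‖]
  have h8 : 0 ≤ (ε ^ 2)⁻¹ := by positivity
  have k1 := abs_mul r (energy η (mulV rootM h))
  rw [abs_of_nonneg h1] at k1
  have k2 := mul_le_mul_of_nonneg_left h2 (abs_nonneg r)
  have k3 := mul_le_mul_of_nonneg_left h6 h8
  have k4 := mul_le_mul_of_nonneg_left (h4.trans h2) h8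
  have k5 := mul_nonneg h8 h3
  have k6 := mul_nonneg h8 h5
  have k7 := abs_le.1 k1.le
  rw [growth, abs_le]
  have := sq_nonneg ‖h‖
  have := mul_nonneg h8 this
  constructor <;> nlinarith [k7.1, k7.2]

/-- If the limiting growth rate is never positive, the weighted functional decreases. -/
theorem IsWeighted.functional_le (hw : IsWeighted F Fx g gx) (hε : 0 < ε)
    (h : Sol ε F Fx Fv (force e F)) (he : IsField e c) (r a : ℝ) {t : ℝ} (ht : 0 ≤ t)
    (hΛ : ∀ s ∈ Icc 0 t, totalGrowth ε r c a (g s) (gx s) (force e g s) ≤ 0) :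
    Real.exp (r * t) * (‖g t‖ ^ 2 + ‖gx t‖ ^ 2
        + 2 * a * ε * inner ℝ (momentum (g t)) (density (gx t)))
      ≤ ‖g 0‖ ^ 2 + ‖gx 0‖ ^ 2 + 2 * a * ε * inner ℝ (momentum (g 0)) (density (gx 0)) := by
  have hF := h.cont
  have hFx := h.contX
  have hG := h.contG
  obtain ⟨R, hR⟩ := hw.bound t
  have hR0 : 0 ≤ R := (norm_nonneg _).trans (hR 0 ⟨le_rfl, ht⟩).1
  have hc0 := he.nonneg
  obtain ⟨P, hP, hPb⟩ := exists_abs_crossTerm_le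
  obtain ⟨Q, hQ, hQb⟩ := exists_abs_crossRate_le hε
  -- growth rate of the regularized functional, with `η = etaSeq n`
  let Λ : ℕ → ℝ → ℝ := fun n s => growth ε (etaSeq n) (r + c ^ 2) (F s)
    + (growth ε (etaSeq n) (r + 2 * c ^ 2) (Fx s) + 2 * c ^ 2 * energy (etaSeq n) (F s))
    + 2 * a * ε * (r * crossTerm (etaSeq n) (F s) (Fx s)
      + ε⁻¹ * crossRate ε (etaSeq n) (F s) (Fx s) (force e F s))
  have c1 : ∀ n, Continuous fun s => growth ε (etaSeq n) (r + c ^ 2) (F s) := fun n =>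
    (continuous_growth ε (etaSeq n) _).comp hF
  have c2 : ∀ n, Continuous fun s => growth ε (etaSeq n) (r + 2 * c ^ 2) (Fx s)
      + 2 * c ^ 2 * energy (etaSeq n) (F s) := fun n =>
    ((continuous_growth ε (etaSeq n) _).comp hFx).add
      (((continuous_energy (etaSeq n)).comp hF).const_mul _)
  have c3 : ∀ n, Continuous fun s => crossTerm (etaSeq n) (F s) (Fx s) := fun n => by
    unfold crossTerm; fun_prop
  have c4 : ∀ n, Continuous fun s => ε⁻¹ * crossRate ε (etaSeq n) (F s) (Fx s) (force e F s) :=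
    fun n => by unfold crossRate momentRate; fun_prop
  have hΛc : ∀ n, Continuous (Λ n) := fun n =>
    ((c1 n).add (c2 n)).add ((((c3 n).const_mul r).add (c4 n)).const_mul _)
  have key : ∀ n, Real.exp (r * t) * (energy (etaSeq n) (F t) + energy (etaSeq n) (Fx t)
      + 2 * a * ε * crossTerm (etaSeq n) (F t) (Fx t))
      ≤ (energy (etaSeq n) (F 0) + energy (etaSeq n) (Fx 0)
        + 2 * a * ε * crossTerm (etaSeq n) (F 0) (Fx 0))
        + ∫ s in (0 : ℝ)..t, Real.exp (r * s) * Λ n s := fun n => by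
    have k1 := h.energy_le_of_field hε he (etaSeq_pos n) r ht
    have k2 := h.energy_deriv_le_of_field hε he (etaSeq_pos n) r ht
    have k3 := exp_mul_eq_add_integral (c3 n) (c4 n)
      (fun s hs => h.hasDerivWithinAt_crossTerm hε (etaSeq_pos n) hs) r ht
    have k4 : ∫ s in (0 : ℝ)..t, Real.exp (r * s) * Λ n s
        = (∫ s in (0 : ℝ)..t, Real.exp (r * s) * growth ε (etaSeq n) (r + c ^ 2) (F s))
        + (∫ s in (0 : ℝ)..t, Real.exp (r * s) * (growth ε (etaSeq n) (r + 2 * c ^ 2) (Fx s)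
          + 2 * c ^ 2 * energy (etaSeq n) (F s)))
        + 2 * a * ε * ∫ s in (0 : ℝ)..t, Real.exp (r * s) * (r * crossTerm (etaSeq n) (F s) (Fx s)
          + ε⁻¹ * crossRate ε (etaSeq n) (F s) (Fx s) (force e F s)) := by
      exact integral_exp_mul_add r t (c1 n) (c2 n) (((c3 n).const_mul r).add (c4 n)) _
    rw [k4]
    linear_combination k1 + k2 + (2 * a * ε) * k3
  -- limit `η → 0` of the functional and of its growth rate
  have lZ : ∀ s, 0 ≤ s → Tendsto (fun n => energy (etaSeq n) (F s) + energy (etaSeq n) (Fx s)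
      + 2 * a * ε * crossTerm (etaSeq n) (F s) (Fx s)) atTop (𝓝 (‖g s‖ ^ 2 + ‖gx s‖ ^ 2
        + 2 * a * ε * inner ℝ (momentum (g s)) (density (gx s)))) := fun s hs => by
    rw [← hw.eq s hs, ← hw.eqX s hs]
    exact ((tendsto_energy_rootM _).add (tendsto_energy_rootM _)).add
      ((tendsto_crossTerm _ _).const_mul _)
  have lΛ : ∀ s ∈ Icc 0 t, Tendsto (fun n => Λ n s) atTop
      (𝓝 (totalGrowth ε r c a (g s) (gx s) (force e g s))) := fun s hs => by
    simp only [Λ]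
    rw [← hw.force_eq he hs.1, ← hw.eq s hs.1, ← hw.eqX s hs.1]
    have := ((tendsto_growth ε (r + c ^ 2) (g s)).add ((tendsto_growth ε (r + 2 * c ^ 2) (gx s)).add
      ((tendsto_energy_rootM (g s)).const_mul (2 * c ^ 2)))).add
      ((((tendsto_crossTerm (g s) (gx s)).const_mul r).add
        ((tendsto_crossRate hε (g s) (gx s) (force e g s)).const_mul ε⁻¹)).const_mul (2 * a * ε))
    convert this using 2
    rw [totalGrowth]
    field_simp
    ring
  -- a bound uniform in `η`, for dominated convergence in the time integral
  have bΛ : ∃ K, ∀ n, ∀ s ∈ Icc 0 t, |Λ n s| ≤ K := by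
    refine ⟨(|r + c ^ 2| + 4 * (ε ^ 2)⁻¹) * R ^ 2
      + ((|r + 2 * c ^ 2| + 4 * (ε ^ 2)⁻¹) * R ^ 2 + 2 * c ^ 2 * R ^ 2)
      + |2 * a * ε| * (|r| * (P * (R * R)) + ε⁻¹ * (Q * ((R + R + c * R) * R))), fun n s hs => ?_⟩
    obtain ⟨b1, b2⟩ := hR s hs
    have b3 : ‖force e g s‖ ≤ c * R :=
      (norm_force_le he s).trans (mul_le_mul_of_nonneg_left b1 hc0)
    simp only [Λ]
    rw [← hw.force_eq he hs.1, ← hw.eq s hs.1, ← hw.eqX s hs.1]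
    refine (abs_add_le _ _).trans (add_le_add ((abs_add_le _ _).trans (add_le_add ?_
      ((abs_add_le _ _).trans (add_le_add ?_ ?_)))) ?_)
    · exact (abs_growth_le ε _ (etaSeq_pos n) _).trans (by gcongr)
    · exact (abs_growth_le ε _ (etaSeq_pos n) _).trans (by gcongr)
    · rw [abs_of_nonneg (mul_nonneg (by positivity) (energy_nonneg (etaSeq_pos n) _))]
      exact mul_le_mul_of_nonneg_left ((energy_rootM_le (etaSeq_pos n) _).trans (by gcongr))
        (by positivity)
    · rw [abs_mul]
      refine mul_le_mul_of_nonneg_left ((abs_add_le _ _).trans (add_le_add ?_ ?_)) (abs_nonneg _)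
      · rw [abs_mul]
        exact mul_le_mul_of_nonneg_left ((hPb n _ _).trans (by gcongr)) (abs_nonneg _)
      · rw [abs_mul, abs_of_pos (inv_pos.2 hε)]
        exact mul_le_mul_of_nonneg_left ((hQb n _ _ _).trans (by gcongr)) (inv_pos.2 hε).le
  obtain ⟨K, hK⟩ := bΛ
  have lI := tendsto_integral_exp_mul hΛc r ht hK lΛ
  have h0 : ∫ s in (0 : ℝ)..t, Real.exp (r * s)
      * totalGrowth ε r c a (g s) (gx s) (force e g s) ≤ 0 := by
    rw [intervalIntegral.integral_of_le ht]
    refine setIntegral_nonpos measurableSet_Ioc fun s hs => ?_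
    exact mul_nonpos_of_nonneg_of_nonpos (Real.exp_pos _).le (hΛ s (Ioc_subset_Icc_self hs))
  have := le_of_tendsto_of_tendsto' ((lZ t ht).const_mul _) ((lZ 0 le_rfl).add lI) key
  linarith

/-! ### Decay of the functional -/

/-- The quadratic form that bounds the growth rate is negative: in terms of `u = y₀ / ε` and
`w = y₁ / ε` its diagonal dominates. -/
lemma quadratic_form_nonpos {ε r C a y₀ y₁ S ρ p H : ℝ} (hε : 0 < ε) (hε1 : ε ≤ 1) (hr : 0 ≤ r)
    (hC : 0 ≤ C) (hC1 : C ≤ 1 / 32) (ha : 0 < a) (ha1 : a < 1 / 16)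
    (hr1 : r * ε ^ 2 ≤ 1 / 2 - 2 * C - 8 * a) (hr2 : 4 * r ≤ 3 * a - 2 * (a * C) - 4 * C)
    (hy₀ : 0 ≤ y₀) (hS : 0 ≤ S) (hρ : 0 ≤ ρ) (hρS : ρ ≤ S)
    (hH : H ^ 2 = ρ ^ 2 + y₀ ^ 2) (hp : p ^ 2 ≤ 2 * y₁ ^ 2) :
    (r + 3 * (C / 2) ^ 2) * H ^ 2 + (r + 2 * (C / 2) ^ 2) * (S ^ 2 + y₁ ^ 2)
      - (ε ^ 2)⁻¹ * (y₀ ^ 2 + y₁ ^ 2)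
      + 2 * a * (r * ε * (y₀ * S)
        + (y₁ ^ 2 + p * S - S ^ 2 + C / 2 * H * S + ε⁻¹ * (y₀ * S))) ≤ 0 := by
  obtain ⟨u, hu⟩ : ∃ u, u = y₀ / ε := ⟨_, rfl⟩
  obtain ⟨w, hw⟩ : ∃ w, w = y₁ / ε := ⟨_, rfl⟩
  have hu0 : 0 ≤ u := by rw [hu]; positivity
  have e0 : y₀ = ε * u := by rw [hu]; field_simp
  have e1 : y₁ = ε * w := by rw [hw]; field_simp
  have hH1 : H ≤ S + y₀ := by
    refine abs_le_of_sq_le_sq' (a := H) ?_ (by linarith) |>.2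
    nlinarith [mul_nonneg hS hy₀]
  have hε2 : ε ^ 2 ≤ 1 := pow_le_one₀ hε.le hε1
  have hy₀u : y₀ ≤ u := by rw [e0]; exact mul_le_of_le_one_left hu0 hε1
  have uS := mul_nonneg hu0 hS
  have hC2 : C ^ 2 ≤ C / 32 := by nlinarith
  have aC := mul_nonneg ha.le hC
  -- the coefficients of the squares
  have t1 : (r + 3 * (C / 2) ^ 2) * H ^ 2 ≤ (r + 3 * (C / 2) ^ 2) * S ^ 2
      + (1 / 2 - C - 8 * a) * u ^ 2 := by
    have h1 : ρ ^ 2 ≤ S ^ 2 := by gcongr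
    have h2 : (r + 3 * (C / 2) ^ 2) * ρ ^ 2 ≤ (r + 3 * (C / 2) ^ 2) * S ^ 2 := by gcongr
    have h3 : (r + 3 * (C / 2) ^ 2) * y₀ ^ 2 ≤ (1 / 2 - C - 8 * a) * u ^ 2 := by
      rw [e0, mul_pow, ← mul_assoc]
      refine mul_le_mul_of_nonneg_right ?_ (sq_nonneg u)
      nlinarith
    rw [hH]
    linarith
  have t2 : (r + 2 * (C / 2) ^ 2 + 2 * a) * y₁ ^ 2 ≤ (1 / 2 - C - 6 * a) * w ^ 2 := by
    rw [e1, mul_pow, ← mul_assoc]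
    refine mul_le_mul_of_nonneg_right ?_ (sq_nonneg w)
    nlinarith
  have t3 : (ε ^ 2)⁻¹ * (y₀ ^ 2 + y₁ ^ 2) = u ^ 2 + w ^ 2 := by
    rw [e0, e1]
    field_simp
  -- the mixed terms
  have t4 : r * ε * (y₀ * S) ≤ 1 / 2 * (u * S) := by
    rw [show r * ε * (y₀ * S) = r * ε ^ 2 * (u * S) by rw [e0]; ring]
    exact mul_le_mul_of_nonneg_right (by linarith) uS
  have t5 : C / 2 * H * S ≤ C / 2 * (S ^ 2 + u * S) := by
    rw [mul_assoc]
    refine mul_le_mul_of_nonneg_left ?_ (by positivity)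
    have := mul_le_mul_of_nonneg_right (hH1.trans (add_le_add_right hy₀u S)) hS
    linarith
  have t6 : ε⁻¹ * (y₀ * S) = u * S := by
    rw [e0]
    field_simp
  have t7 : p ^ 2 ≤ 2 * w ^ 2 := by
    refine hp.trans ?_
    rw [e1, mul_pow]
    nlinarith [sq_nonneg w]
  -- completing squares
  have q1 : 0 ≤ a * (1 / 2 * S - 32 / 10 * u) ^ 2 := by positivity
  have q2 : 0 ≤ a * (1 / 2 * S - 2 * p) ^ 2 := by positivity
  have m1 := mul_le_mul_of_nonneg_left t4 ha.le
  have m2 := mul_le_mul_of_nonneg_left t5 ha.le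
  have m3 := mul_le_mul_of_nonneg_left t7 ha.le
  have m4 := mul_le_mul_of_nonneg_right ha1.le (sq_nonneg u)
  have m5 := mul_le_mul_of_nonneg_right ha1.le (sq_nonneg w)
  have m6 : a * C * (u * S) ≤ a * (1 / 32) * (u * S) := by gcongr
  have m7 := mul_le_mul_of_nonneg_right hr2 (sq_nonneg S)
  have m8 := mul_le_mul_of_nonneg_right hC2 (sq_nonneg S)
  have m9 := mul_nonneg hC (sq_nonneg S)
  have m10 := mul_nonneg hC (sq_nonneg u)
  have m11 := mul_nonneg hC (sq_nonneg w)
  have m12 := mul_nonneg ha.le uS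
  have s1 := sq_nonneg u
  have s2 := sq_nonneg w
  rw [t3, t6]
  linarith only [t1, t2, q1, q2, m1, m2, m3, m4, m5, m6, m7, m8, m9, m10, m11, m12, s1, s2]

/-- The limiting growth rate at a function of mean zero: it is bounded by the quadratic form with
`y₀`, `y₁` the norms of the microscopic parts of `h` and `∂ₓh`, and `S`, `ρ` the norms of `∂ₓ` of
the density and of the density. -/
lemma totalGrowth_nonpos {ε r C a : ℝ} (hε : 0 < ε) (hε1 : ε ≤ 1) (hr : 0 ≤ r)
    (hC : 0 ≤ C) (hC1 : C ≤ 1 / 32) (ha : 0 < a) (ha1 : a < 1 / 16)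
    (hr1 : r * ε ^ 2 ≤ 1 / 2 - 2 * C - 8 * a) (hr2 : 4 * r ≤ 3 * a - 2 * (a * C) - 4 * C)
    {h hx k : PhaseL2} (hg : Gen rotX h hx) (h0 : inner ℝ (density h) oneS = 0)
    (hk : ‖k‖ ≤ C / 2 * ‖h‖) : totalGrowth ε r (C / 2) a h hx k ≤ 0 := by
  have hy := norm_density_le h
  have hy1 := norm_density_le hx
  have hm := norm_momentum_sq_le h
  have hm1 := norm_momentum_sq_le hx
  have hpd := norm_pressure_sub_density_sq_le hx
  have e0 := Real.sq_sqrt (sub_nonneg.2 hy)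
  have e1 := Real.sq_sqrt (sub_nonneg.2 hy1)
  set y₀ := √(‖h‖ ^ 2 - ‖density h‖ ^ 2) with hy₀
  set y₁ := √(‖hx‖ ^ 2 - ‖density hx‖ ^ 2)
  have hm0 : ‖momentum h‖ ≤ y₀ := Real.le_sqrt_of_sq_le hm
  have key := quadratic_form_nonpos hε hε1 hr hC hC1 ha ha1 hr1 hr2 (Real.sqrt_nonneg _)
    (norm_nonneg (density hx)) (norm_nonneg (density h)) (norm_le_of_gen_rotS (gen_density hg) h0)
    (y₀ := y₀) (y₁ := y₁) (p := ‖pressure hx - density hx‖) (H := ‖h‖)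
    (by rw [e0]; ring) (by rw [e1]; exact hpd)
  have a1 : inner ℝ (momentum h) (density hx) ≤ y₀ * ‖density hx‖ :=
    (real_inner_le_norm _ _).trans (mul_le_mul_of_nonneg_right hm0 (norm_nonneg _))
  have a2 : -inner ℝ (momentum h) (density hx) ≤ y₀ * ‖density hx‖ :=
    (neg_le_abs _).trans ((abs_real_inner_le_norm _ _).trans
      (mul_le_mul_of_nonneg_right hm0 (norm_nonneg _)))
  have a3 : -inner ℝ (density k) (density hx) ≤ C / 2 * ‖h‖ * ‖density hx‖ := by
    refine (neg_le_abs _).trans ((abs_real_inner_le_norm _ _).trans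
      (mul_le_mul_of_nonneg_right (le_trans ?_ hk) (norm_nonneg _)))
    exact (pow_le_pow_iff_left₀ (norm_nonneg _) (norm_nonneg _) two_ne_zero).1 (norm_density_le k)
  have a4 : -inner ℝ (pressure hx) (density hx)
      ≤ ‖pressure hx - density hx‖ * ‖density hx‖ - ‖density hx‖ ^ 2 := by
    have h1 := (neg_le_abs _).trans
      (abs_real_inner_le_norm (pressure hx - density hx) (density hx))
    rw [inner_sub_left, real_inner_self_eq_norm_sq] at h1
    linarith
  have a5 : limitRate ε h hx k ≤ y₁ ^ 2 + ‖pressure hx - density hx‖ * ‖density hx‖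
      - ‖density hx‖ ^ 2 + C / 2 * ‖h‖ * ‖density hx‖ + ε⁻¹ * (y₀ * ‖density hx‖) := by
    have h1 := mul_le_mul_of_nonneg_left a2 (inv_pos.2 hε).le
    rw [limitRate, inner_add_left, inner_add_left, inner_smul_left, RCLike.conj_to_real]
    linarith
  have a6 := mul_le_mul_of_nonneg_left a1 (mul_nonneg hr hε.le)
  have a7 := mul_le_mul_of_nonneg_left (add_le_add a6 a5) (by positivity : 0 ≤ 2 * a)
  rw [totalGrowth, ← e0, ← e1]
  have e2 : ‖hx‖ ^ 2 = ‖density hx‖ ^ 2 + y₁ ^ 2 := by rw [e1]; ring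
  rw [e2]
  linarith

/-- The cross term is a small perturbation of the norm. -/
lemma abs_cross_le {ε a : ℝ} (hε : 0 < ε) (hε1 : ε ≤ 1) (ha : 0 < a) (h hx : PhaseL2) :
    |2 * a * ε * inner ℝ (momentum h) (density hx)| ≤ a * (‖h‖ ^ 2 + ‖hx‖ ^ 2) := by
  have h1 : ‖momentum h‖ ≤ ‖h‖ := (pow_le_pow_iff_left₀ (norm_nonneg _) (norm_nonneg _)
    two_ne_zero).1 ((norm_momentum_sq_le h).trans (by linarith [sq_nonneg ‖density h‖]))
  have h2 : ‖density hx‖ ≤ ‖hx‖ := (pow_le_pow_iff_left₀ (norm_nonneg _) (norm_nonneg _)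
    two_ne_zero).1 (norm_density_le hx)
  rw [abs_mul, abs_of_pos (by positivity)]
  calc 2 * a * ε * |inner ℝ (momentum h) (density hx)|
      ≤ 2 * a * 1 * (‖h‖ * ‖hx‖) := by
        gcongr
        exact (abs_real_inner_le_norm _ _).trans (by gcongr)
    _ ≤ _ := by nlinarith [sq_nonneg (‖h‖ - ‖hx‖)]

variable {ε : ℝ} {F Fx Fv : ℝ → PhaseL2} {e : ℝ → ℝ → ℝ} {g gx : ℝ → PhaseL2}

/-- Decay of the norm. The factor arises from `(1 + a) / (1 - a) ≤ 5 / 4`, which holds for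
`a ≤ 1 / 9`. -/
theorem IsWeighted.norm_sq_le {r C a : ℝ} (hε : 0 < ε) (hε1 : ε ≤ 1) (hr : 0 ≤ r)
    (hC1 : C ≤ 1 / 32) (ha : 0 < a) (ha1 : a < 1 / 16)
    (hr1 : r * ε ^ 2 ≤ 1 / 2 - 2 * C - 8 * a) (hr2 : 4 * r ≤ 3 * a - 2 * (a * C) - 4 * C)
    (hw : IsWeighted F Fx g gx) (h : Sol ε F Fx Fv (force e F)) (he : IsField e (C / 2))
    (h0 : inner ℝ (density (g 0)) oneS = 0) {t : ℝ} (ht : 0 ≤ t) :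
    ‖g t‖ ^ 2 + ‖gx t‖ ^ 2 ≤ 5 / 4 * Real.exp (-r * t) * (‖g 0‖ ^ 2 + ‖gx 0‖ ^ 2) := by
  have hC : 0 ≤ C := by linarith [he.nonneg]
  have key := hw.functional_le hε h he r a ht fun s hs =>
    totalGrowth_nonpos hε hε1 hr hC hC1 ha ha1 hr1 hr2 (hw.gen h hs.1)
      ((hw.mass_eq hε h he hs.1).trans h0) (norm_force_le he s)
  have b1 := (abs_le.1 (abs_cross_le hε hε1 ha (g t) (gx t))).1
  have b2 := (abs_le.1 (abs_cross_le hε hε1 ha (g 0) (gx 0))).2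
  have hexp := Real.exp_pos (r * t)
  have b3 : Real.exp (r * t) * ((1 - a) * (‖g t‖ ^ 2 + ‖gx t‖ ^ 2))
      ≤ (1 + a) * (‖g 0‖ ^ 2 + ‖gx 0‖ ^ 2) := by
    refine le_trans (mul_le_mul_of_nonneg_left ?_ hexp.le) (key.trans ?_) <;> linarith
  have v0 : 0 ≤ ‖g 0‖ ^ 2 + ‖gx 0‖ ^ 2 := by positivity
  have b4 : Real.exp (r * t) * (‖g t‖ ^ 2 + ‖gx t‖ ^ 2)
      ≤ 5 / 4 * (‖g 0‖ ^ 2 + ‖gx 0‖ ^ 2) := by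
    have b5 : (1 - a) * (Real.exp (r * t) * (‖g t‖ ^ 2 + ‖gx t‖ ^ 2))
        ≤ (1 - a) * (5 / 4 * (‖g 0‖ ^ 2 + ‖gx 0‖ ^ 2)) := by nlinarith
    exact le_of_mul_le_mul_left b5 (by linarith)
  rw [neg_mul, Real.exp_neg]
  rw [mul_right_comm, ← div_eq_mul_inv, le_div_iff₀ hexp]
  linarith

/-! ### The weighted norm -/

lemma lintegral_ofReal_sq (h : PhaseL2) :
    ∫⁻ z, ENNReal.ofReal (h z ^ 2) ∂phaseMeasure = ENNReal.ofReal (‖h‖ ^ 2) := by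
  rw [norm_sq_eq_integral, ofReal_integral_eq_lintegral_ofReal (Lp.memLp h).integrable_sq
    (Eventually.of_forall fun z => sq_nonneg _)]

lemma weighted_eq_div (u : ℝ × ℝ → ℝ) : weighted u = fun z => u z / rootM z.2 := rfl

lemma weighted_ae_eq {F h : PhaseL2} (hF : mulV rootM h = F) :
    weighted F =ᵐ[phaseMeasure] h := by
  filter_upwards [mulL_coe (μ := phaseMeasure) bdd_rootM.comp_snd h] with z hz
  rw [hF] at hz
  rw [weighted_eq_div]
  simp only
  rw [hz, mul_div_cancel_left₀ _ (rootM_pos _).ne']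

lemma hasWeakPartial_weighted {u ux : ℝ × ℝ → ℝ} (h : HasWeakPartial u (1, 0) ux) :
    HasWeakPartial (weighted u) (1, 0) (weighted ux) := by
  have h1 := h.mul_snd (b := fun v => (rootM v)⁻¹)
    (contDiff_rootM.inv fun v => (rootM_pos v).ne')
  refine h1.congr (Eventually.of_forall fun z => ?_) (Eventually.of_forall fun z => ?_)
  · simp only [weighted_eq_div, div_eq_inv_mul]
  · simp only [weighted_eq_div, div_eq_inv_mul, zero_mul, add_zero]

lemma vNormSq_weighted {F Fx : PhaseL2} (hx : HasWeakPartial F (1, 0) Fx) :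
    vNormSq (weighted F) = (∫⁻ z, ENNReal.ofReal (weighted F z ^ 2) ∂phaseMeasure)
      + ∫⁻ z, ENNReal.ofReal (weighted Fx z ^ 2) ∂phaseMeasure := by
  have hw := hasWeakPartial_weighted hx
  rw [vNormSq]
  congr 1
  refine le_antisymm (iInf₂_le _ hw) (le_iInf₂ fun u hu => le_of_eq ?_)
  refine lintegral_congr_ae ?_
  filter_upwards [hw.unique hu] with z hz
  rw [hz]

/-- The `V`-norm of `F / √M`: both its value and its `x`-derivative are the given `L²` functions. -/
lemma vNormSq_weighted_eq {F Fx h hx : PhaseL2} (hd : HasWeakPartial F (1, 0) Fx)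
    (hF : mulV rootM h = F) (hFx : mulV rootM hx = Fx) :
    vNormSq (weighted F) = ENNReal.ofReal (‖h‖ ^ 2 + ‖hx‖ ^ 2) := by
  rw [vNormSq_weighted hd, ENNReal.ofReal_add (sq_nonneg _) (sq_nonneg _), ← lintegral_ofReal_sq,
    ← lintegral_ofReal_sq]
  congr 1 <;> refine lintegral_congr_ae ?_
  · filter_upwards [weighted_ae_eq hF] with z hz
    rw [hz]
  · filter_upwards [weighted_ae_eq hFx] with z hz
    rw [hz]

lemma exists_rootM_of_lintegral_ne_top {F : PhaseL2}
    (h : ∫⁻ z, ENNReal.ofReal (weighted F z ^ 2) ∂phaseMeasure ≠ ⊤) :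
    ∃ h : PhaseL2, mulV rootM h = F := by
  have hmeas : Measurable (weighted F) :=
    (measurable_Lp F).div (contDiff_rootM.continuous.measurable.comp measurable_snd)
  have hm : MemLp (weighted F) 2 phaseMeasure := by
    refine (memLp_two_iff_integrable_sq hmeas.aestronglyMeasurable).2
      ⟨(hmeas.pow_const 2).aestronglyMeasurable, ?_⟩
    rw [hasFiniteIntegral_iff_ofReal (Eventually.of_forall fun z => sq_nonneg _)]
    exact h.lt_top
  refine ⟨toL2 phaseMeasure (weighted F), Lp.ext ?_⟩
  filter_upwards [mulL_coe (μ := phaseMeasure) bdd_rootM.comp_snd (toL2 phaseMeasure (weighted F)),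
    toL2_coe hm] with z h1 h2
  rw [h1, h2, weighted_eq_div]
  simp only
  rw [mul_div_cancel₀ _ (rootM_pos _).ne']

lemma inner_density_oneS {F h : PhaseL2} (hF : mulV rootM h = F) :
    inner ℝ (density h) oneS = ∫ z, F z ∂phaseMeasure := by
  rw [density, inner_moment, inner_eq_integral]
  refine integral_congr_ae ?_
  filter_upwards [tensor_coe oneS (toL2 volume rootM), ae_fst oneS_coe,
    ae_snd (toL2_coe memLp_rootM),
    mulL_coe (μ := phaseMeasure) bdd_rootM.comp_snd h] with z h1 h2 h3 h4
  rw [h1, h2, h3, ← hF, h4]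
  ring

end VFP

end

theorem mainTheorem2
    (ε lam C_s C_E a : ℝ) (hε : 0 < ε) (hε1 : ε ≤ 1)
    (hlam : 0 < lam) (hlam1 : lam ≤ 1 / 4) (hCs : 0 < C_s) (hCs1 : C_s ≤ 1)
    (E : ℝ → ℝ → ℝ) (hE : VFP.FieldAssumption E C_E lam C_s)
    (K : Matrix (Fin 2) (Fin 2) ℝ) (hK : K = !![0, 1; 1, 0])
    (f : ℝ → MeasureTheory.Lp ℝ 2 VFP.phaseMeasure)
    (hf : VFP.IsWeakSolution ε E K f)
    (hint : MeasureTheory.Integrable (f 0) VFP.phaseMeasure)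
    (hmass : ∫ z, f 0 z ∂VFP.phaseMeasure = 0)
    (ha : 4 * C_E / (3 * C_s - 2 * C_E) < a) (ha' : a < (lam - C_E) / 4) :
    0 < VFP.rate ε lam C_s C_E a ∧
      ∀ t : ℝ, 0 ≤ t →
        VFP.vNormSq (VFP.weighted (f t)) ≤
          ENNReal.ofReal (5 / 4 * Real.exp (-2 * VFP.rate ε lam C_s C_E a * t)) *
            VFP.vNormSq (VFP.weighted (f 0)) := by
  have he := VFP.isField_fieldExt hE
  have hC : 0 ≤ C_E := by linarith [he.nonneg]
  -- the admissible ranges force `C_E ≤ 1 / 32` and `a < 1 / 16`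
  have hlC : lam * C_s ≤ 1 / 4 := by nlinarith
  have hlC' : lam * C_s ≤ C_s / 4 := by nlinarith
  have hsmall := hE.small
  have hC1 : C_E ≤ 1 / 32 := by linarith
  have hden : 0 < 3 * C_s - 2 * C_E := by linarith
  have ha0 : 0 < a := lt_of_le_of_lt (by positivity) ha
  have ha1 : a < 1 / 16 := by linarith
  have hξ1 : 0 < a * (3 * C_s - 2 * C_E) - 4 * C_E := by
    rw [div_lt_iff₀ hden] at ha
    linarith
  have hε2 : 0 < ε ^ 2 := by positivity
  have hξ : 0 < VFP.rate ε lam C_s C_E a :=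
    lt_min (div_pos (by linarith) hε2) (by linarith)
  refine ⟨hξ, fun t ht => ?_⟩
  have hr1 : VFP.rate ε lam C_s C_E a * ε ^ 2 ≤ lam - C_E - 4 * a :=
    (le_div_iff₀ hε2).1 (min_le_left _ _)
  have hr2 : VFP.rate ε lam C_s C_E a ≤ (a * (3 * C_s - 2 * C_E) - 4 * C_E) / 8 :=
    min_le_right _ _
  have haC : a * C_s ≤ a := mul_le_of_le_one_right ha0.le hCs1
  set ξ := VFP.rate ε lam C_s C_E a
  obtain ⟨Fx, Fv, hsol, hFx⟩ := hf.exists_sol he hK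
  have hcoef : ENNReal.ofReal (5 / 4 * Real.exp (-2 * ξ * t)) ≠ 0 := by
    rw [ne_eq, ENNReal.ofReal_eq_zero, not_le]
    positivity
  have hx : ∀ s, 0 ≤ s → VFP.HasWeakPartial (f s) (1, 0) (Fx s) := fun s hs => by
    simpa only [max_eq_left hs] using hFx s
  -- an infinite initial norm bounds everything
  by_cases htop : VFP.vNormSq (VFP.weighted (f 0)) = ⊤
  · rw [htop, ENNReal.mul_top hcoef]
    exact le_top
  have hfin := htop
  rw [VFP.vNormSq_weighted (hx 0 le_rfl), ENNReal.add_eq_top, not_or] at hfin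
  obtain ⟨h₀, hh₀⟩ := VFP.exists_rootM_of_lintegral_ne_top hfin.1
  obtain ⟨hx₀, hhx₀⟩ := VFP.exists_rootM_of_lintegral_ne_top hfin.2
  obtain ⟨g, gx, hw⟩ := hsol.exists_isWeighted hε he (h₀ := h₀) (by rw [hh₀, max_self]) hhx₀
  have hg : ∀ s, 0 ≤ s → VFP.mulV VFP.rootM (g s) = f s := fun s hs => by
    simpa only [max_eq_left hs] using hw.eq s hs
  have hnorm : ∀ s, 0 ≤ s → VFP.vNormSq (VFP.weighted (f s))
      = ENNReal.ofReal (‖g s‖ ^ 2 + ‖gx s‖ ^ 2) := fun s hs =>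
    VFP.vNormSq_weighted_eq (hx s hs) (hg s hs) (hw.eqX s hs)
  have h0 : inner ℝ (VFP.density (g 0)) VFP.oneS = 0 := by
    rw [VFP.inner_density_oneS (hg 0 le_rfl), hmass]
  -- `a C_s ≤ a` turns the two bounds on `ξ` into those for the decay rate `2 ξ`
  have key := hw.norm_sq_le (r := 2 * ξ) (a := a) hε hε1 (by linarith) hC1 ha0 ha1
    (by linarith) (by linarith) hsol he h0 ht
  rw [hnorm t ht, hnorm 0 le_rfl, ← ENNReal.ofReal_mul (by positivity)]
  refine ENNReal.ofReal_le_ofReal (key.trans_eq ?_)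
  rw [neg_mul (2 : ℝ) ξ]
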